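/- Let $f_\varepsilon$ be a probability density on $\mathbb R$, $\mu_\varepsilon$ the corresponding law, and $\hat f_\varepsilon(t)=\int_{\mathbb R}e^{\imath tx}f_\varepsilon(x)\,\mathrm dx$. Assume that $\hat f_\varepsilon$ is twice differentiable and that there exist $\beta>0$ and $d_0,d_1,d_2>0$ such that, for $l=0,1,2$, $$|\hat f_\varepsilon^{(l)}(t)|\le d_l(1+|t|)^{-(\beta+l)},\qquad t\in\mathbb R.$$ Let $d\ge 1$ and $\alpha,L,M>0$. Let $\mathcal D_d$ be the set of probability measures $\mu$ on $\mathbb R^d$ with $\int|x|\,\mu(\mathrm dx)\le M$ that have a Lebesgue density $f$ satisfying $$\sum_{j=1}^d\int_{\mathbb R^d}|\hat f(t)|^2(1+t_j^2)^{\alpha}\,\mathrm dt\le L^2,\qquad \hat f(t)=\int_{\mathbb R^d}e^{\imath t\cdot x}f(x)\,\mathrm dx,$$ and assume that $\mathcal D_d$ contains at least two elements. Let $W_1$ be the $L^1$-Wasserstein distance on $\mathbb R^d$ for the Euclidean norm, defined as the infimum of $\int|x-y|\,\gamma(\mathrm dx,\mathrm dy)$ over all couplings $\gamma$ (possibly $+\infty$),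 and let $$\psi_n:=n^{(\alpha+1)/[2\alpha+\max\{2\beta d,\,1\}+1]}.$$ Then there exists $C>0$ such that, for every sequence of estimators $\hat\mu_n$ (measurable maps from $(\mathbb R^d)^n$ to the probability measures on $\mathbb R^d$), $$\liminf_{n\to\infty}\ \psi_n\sup_{\mu\in\mathcal D_d}\mathbb E^n_{\mu}\,W_1(\hat\mu_n,\mu)>C,$$ where $\mathbb E^n_{\mu}$ is the expectation when $\hat\mu_n$ is computed from $n$ i.i.d. observations with law $\mu\ast\mu_\varepsilon^{\otimes d}$. -/

import Mathlib

open MeasureTheory Filter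
open scoped ENNReal

noncomputable section

namespace Deconvolution

/-- The Fourier transform `f̂ t = ∫ exp (i t·x) f x dx` of a real function on `ℝ` or `ℝᵈ`. -/
def fourier {E : Type*} [NormedAddCommGroup E] [InnerProductSpace ℝ E] [MeasureSpace E]
    (f : E → ℝ) (t : E) : ℂ :=
  ∫ x, Complex.exp (Complex.I * ((inner ℝ t x : ℝ) : ℂ)) * (f x : ℂ)

/-- `f` is a probability density on `ℝ` or `ℝᵈ` with respect to Lebesgue measure. -/
structure IsDensity {E : Type*} [MeasureSpace E] (f : E → ℝ) : Prop where
  nonneg : ∀ x, 0 ≤ f x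
  integrable : Integrable f
  integral_eq_one : ∫ x, f x = 1

/-- The measure `f dλ` with Lebesgue density `f`. -/
def ofDensity {E : Type*} [MeasureSpace E] (f : E → ℝ) : Measure E :=
  (volume : Measure E).withDensity (fun x => ENNReal.ofReal (f x))

/-- The isotropic Sobolev class `S_d(α, L)`: integrable `f : ℝᵈ → ℝ` with
`∑ j, ∫ |f̂ t|² (1 + t_j²)^α dt ≤ L²`. -/
def sobolevClass (d : ℕ) (α L : ℝ) : Set (EuclideanSpace ℝ (Fin d) → ℝ) :=
  {f | Integrable f ∧
    ∑ j : Fin d, ∫⁻ t : EuclideanSpace ℝ (Fin d),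
      ENNReal.ofReal (‖fourier f t‖ ^ 2 * (1 + t j ^ 2) ^ α) ≤ ENNReal.ofReal (L ^ 2)}

/-- The class `D_d = P₁(ℝᵈ, M) ∩ S_d(α, L)`: probability measures on `ℝᵈ` with first absolute
moment at most `M`, having a Lebesgue density in `S_d(α, L)`. -/
def mixingClass (d : ℕ) (α L M : ℝ) : Set (Measure (EuclideanSpace ℝ (Fin d))) :=
  {μ | ∫⁻ x, ‖x‖ₑ ∂μ ≤ ENNReal.ofReal M ∧
    ∃ f ∈ sobolevClass d α L, IsDensity f ∧ μ = ofDensity f}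

/-- The `L¹`-Wasserstein distance: infimum over all couplings `γ` of `μ` and `ν` of
`∫ |x - y| dγ(x, y)`, with values in `[0, ∞]`. -/
def W1 {E : Type*} [PseudoEMetricSpace E] [MeasurableSpace E] (μ ν : Measure E) : ℝ≥0∞ :=
  ⨅ γ ∈ {γ : Measure (E × E) | γ.map Prod.fst = μ ∧ γ.map Prod.snd = ν},
    ∫⁻ p, edist p.1 p.2 ∂γ

/-- The law `με^{⊗d}` on `ℝᵈ` of a vector with i.i.d. coordinates of law `με`. -/
def noiseLaw (d : ℕ) (με : Measure ℝ) : Measure (EuclideanSpace ℝ (Fin d)) :=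
  (Measure.pi (fun _ : Fin d => με)).map (WithLp.toLp 2)

/-- The law of `n` i.i.d. observations with common law `μ ∗ με^{⊗d}`. -/
def sampleLaw (d n : ℕ) (με : Measure ℝ) (μ : Measure (EuclideanSpace ℝ (Fin d))) :
    Measure (Fin n → EuclideanSpace ℝ (Fin d)) :=
  Measure.pi (fun _ : Fin n => Measure.conv μ (noiseLaw d με))

/-- An estimator from `n` observations: a measurable map from samples to probability measures. -/
structure IsEstimator {d n : ℕ}
    (m : (Fin n → EuclideanSpace ℝ (Fin d)) → Measure (EuclideanSpace ℝ (Fin d))) : Prop where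
  measurable : Measurable m
  isProbabilityMeasure : ∀ y, IsProbabilityMeasure (m y)

/-- The `W₁`-risk of the estimator `m` when the mixing law is `μ`. -/
def risk {d n : ℕ} (με : Measure ℝ)
    (m : (Fin n → EuclideanSpace ℝ (Fin d)) → Measure (EuclideanSpace ℝ (Fin d)))
    (μ : Measure (EuclideanSpace ℝ (Fin d))) : ℝ≥0∞ :=
  ∫⁻ y, W1 (m y) μ ∂(sampleLaw d n με μ)

/-- The inverse rate `ψ_n = n ^ ((α + 1) / (2 α + (2 β d ∨ 1) + 1))`. -/
def psi (d : ℕ) (α β : ℝ) (n : ℕ) : ℝ :=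
  (n : ℝ) ^ ((α + 1) / (2 * α + max (2 * β * d) 1 + 1))

end Deconvolution

end

/-!
The bound is proved by Assouad's method, with the perturbations doubling as test functions.

Since the class has two elements, the midpoint of two of them lies strictly inside the Sobolev ball
(`exists_interior_density`), so it can be mixed with a small amount of a smooth density with tails
of order `∏ x_j⁻⁴` and then perturbed. The perturbations are `γ` times a tensor product of combs:
in one coordinate a sum of `m` disjoint bumps of width `h` on `[0, 1]`, each kept or dropped, and in
the other coordinates a fixed sum of such bumps. They have frequencies of order `h⁻¹`, hence Sobolev
energy of order `γ² h ^ (-2 * α)`, and stay in the class when `γ` is at most a small multiple of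
`h ^ α` (`exists_perturbed_family`).

Dropping or adding one bump is hard to detect. The bumps are derivatives of order `q + 2` with
`q ≥ β`, so they have no low frequencies, and convolution with the noise shrinks each of the `d`
factors by `h ^ β` in `L²`. The `χ²`-divergence also needs division by the density of the
observations, which is bounded below by a multiple of `∏ (1 + y_j²)⁻²`. The smoothing estimate must
therefore hold with the weight `(1 + y²)²` (`exists_weighted_bound`). Multiplication of a
convolution by `y²` distributes over its factors: powers of `x` times the bumps are again high
derivatives, and `xˡ fε` for `l ≤ 2` has a transform with the same decay as that of `fε`, by the
assumptions on the derivatives of the characteristic function (`noise_moments`). Altogether one flip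
costs a divergence of order `γ² h ^ (2 * β * d + 1)` per observation (`exists_chiSq_bound`), so flips
are undetectable when `n γ² h ^ (2 * β * d + 1)` is small.

On the other side, a signed sum of the same bumps is a Lipschitz function with constant of order
`h⁻¹`. By the easy half of Kantorovich duality its integral bounds `W₁` from below by `h` times the
sum of the errors made on the single bumps, and Assouad's lemma gives a risk of order
`γ h (m h) ^ d` (`exists_minimax_lower_bound`). With `m h` of order one and `γ` of order `h ^ α` this
is `h ^ (α + 1)`. If `2 * β * d ≥ 1`, the choice `h = n ^ (-1 / (2 * α + 2 * β * d + 1))` gives the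
rate. If `2 * β * d < 1`, the rate is `n ^ (-1 / 2)`, and a fixed `h` with `γ` of order
`n ^ (-1 / 2)` suffices (`exists_tuning`).
-/

open MeasureTheory Filter
open scoped ENNReal FourierTransform ContDiff Topology

namespace Deconvolution

/-! ### Information bounds and Wasserstein duality -/

/-- Two-point estimation bound. If the likelihood ratio `R` of `Q` with respect to `P` has
`χ²`-divergence at most `1 / 4`, the event `{|T - a| ≥ |a - b| / 2}` under `P` and its complement
under `Q` have total mass at least `1 / 2`, and on the latter `|T - b| ≥ |a - b| / 2`. -/
theorem two_point_bound {Ω : Type*} [MeasurableSpace Ω] {P Q : Measure Ω}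
    [IsProbabilityMeasure P] [IsProbabilityMeasure Q] {R : Ω → ℝ} (hR : Measurable R)
    (hR0 : ∀ y, 0 ≤ R y) (hQ : Q = P.withDensity (fun y => ENNReal.ofReal (R y)))
    (hint : Integrable (fun y => (R y - 1) ^ 2) P) (hchi : ∫ y, (R y - 1) ^ 2 ∂P ≤ 1 / 4)
    {T : Ω → ℝ} (hT : Measurable T) (a b : ℝ) :
    ENNReal.ofReal (|a - b| / 4) ≤
      ∫⁻ y, ENNReal.ofReal |T y - a| ∂P + ∫⁻ y, ENNReal.ofReal |T y - b| ∂Q := by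
  set δ := |a - b| / 2 with hδ
  have hδ0 : 0 ≤ δ := by positivity
  set A : Set Ω := {y | δ ≤ |T y - a|} with hA
  have hAm : MeasurableSet A := measurableSet_le measurable_const (by fun_prop)
  have h1 : ENNReal.ofReal δ * P A ≤ ∫⁻ y, ENNReal.ofReal |T y - a| ∂P := by
    rw [← setLIntegral_const]
    refine (setLIntegral_mono (by fun_prop) fun y hy => ?_).trans (setLIntegral_le_lintegral A _)
    exact ENNReal.ofReal_le_ofReal hy
  have h2 : ENNReal.ofReal δ * Q Aᶜ ≤ ∫⁻ y, ENNReal.ofReal |T y - b| ∂Q := by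
    rw [← setLIntegral_const]
    refine (setLIntegral_mono (by fun_prop) fun y hy => ?_).trans (setLIntegral_le_lintegral Aᶜ _)
    refine ENNReal.ofReal_le_ofReal ?_
    have hy' : |T y - a| < δ := by simpa [hA] using hy
    have h3 : |a - b| ≤ |T y - a| + |T y - b| := by
      have := abs_sub_le a (T y) b
      rwa [abs_sub_comm a (T y)] at this
    rw [hδ] at hy' ⊢
    linarith
  have hRm1 : Integrable (fun y => R y - 1) P := by
    refine Integrable.mono' (hint.add (integrable_const (1 : ℝ)))
      (by fun_prop) (Eventually.of_forall fun y => ?_)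
    simp only [Real.norm_eq_abs, Pi.add_apply]
    rw [abs_le]
    constructor <;> nlinarith [sq_nonneg (R y - 1 + 1), sq_nonneg (R y - 1 - 1)]
  have hRi : Integrable R P := by
    have := hRm1.add (integrable_const (1 : ℝ))
    refine this.congr (Eventually.of_forall fun y => ?_)
    simp
  have hQA : Q.real A = ∫ y in A, R y ∂P := by
    rw [measureReal_def, hQ, withDensity_apply _ hAm,
      integral_eq_lintegral_of_nonneg_ae (Eventually.of_forall fun y => hR0 y)
        (by fun_prop)]
  have hPA : P.real A = ∫ y in A, (1 : ℝ) ∂P := by simp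
  have hdiff : Q.real A - P.real A ≤ 1 / 2 := by
    rw [hQA, hPA, ← integral_sub hRi.integrableOn (integrable_const _)]
    -- the elementary bound `r ≤ r² + 1/4` replaces Cauchy-Schwarz
    have h4 : ∫ y in A, (R y - 1) ∂P ≤ ∫ y in A, ((R y - 1) ^ 2 + 1 / 4) ∂P := by
      refine integral_mono hRm1.integrableOn (hint.integrableOn.add (integrable_const _))
        fun y => ?_
      simp only
      nlinarith [sq_nonneg (R y - 1 - 1 / 2)]
    have h5 : ∫ y in A, ((R y - 1) ^ 2 + 1 / 4) ∂P ≤ ∫ y, ((R y - 1) ^ 2 + 1 / 4) ∂P :=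
      setIntegral_le_integral (hint.add (integrable_const _))
        (Eventually.of_forall fun y => by positivity)
    have h6 : ∫ y, ((R y - 1) ^ 2 + 1 / 4) ∂P = ∫ y, (R y - 1) ^ 2 ∂P + 1 / 4 := by
      rw [integral_add hint (integrable_const _)]; simp
    linarith
  have hsum : (1 / 2 : ℝ) ≤ P.real A + Q.real Aᶜ := by
    have := probReal_compl_eq_one_sub (μ := Q) hAm
    linarith
  calc ENNReal.ofReal (|a - b| / 4) = ENNReal.ofReal (δ * (1 / 2)) := by
        rw [hδ]; ring_nf
    _ ≤ ENNReal.ofReal (δ * (P.real A + Q.real Aᶜ)) := by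
        gcongr
    _ = ENNReal.ofReal δ * P A + ENNReal.ofReal δ * Q Aᶜ := by
        rw [ENNReal.ofReal_mul hδ0, ENNReal.ofReal_add (by positivity) (by positivity), mul_add]
        simp [measureReal_def]
    _ ≤ _ := add_le_add h1 h2

theorem pi_withDensity {ι Ω : Type*} [Fintype ι] [MeasurableSpace Ω] {P : Measure Ω}
    [IsProbabilityMeasure P] {r : Ω → ℝ}
    (hr0 : ∀ y, 0 ≤ r y) (hri : Integrable r P)
    [IsFiniteMeasure (P.withDensity (fun y => ENNReal.ofReal (r y)))] :
    Measure.pi (fun _ : ι => P.withDensity (fun y => ENNReal.ofReal (r y))) =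
      (Measure.pi (fun _ : ι => P)).withDensity (fun y => ENNReal.ofReal (∏ i, r (y i))) := by
  refine Measure.pi_eq fun s hs => ?_
  rw [withDensity_apply _ (MeasurableSet.univ_pi hs), Measure.restrict_pi_pi,
    ← ofReal_integral_eq_lintegral_ofReal (Integrable.fintype_prod fun i => hri.integrableOn)
      (Eventually.of_forall fun y => Finset.prod_nonneg fun i _ => hr0 _),
    integral_fintype_prod_eq_prod (fun _ => r), ENNReal.ofReal_prod_of_nonneg]
  · refine Finset.prod_congr rfl fun i _ => ?_
    rw [withDensity_apply _ (hs i), ← ofReal_integral_eq_lintegral_ofReal hri.integrableOn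
      (Eventually.of_forall fun y => hr0 y)]
  · exact fun i _ => integral_nonneg fun y => hr0 y

/-- The two-point bound for `n` independent observations: the `χ²`-divergence tensorizes,
`1 + χ²(Pⁿ, Qⁿ) = (1 + χ²) ^ n ≤ exp (n χ²)`, and `exp (1 / 5) ≤ 1 + 1 / 4`. -/
theorem two_point_bound_pi {n : ℕ} {Ω : Type*} [MeasurableSpace Ω] {P Q : Measure Ω}
    [IsProbabilityMeasure P] [IsProbabilityMeasure Q] {r : Ω → ℝ} (hr : Measurable r)
    (hr0 : ∀ y, 0 ≤ r y) (hQ : Q = P.withDensity (fun y => ENNReal.ofReal (r y)))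
    (hint : Integrable (fun y => (r y - 1) ^ 2) P) (hchi : (n : ℝ) * ∫ y, (r y - 1) ^ 2 ∂P ≤ 1 / 5)
    {T : (Fin n → Ω) → ℝ} (hT : Measurable T) (a b : ℝ) :
    ENNReal.ofReal (|a - b| / 4) ≤
      ∫⁻ y, ENNReal.ofReal |T y - a| ∂(Measure.pi fun _ => P) +
        ∫⁻ y, ENNReal.ofReal |T y - b| ∂(Measure.pi fun _ => Q) := by
  have hRm1 : Integrable (fun y => r y - 1) P := by
    refine Integrable.mono' (hint.add (integrable_const (1 : ℝ)))
      (by fun_prop) (Eventually.of_forall fun y => ?_)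
    simp only [Real.norm_eq_abs, Pi.add_apply]
    rw [abs_le]
    constructor <;> nlinarith [sq_nonneg (r y - 1 + 1), sq_nonneg (r y - 1 - 1)]
  have hri : Integrable r P := by
    refine (hRm1.add (integrable_const (1 : ℝ))).congr (Eventually.of_forall fun y => ?_)
    simp
  have hr1 : ∫ y, r y ∂P = 1 := by
    have h1 : Q Set.univ = 1 := measure_univ
    rw [hQ, withDensity_apply _ MeasurableSet.univ, Measure.restrict_univ] at h1
    rw [integral_eq_lintegral_of_nonneg_ae (Eventually.of_forall fun y => hr0 y) (by fun_prop), h1]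
    simp
  have hr2i : Integrable (fun y => r y ^ 2) P := by
    have := (hint.add (hri.const_mul 2)).sub (integrable_const (1 : ℝ))
    refine this.congr (Eventually.of_forall fun y => ?_)
    simp only [Pi.sub_apply, Pi.add_apply]; ring
  have hr2 : ∫ y, r y ^ 2 ∂P = 1 + ∫ y, (r y - 1) ^ 2 ∂P := by
    have : ∀ y, r y ^ 2 = (r y - 1) ^ 2 + (2 * r y - 1) := fun y => by ring
    have hlin : Integrable (fun y => 2 * r y - 1) P := (hri.const_mul 2).sub (integrable_const _)
    simp_rw [this]
    rw [integral_add hint hlin,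
      integral_sub (hri.const_mul 2) (integrable_const _), integral_const_mul, hr1]
    simp; ring
  set R : (Fin n → Ω) → ℝ := fun y => ∏ i, r (y i) with hRdef
  have hRmeas : Measurable R := by
    rw [hRdef]; fun_prop
  have hRi : Integrable R (Measure.pi fun _ => P) := Integrable.fintype_prod fun _ => hri
  have hR2i : Integrable (fun y => R y ^ 2) (Measure.pi fun _ => P) := by
    simp only [hRdef, ← Finset.prod_pow]
    exact Integrable.fintype_prod (f := fun _ y => r y ^ 2) fun _ => hr2i
  have hexp : ∀ y, (R y - 1) ^ 2 = R y ^ 2 - 2 * R y + 1 := fun y => by ring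
  subst hQ
  refine two_point_bound (R := R) hRmeas (fun y => Finset.prod_nonneg fun i _ => hr0 _)
    (pi_withDensity hr0 hri) ?_ ?_ hT a b
  · simp_rw [hexp]
    exact (hR2i.sub (hRi.const_mul 2)).add (integrable_const _)
  · have hlin : Integrable (fun y => R y ^ 2 - 2 * R y) (Measure.pi fun _ => P) :=
      hR2i.sub (hRi.const_mul 2)
    simp_rw [hexp]
    rw [integral_add hlin (integrable_const _),
      integral_sub hR2i (hRi.const_mul 2), integral_const_mul]
    have h1 : ∫ y, R y ∂(Measure.pi fun _ => P) = 1 := by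
      rw [hRdef, integral_fintype_prod_eq_prod (fun _ => r)]
      simp [hr1]
    have h2 : ∫ y, R y ^ 2 ∂(Measure.pi fun _ => P) = (1 + ∫ y, (r y - 1) ^ 2 ∂P) ^ n := by
      simp only [hRdef, ← Finset.prod_pow]
      rw [integral_fintype_prod_eq_prod (fun _ y => r y ^ 2)]
      simp [hr2]
    rw [h1, h2]
    set x := ∫ y, (r y - 1) ^ 2 ∂P
    have hx : 0 ≤ x := integral_nonneg fun y => by positivity
    have h3 : (1 + x) ^ n ≤ Real.exp (1 / 5) := by
      calc (1 + x) ^ n ≤ (Real.exp x) ^ n := by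
            gcongr; linarith [Real.add_one_le_exp x]
        _ = Real.exp (n * x) := by rw [← Real.exp_nat_mul]
        _ ≤ _ := by gcongr
    have h4 : Real.exp (1 / 5) ≤ 5 / 4 := by
      have h5 := Real.add_one_le_exp (-(1 / 5))
      have h6 : Real.exp (1 / 5) * Real.exp (-(1 / 5)) = 1 := by rw [← Real.exp_add]; simp
      nlinarith [Real.exp_pos (1 / 5)]
    simp
    linarith

/-- Assouad's counting argument. If flipping the `k`-th coordinate of `θ` always costs `D`, then
the total loss `∑ k, I θ k` is at least `m D / 2` for some `θ`. -/
theorem assouad {m : ℕ} {D S : ℝ≥0∞} (I : (Fin m → Bool) → Fin m → ℝ≥0∞)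
    (hD : ∀ θ k, D ≤ I θ k + I (Function.update θ k (!θ k)) k)
    (hS : ∀ θ, ∑ k, I θ k ≤ S) : m * D ≤ 2 * S := by
  have hflip : ∀ k : Fin m, ∑ θ, I (Function.update θ k (!θ k)) k = ∑ θ, I θ k := by
    intro k
    have hinv : Function.Involutive
        (fun θ : Fin m → Bool => Function.update θ k (!θ k)) := by
      intro θ
      simp
    exact hinv.bijective.sum_comp (fun θ => I θ k)
  have h1 : ∀ k : Fin m, (2 ^ m : ℝ≥0∞) * D ≤ 2 * ∑ θ, I θ k := by
    intro k
    calc (2 ^ m : ℝ≥0∞) * D = ∑ _θ : Fin m → Bool, D := by simp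
      _ ≤ ∑ θ, (I θ k + I (Function.update θ k (!θ k)) k) := Finset.sum_le_sum fun θ _ => hD θ k
      _ = 2 * ∑ θ, I θ k := by rw [Finset.sum_add_distrib, hflip, two_mul]
  have h2 : (2 ^ m : ℝ≥0∞) * (m * D) ≤ 2 ^ m * (2 * S) := by
    calc (2 ^ m : ℝ≥0∞) * (m * D) = ∑ _k : Fin m, (2 ^ m : ℝ≥0∞) * D := by simp; ring
      _ ≤ ∑ k : Fin m, 2 * ∑ θ, I θ k := Finset.sum_le_sum fun k _ => h1 k
      _ = 2 * ∑ θ, ∑ k : Fin m, I θ k := by rw [← Finset.mul_sum, Finset.sum_comm]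
      _ ≤ 2 * ∑ _θ : Fin m → Bool, S := by gcongr with θ; exact hS θ
      _ = _ := by simp; ring
  exact (ENNReal.mul_le_mul_iff_right (by simp) (by simp)).mp h2

/-- The easy half of Kantorovich duality. -/
theorem ofReal_abs_integral_sub_le_W1 {E : Type*} [PseudoEMetricSpace E] [MeasurableSpace E]
    [OpensMeasurableSpace E] [SecondCountableTopology E]
    {μ ν : Measure E} [IsProbabilityMeasure μ] {φ : E → ℝ} (hφ : Measurable φ)
    {C : ℝ} (hb : ∀ x, |φ x| ≤ C) {K : NNReal} (hK0 : K ≠ 0) (hK : LipschitzWith K φ) :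
    ENNReal.ofReal |∫ x, φ x ∂μ - ∫ x, φ x ∂ν| ≤ K * W1 μ ν := by
  rw [W1, ENNReal.mul_iInf_of_ne (by simpa using hK0) (by simp)]
  refine le_iInf fun γ => ?_
  rw [ENNReal.mul_iInf_of_ne (by simpa using hK0) (by simp)]
  refine le_iInf fun hγ => ?_
  obtain ⟨h1, h2⟩ := hγ
  have hγp : IsProbabilityMeasure γ := by
    constructor
    have : (γ.map Prod.fst) Set.univ = 1 := by rw [h1]; exact measure_univ
    rwa [Measure.map_apply measurable_fst MeasurableSet.univ, Set.preimage_univ] at this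
  have hi : ∀ {g : E × E → E}, Measurable g → Integrable (fun p => φ (g p)) γ := fun hg =>
    Integrable.of_bound (hφ.comp hg).aestronglyMeasurable C
      (Eventually.of_forall fun p => hb _)
  rw [← h1, ← h2, integral_map measurable_fst.aemeasurable hφ.aestronglyMeasurable,
    integral_map measurable_snd.aemeasurable hφ.aestronglyMeasurable,
    ← integral_sub (hi measurable_fst) (hi measurable_snd), ← Real.norm_eq_abs, ofReal_norm]
  refine (enorm_integral_le_lintegral_enorm _).trans ?_
  rw [← lintegral_const_mul _ (by fun_prop)]
  refine lintegral_mono fun p => ?_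
  rw [← edist_eq_enorm_sub]
  exact hK p.1 p.2

theorem measurable_integral_estimator {Ω E : Type*} [MeasurableSpace Ω] [MeasurableSpace E]
    {m : Ω → Measure E} (hm : Measurable m) {φ : E → ℝ} (hφ : Measurable φ) :
    Measurable fun y => ∫ x, φ x ∂(m y) :=
  (StronglyMeasurable.integral_kernel (κ := (⟨m, hm⟩ : ProbabilityTheory.Kernel Ω E))
    hφ.stronglyMeasurable).measurable

/-! ### Fourier analysis on the line -/

/-- Comparison with Mathlib's normalization, which has the kernel `exp (-2πi t x)`. -/
theorem fourier_eq_real (f : ℝ → ℝ) (t : ℝ) :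
    fourier f t = 𝓕 (fun x => (f x : ℂ)) (-(t / (2 * Real.pi))) := by
  rw [Real.fourier_real_eq_integral_exp_smul, fourier]
  refine integral_congr_ae (Eventually.of_forall fun x => ?_)
  simp only [smul_eq_mul]
  congr 2
  have : (Real.pi : ℂ) ≠ 0 := by exact_mod_cast Real.pi_ne_zero
  simp
  field_simp

theorem real_fourier_eq (f : ℝ → ℝ) (ξ : ℝ) :
    𝓕 (fun x => (f x : ℂ)) ξ = fourier f (ξ * (-(2 * Real.pi))) := by
  rw [fourier_eq_real]
  field_simp

theorem norm_fourier_le {E : Type*} [NormedAddCommGroup E] [InnerProductSpace ℝ E]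
    [MeasureSpace E] (f : E → ℝ) (t : E) : ‖fourier f t‖ ≤ ∫ x, |f x| := by
  refine (norm_integral_le_integral_norm _).trans_eq ?_
  refine integral_congr_ae (Eventually.of_forall fun x => ?_)
  simp only [norm_mul, Complex.norm_real, Real.norm_eq_abs]
  rw [mul_comm Complex.I, Complex.norm_exp_ofReal_mul_I, one_mul]

theorem continuous_fourier {E : Type*} [NormedAddCommGroup E] [InnerProductSpace ℝ E]
    [MeasureSpace E] [BorelSpace E] [SecondCountableTopology E] {f : E → ℝ} (hf : Integrable f) :
    Continuous (fourier f) := by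
  refine continuous_of_dominated (bound := fun x => |f x|) (fun t => ?_) (fun t => ?_) hf.abs ?_
  · exact (Continuous.aestronglyMeasurable (by fun_prop)).mul hf.ofReal.aestronglyMeasurable
  · refine Eventually.of_forall fun x => ?_
    rw [norm_mul, Complex.norm_real, Real.norm_eq_abs, mul_comm Complex.I,
      Complex.norm_exp_ofReal_mul_I, one_mul]
  · exact Eventually.of_forall fun x => by fun_prop

/-- Plancherel's identity, for a continuous integrable function with integrable transform. -/
theorem integral_norm_fourier_sq {f : ℝ → ℝ} (hc : Continuous f) (hi : Integrable f)
    (hF : Integrable (fourier f)) :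
    ∫ t, ‖fourier f t‖ ^ 2 = 2 * Real.pi * ∫ x, f x ^ 2 := by
  set g : ℝ → ℂ := fun x => (f x : ℂ) with hg
  have hgc : Continuous g := by fun_prop
  have hgi : Integrable g := hi.ofReal
  have hpi : -(2 * Real.pi) ≠ 0 := by simp [Real.pi_ne_zero]
  have hFg : Integrable (𝓕 g) := by
    have : 𝓕 g = fun ξ => fourier f (ξ * (-(2 * Real.pi))) := funext fun ξ => real_fourier_eq f ξ
    rw [this]
    exact hF.comp_mul_right' hpi
  have hinv : 𝓕⁻ (𝓕 g) = g := hgc.fourierInv_fourier_eq hgi hFg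
  have h1 : ∫ ξ, innerSL ℂ (𝓕 g ξ) (𝓕 g ξ) = ∫ x, innerSL ℂ (g x) (𝓕⁻ (𝓕 g) x) := by
    have h0 : VectorFourier.fourierIntegral Real.fourierChar volume (-(innerₗ ℝ).flip) (𝓕 g) =
        𝓕⁻ (𝓕 g) := by
      ext x
      rw [Real.fourierInv_eq, VectorFourier.fourierIntegral]
      simp
    rw [← h0]
    exact VectorFourier.integral_sesq_fourierIntegral_eq_neg_flip (innerSL ℂ)
      (L := innerₗ ℝ) Real.continuous_fourierChar continuous_inner hgi hFg
  rw [hinv] at h1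
  have h2 : ∫ ξ, ‖𝓕 g ξ‖ ^ 2 = ∫ x, f x ^ 2 := by
    apply Complex.ofReal_injective
    rw [← integral_complex_ofReal, ← integral_complex_ofReal]
    have hA : ∀ ξ, ((‖𝓕 g ξ‖ ^ 2 : ℝ) : ℂ) = innerSL ℂ (𝓕 g ξ) (𝓕 g ξ) := fun ξ => by
      rw [innerSL_apply_apply, inner_self_eq_norm_sq_to_K]; simp
    have hB : ∀ x, ((f x ^ 2 : ℝ) : ℂ) = innerSL ℂ (g x) (g x) := fun x => by
      rw [innerSL_apply_apply, inner_self_eq_norm_sq_to_K]; simp [hg, ← Complex.ofReal_pow]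
    simp_rw [hA, hB]
    exact h1
  have h3 := Measure.integral_comp_mul_right (fun t => ‖fourier f t‖ ^ 2) (-(2 * Real.pi))
  simp_rw [← real_fourier_eq] at h3
  rw [h2, abs_inv, abs_neg, abs_of_pos (by positivity), smul_eq_mul] at h3
  rw [h3]
  field_simp

theorem fourier_deriv {f : ℝ → ℝ} (hf : Integrable f) (hd : Differentiable ℝ f)
    (hf' : Integrable (deriv f)) (t : ℝ) :
    fourier (deriv f) t = -(Complex.I * t) * fourier f t := by
  have hder : ∀ x, HasDerivAt (fun x => (f x : ℂ)) ((deriv f x : ℝ) : ℂ) x := fun x =>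
    (hd x).hasDerivAt.ofReal_comp
  have hderiv : deriv (fun x => (f x : ℂ)) = fun x => ((deriv f x : ℝ) : ℂ) :=
    funext fun x => (hder x).deriv
  rw [fourier_eq_real, fourier_eq_real, ← hderiv, Real.fourier_deriv hf.ofReal
    (fun x => (hder x).differentiableAt) (by rw [hderiv]; exact hf'.ofReal)]
  have : (Real.pi : ℂ) ≠ 0 := by exact_mod_cast Real.pi_ne_zero
  push_cast
  simp only [smul_eq_mul]
  field_simp

/-- The Fourier transform turns `n` derivatives of a test function into the factor `|t| ^ n`. -/
theorem norm_fourier_iteratedDeriv {b : ℝ → ℝ} (hb : ContDiff ℝ ∞ b) (hs : HasCompactSupport b)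
    (n : ℕ) (t : ℝ) : ‖fourier (iteratedDeriv n b) t‖ = |t| ^ n * ‖fourier b t‖ := by
  induction n generalizing b with
  | zero => simp
  | succ n ih =>
    have hb' : ContDiff ℝ ∞ (deriv b) := (contDiff_infty_iff_deriv.mp hb).2
    rw [iteratedDeriv_succ', ih hb' hs.deriv, fourier_deriv
      (hb.continuous.integrable_of_hasCompactSupport hs) (hb.differentiable (by simp))
      (hb'.continuous.integrable_of_hasCompactSupport hs.deriv)]
    simp only [norm_mul, norm_neg, Complex.norm_I, Complex.norm_real, Real.norm_eq_abs, one_mul]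
    ring

theorem _root_.HasCompactSupport.iteratedDeriv {b : ℝ → ℝ} (hs : HasCompactSupport b) (n : ℕ) :
    HasCompactSupport (iteratedDeriv n b) := by
  induction n generalizing b with
  | zero => simpa
  | succ n ih => rw [iteratedDeriv_succ']; exact ih hs.deriv

theorem contDiff_iteratedDeriv {b : ℝ → ℝ} (hb : ContDiff ℝ ∞ b) (n : ℕ) :
    ContDiff ℝ ∞ (iteratedDeriv n b) := by
  induction n generalizing b with
  | zero => simpa
  | succ n ih => rw [iteratedDeriv_succ']; exact ih (contDiff_infty_iff_deriv.mp hb).2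

theorem one_add_sq_pow_le (N : ℕ) (x : ℝ) : (1 + x ^ 2) ^ N ≤ 2 ^ N * (1 + |x| ^ (2 * N)) := by
  have h : (1 + x ^ 2) ^ N ≤ (2 * max 1 (x ^ 2)) ^ N := by
    gcongr
    linarith [le_max_left 1 (x ^ 2), le_max_right 1 (x ^ 2)]
  refine h.trans ?_
  rw [mul_pow]
  gcongr
  rw [pow_mul, sq_abs]
  rcases le_total 1 (x ^ 2) with h1 | h1
  · rw [max_eq_right h1]; linarith
  · rw [max_eq_left h1]; simp; positivity

/-- The transform of a test function decays faster than any power. -/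
theorem exists_norm_fourier_le {b : ℝ → ℝ} (hb : ContDiff ℝ ∞ b) (hs : HasCompactSupport b)
    (N : ℕ) : ∃ C, 0 ≤ C ∧ ∀ t, ‖fourier b t‖ * (1 + t ^ 2) ^ N ≤ C := by
  refine ⟨2 ^ N * ((∫ x, |b x|) + ∫ x, |iteratedDeriv (2 * N) b x|), by positivity, fun t => ?_⟩
  calc ‖fourier b t‖ * (1 + t ^ 2) ^ N ≤ ‖fourier b t‖ * (2 ^ N * (1 + |t| ^ (2 * N))) := by
        gcongr; exact one_add_sq_pow_le N t
    _ = 2 ^ N * (‖fourier b t‖ + ‖fourier (iteratedDeriv (2 * N) b) t‖) := by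
        rw [norm_fourier_iteratedDeriv hb hs]; ring
    _ ≤ _ := by gcongr <;> exact norm_fourier_le _ _

theorem integrable_fourier {b : ℝ → ℝ} (hb : ContDiff ℝ ∞ b) (hs : HasCompactSupport b) :
    Integrable (fourier b) := by
  obtain ⟨C, -, hC⟩ := exists_norm_fourier_le hb hs 1
  refine Integrable.mono' (integrable_inv_one_add_sq.const_mul C)
    (continuous_fourier (hb.continuous.integrable_of_hasCompactSupport hs)).aestronglyMeasurable
    (Eventually.of_forall fun t => ?_)
  have := hC t
  rw [pow_one] at this
  rw [← div_eq_mul_inv, le_div_iff₀ (by positivity)]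
  exact this

theorem integrable_sobolev {b : ℝ → ℝ} (hb : ContDiff ℝ ∞ b) (hs : HasCompactSupport b) (α : ℝ) :
    Integrable (fun t => ‖fourier b t‖ ^ 2 * (1 + t ^ 2) ^ α) := by
  obtain ⟨N, hN⟩ := exists_nat_ge α
  obtain ⟨C, hC0, hC⟩ := exists_norm_fourier_le hb hs (N + 1)
  have hcont := continuous_fourier (hb.continuous.integrable_of_hasCompactSupport hs)
  refine Integrable.mono' (integrable_inv_one_add_sq.const_mul (C ^ 2))
    (Continuous.aestronglyMeasurable ?_) (Eventually.of_forall fun t => ?_)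
  · refine (hcont.norm.pow 2).mul (Continuous.rpow_const (by fun_prop) fun t => Or.inl ?_)
    positivity
  · have h1 : (1 : ℝ) ≤ 1 + t ^ 2 := by nlinarith [sq_nonneg t]
    rw [Real.norm_of_nonneg (by positivity), ← div_eq_mul_inv, le_div_iff₀ (by positivity)]
    have h2 : (1 + t ^ 2) ^ α ≤ (1 + t ^ 2) ^ N := by
      rw [← Real.rpow_natCast _ N]
      exact Real.rpow_le_rpow_of_exponent_le h1 hN
    calc ‖fourier b t‖ ^ 2 * (1 + t ^ 2) ^ α * (1 + t ^ 2)
        ≤ ‖fourier b t‖ ^ 2 * (1 + t ^ 2) ^ N * (1 + t ^ 2) := by gcongr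
      _ = ‖fourier b t‖ ^ 2 * (1 + t ^ 2) ^ (N + 1) := by ring
      _ ≤ ‖fourier b t‖ ^ 2 * ((1 + t ^ 2) ^ (N + 1)) ^ 2 := by
          gcongr
          nlinarith [one_le_pow₀ h1 (n := N + 1)]
      _ = (‖fourier b t‖ * (1 + t ^ 2) ^ (N + 1)) ^ 2 := by ring
      _ ≤ C ^ 2 := by gcongr; exact hC t

theorem integral_norm_fourier_sq_of_contDiff {b : ℝ → ℝ} (hb : ContDiff ℝ ∞ b)
    (hs : HasCompactSupport b) : ∫ t, ‖fourier b t‖ ^ 2 = 2 * Real.pi * ∫ x, b x ^ 2 :=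
  integral_norm_fourier_sq hb.continuous (hb.continuous.integrable_of_hasCompactSupport hs)
    (integrable_fourier hb hs)

/-- The convolution `x ↦ ∫ φ (t) b (x - t) dt` of real functions. -/
noncomputable def cv (φ b : ℝ → ℝ) : ℝ → ℝ :=
  convolution φ b (ContinuousLinearMap.mul ℝ ℝ) volume

theorem cv_apply (φ b : ℝ → ℝ) (x : ℝ) : cv φ b x = ∫ t, φ t * b (x - t) := rfl

theorem integrable_cv {φ b : ℝ → ℝ} (hφ : Integrable φ) (hb : Integrable b) :
    Integrable (cv φ b) :=
  hφ.integrable_convolution _ hb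

theorem continuous_cv {φ b : ℝ → ℝ} (hφ : Integrable φ) (hb : Continuous b)
    (hs : HasCompactSupport b) : Continuous (cv φ b) :=
  hs.continuous_convolution_right _ hφ.locallyIntegrable hb

theorem fourier_cv {φ b : ℝ → ℝ} (hφ : Integrable φ) (hb : Integrable b) (t : ℝ) :
    fourier (cv φ b) t = fourier φ t * fourier b t := by
  have h : (fun x => ((cv φ b x : ℝ) : ℂ)) = convolution (fun x => (φ x : ℂ)) (fun x => (b x : ℂ))
      (ContinuousLinearMap.mul ℂ ℂ) volume := by
    ext x
    rw [cv_apply, ← integral_complex_ofReal]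
    simp [convolution]
  rw [fourier_eq_real, h, fourier_eq_real, fourier_eq_real]
  exact Real.fourier_mul_convolution_eq (R := ℂ) hφ.ofReal hb.ofReal _

theorem integrable_cv_sq {φ b : ℝ → ℝ} (hφ : Integrable φ) (hb : Continuous b)
    (hs : HasCompactSupport b) : Integrable (fun x => cv φ b x ^ 2) := by
  obtain ⟨C, hC⟩ := hs.exists_bound_of_continuous hb
  have hbound : ∀ x, ‖cv φ b x‖ ≤ (∫ t, ‖φ t‖) * C := by
    intro x
    rw [cv_apply, ← integral_mul_const]
    refine norm_integral_le_of_norm_le (hφ.norm.mul_const C) (Eventually.of_forall fun t => ?_)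
    rw [norm_mul]
    gcongr
    exact hC _
  have := (integrable_cv hφ (hb.integrable_of_hasCompactSupport hs)).bdd_mul
    (continuous_cv hφ hb hs).aestronglyMeasurable (Eventually.of_forall hbound)
  refine this.congr (Eventually.of_forall fun x => ?_)
  simp only; ring

/-- Smoothing estimate: if `φ̂` decays like `(1 + |t|) ^ (-β)` and `b = h ^ q V⁽q⁾` with `q ≥ β`,
then `φ ∗ b` has an `L²` norm smaller by a factor `h ^ β` than those of `b` and `V`. The
frequencies `|t| ≤ h⁻¹` are controlled by `V`, the others by `b` itself. -/
theorem integral_cv_sq_le {φ b V : ℝ → ℝ} {β c h : ℝ} {q : ℕ} (hβ : 0 < β) (hq : β ≤ q)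
    (hφ : Integrable φ) (hφb : ∀ t, ‖fourier φ t‖ ≤ c * (1 + |t|) ^ (-β)) (hh : 0 < h)
    (hV : ContDiff ℝ ∞ V) (hVs : HasCompactSupport V)
    (hb : ∀ x, b x = h ^ q * iteratedDeriv q V x) :
    ∫ x, cv φ b x ^ 2 ≤ c ^ 2 * h ^ (2 * β) * ((∫ x, V x ^ 2) + ∫ x, b x ^ 2) := by
  have hbc : ContDiff ℝ ∞ b := by
    rw [show b = fun x => h ^ q * iteratedDeriv q V x from funext hb]
    exact contDiff_const.mul (contDiff_iteratedDeriv hV q)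
  have hbs : HasCompactSupport b := by
    rw [show b = fun x => h ^ q * iteratedDeriv q V x from funext hb]
    exact (hVs.iteratedDeriv q).mul_left
  have hbi : Integrable b := hbc.continuous.integrable_of_hasCompactSupport hbs
  have hfb : ∀ t, ‖fourier b t‖ = |h * t| ^ q * ‖fourier V t‖ := by
    intro t
    have : fourier b t = (h ^ q : ℝ) * fourier (iteratedDeriv q V) t := by
      rw [fourier, fourier, ← integral_const_mul]
      refine integral_congr_ae (Eventually.of_forall fun x => ?_)
      simp only [hb x]
      push_cast; ring
    rw [this, norm_mul, norm_fourier_iteratedDeriv hV hVs, Complex.norm_real, Real.norm_eq_abs,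
      abs_pow, abs_mul, mul_pow]
    ring
  have hc0 : 0 ≤ c := by
    have := (norm_nonneg _).trans (hφb 0)
    simpa using this
  have hcvF : Integrable (fourier (cv φ b)) := by
    refine Integrable.mono' ((integrable_fourier hbc hbs).norm.const_mul (∫ x, |φ x|))
      (continuous_fourier (integrable_cv hφ hbi)).aestronglyMeasurable
      (Eventually.of_forall fun t => ?_)
    rw [fourier_cv hφ hbi, norm_mul]
    gcongr
    exact norm_fourier_le _ _
  have hV2 : Integrable (fun t => ‖fourier V t‖ ^ 2) := by
    simpa using integrable_sobolev hV hVs 0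
  have hb2 : Integrable (fun t => ‖fourier b t‖ ^ 2) := by
    simpa using integrable_sobolev hbc hbs 0
  have key : ∫ t, ‖fourier (cv φ b) t‖ ^ 2 ≤
      ∫ t, c ^ 2 * h ^ (2 * β) * (‖fourier V t‖ ^ 2 + ‖fourier b t‖ ^ 2) := by
    refine integral_mono_of_nonneg (Eventually.of_forall fun t => by positivity)
      ((hV2.add hb2).const_mul _) (Eventually.of_forall fun t => ?_)
    simp only
    rw [fourier_cv hφ hbi, norm_mul, mul_pow, hfb t]
    rcases eq_or_ne t 0 with rfl | ht
    · have : q ≠ 0 := by rintro rfl; simp at hq; linarith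
      simp [this]
      positivity
    have ht' : 0 < |t| := abs_pos.mpr ht
    set u := |h * t| with hu
    have hu0 : 0 < u := by positivity
    have h1 : ‖fourier φ t‖ ^ 2 ≤ c ^ 2 * (h ^ (2 * β) * u ^ (-(2 * β))) := by
      have h2 : ‖fourier φ t‖ ≤ c * |t| ^ (-β) := by
        refine (hφb t).trans ?_
        exact mul_le_mul_of_nonneg_left
          (Real.rpow_le_rpow_of_nonpos ht' (by linarith) (by linarith)) hc0
      calc ‖fourier φ t‖ ^ 2 ≤ (c * |t| ^ (-β)) ^ 2 := by gcongr
        _ = c ^ 2 * |t| ^ (-(2 * β)) := by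
            rw [mul_pow, ← Real.rpow_mul_natCast (abs_nonneg t)]
            congr 2; push_cast; ring
        _ = _ := by
            rw [hu, abs_mul, abs_of_pos hh, Real.mul_rpow hh.le (abs_nonneg t), ← mul_assoc (h ^ _),
              ← Real.rpow_add hh]
            simp
    have h3 : u ^ (-(2 * β)) * (u ^ q) ^ 2 ≤ 1 + (u ^ q) ^ 2 := by
      have h4 : (u ^ q) ^ 2 = u ^ (2 * q : ℝ) := by
        rw [← pow_mul, ← Real.rpow_natCast]; push_cast; ring_nf
      rw [h4, ← Real.rpow_add hu0]
      rcases le_total u 1 with h5 | h5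
      · have : u ^ (-(2 * β) + 2 * q : ℝ) ≤ 1 := Real.rpow_le_one hu0.le h5 (by linarith)
        have : 0 ≤ u ^ (2 * q : ℝ) := by positivity
        linarith
      · have : u ^ (-(2 * β) + 2 * q : ℝ) ≤ u ^ (2 * q : ℝ) :=
          Real.rpow_le_rpow_of_exponent_le h5 (by linarith)
        linarith
    calc ‖fourier φ t‖ ^ 2 * (u ^ q * ‖fourier V t‖) ^ 2
        ≤ c ^ 2 * (h ^ (2 * β) * u ^ (-(2 * β))) * (u ^ q * ‖fourier V t‖) ^ 2 := by gcongr
      _ = c ^ 2 * h ^ (2 * β) * ((u ^ (-(2 * β)) * (u ^ q) ^ 2) * ‖fourier V t‖ ^ 2) := by ring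
      _ ≤ c ^ 2 * h ^ (2 * β) * ((1 + (u ^ q) ^ 2) * ‖fourier V t‖ ^ 2) := by gcongr
      _ = _ := by ring
  rw [integral_norm_fourier_sq (continuous_cv hφ hbc.continuous hbs) (integrable_cv hφ hbi) hcvF,
    integral_const_mul, integral_add hV2 hb2, integral_norm_fourier_sq_of_contDiff hV hVs,
    integral_norm_fourier_sq_of_contDiff hbc hbs] at key
  refine le_of_mul_le_mul_left (key.trans_eq ?_) (show 0 < 2 * Real.pi by positivity)
  ring

/-- The Sobolev integral of a test function whose derivatives grow like powers of `h⁻¹`. -/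
theorem integral_sobolev_le {b : ℝ → ℝ} (hb : ContDiff ℝ ∞ b) (hs : HasCompactSupport b)
    {α h : ℝ} (hα : 0 ≤ α) {N : ℕ} (hN : α ≤ N) (hh : 0 < h) (hh1 : h ≤ 1) :
    ∫ t, ‖fourier b t‖ ^ 2 * (1 + t ^ 2) ^ α ≤
      2 ^ N * h ^ (-(2 * α)) * (2 * Real.pi) *
        ((∫ x, b x ^ 2) + ∫ x, (h ^ N * iteratedDeriv N b x) ^ 2) := by
  have hNb := contDiff_iteratedDeriv hb N
  have hNs := hs.iteratedDeriv N
  have hb2 : Integrable (fun t => ‖fourier b t‖ ^ 2) := by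
    simpa using integrable_sobolev hb hs 0
  have hd2 : Integrable (fun t => ‖fourier (iteratedDeriv N b) t‖ ^ 2) := by
    simpa using integrable_sobolev hNb hNs 0
  have key : ∫ t, ‖fourier b t‖ ^ 2 * (1 + t ^ 2) ^ α ≤ ∫ t, 2 ^ N * h ^ (-(2 * α)) *
      (‖fourier b t‖ ^ 2 + h ^ (2 * N) * ‖fourier (iteratedDeriv N b) t‖ ^ 2) := by
    refine integral_mono (integrable_sobolev hb hs α) ((hb2.add (hd2.const_mul _)).const_mul _)
      fun t => ?_
    simp only
    rw [norm_fourier_iteratedDeriv hb hs]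
    have h1 : (1 + t ^ 2) ^ α ≤ h ^ (-(2 * α)) * (2 ^ N * (1 + |h * t| ^ (2 * N))) := by
      have h2 : 1 + t ^ 2 ≤ h ^ (-2 : ℝ) * (1 + (h * t) ^ 2) := by
        have h3 : h ^ (-2 : ℝ) = (h ^ 2)⁻¹ := by
          rw [Real.rpow_neg hh.le]; norm_cast
        rw [h3, mul_add, mul_one, mul_pow, inv_mul_cancel_left₀ (by positivity)]
        gcongr
        rw [one_le_inv₀ (by positivity)]
        exact pow_le_one₀ hh.le hh1
      have h4 : (1 : ℝ) ≤ 1 + (h * t) ^ 2 := by nlinarith [sq_nonneg (h * t)]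
      calc (1 + t ^ 2) ^ α ≤ (h ^ (-2 : ℝ) * (1 + (h * t) ^ 2)) ^ α := by gcongr
        _ = h ^ (-(2 * α)) * (1 + (h * t) ^ 2) ^ α := by
            rw [Real.mul_rpow (by positivity) (by positivity), ← Real.rpow_mul hh.le]; ring_nf
        _ ≤ h ^ (-(2 * α)) * (1 + (h * t) ^ 2) ^ N := by
            gcongr
            rw [← Real.rpow_natCast _ N]
            exact Real.rpow_le_rpow_of_exponent_le h4 hN
        _ ≤ _ := by gcongr; exact one_add_sq_pow_le N _
    calc ‖fourier b t‖ ^ 2 * (1 + t ^ 2) ^ α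
        ≤ ‖fourier b t‖ ^ 2 * (h ^ (-(2 * α)) * (2 ^ N * (1 + |h * t| ^ (2 * N)))) := by gcongr
      _ = _ := by rw [abs_mul, abs_of_pos hh, mul_pow]; ring
  have h5 : ∫ x, (h ^ N * iteratedDeriv N b x) ^ 2 =
      h ^ (2 * N) * ∫ x, (iteratedDeriv N b x) ^ 2 := by
    rw [← integral_const_mul]
    congr 1; ext x; ring
  rw [integral_const_mul, integral_add hb2 (hd2.const_mul _), integral_const_mul,
    integral_norm_fourier_sq_of_contDiff hb hs, integral_norm_fourier_sq_of_contDiff hNb hNs] at key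
  rw [h5]
  refine key.trans_eq ?_
  ring

/-! ### Combs of bumps -/

/-- The `i`-th derivative of a fixed smooth bump function supported in `(-1, 1)`. -/
noncomputable def bump (i : ℕ) : ℝ → ℝ :=
  iteratedDeriv i (⟨1 / 4, 1 / 2, by norm_num, by norm_num⟩ : ContDiffBump (0 : ℝ))

theorem contDiff_bump (i : ℕ) : ContDiff ℝ ∞ (bump i) :=
  contDiff_iteratedDeriv (ContDiffBump.contDiff _) i

theorem hasCompactSupport_bump (i : ℕ) : HasCompactSupport (bump i) :=
  (ContDiffBump.hasCompactSupport _).iteratedDeriv i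

theorem bump_succ (i : ℕ) : bump (i + 1) = deriv (bump i) := iteratedDeriv_succ

theorem bump_eq_zero {i : ℕ} {x : ℝ} (hx : 1 ≤ |x|) : bump i x = 0 := by
  have h : tsupport (bump i) ⊆ Metric.closedBall 0 (1 / 2) := by
    induction i with
    | zero => rw [bump, iteratedDeriv_zero, ContDiffBump.tsupport_eq]
    | succ i ih =>
      rw [bump_succ]
      exact (closure_minimal support_deriv_subset (isClosed_tsupport _)).trans ih
  by_contra hne
  have := h (subset_tsupport _ (Function.mem_support.mpr hne))
  rw [mem_closedBall_zero_iff, Real.norm_eq_abs] at this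
  linarith

/-- No derivative of the bump vanishes identically, since a compactly supported function with zero
derivative is zero. -/
theorem integral_bump_sq_pos (i : ℕ) : 0 < ∫ x, bump i x ^ 2 := by
  have hne : ∃ x, bump i x ≠ 0 := by
    induction i with
    | zero =>
      refine ⟨0, ?_⟩
      rw [bump, iteratedDeriv_zero]
      exact (ContDiffBump.pos_of_mem_ball _ (by simp)).ne'
    | succ i ih =>
      by_contra! h0
      obtain ⟨x, hx⟩ := ih
      rw [bump_succ] at h0
      have := is_const_of_deriv_eq_zero ((contDiff_bump i).differentiable (by simp)) h0 x 1
      exact hx (this.trans (bump_eq_zero (by simp)))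
  obtain ⟨x, hx⟩ := hne
  have hc : Continuous (fun x => bump i x ^ 2) := (contDiff_bump i).continuous.pow 2
  have hs : HasCompactSupport (fun x => bump i x ^ 2) := by
    simp only [pow_two]; exact (hasCompactSupport_bump i).mul_left
  exact hc.integral_pos_of_hasCompactSupport_nonneg_nonzero hs (fun x => by positivity)
    (x := x) (by positivity)

/-- The comb `∑ k, s k * B⁽ⁱ⁾((x - (2k+1)h)/h)` of `m` disjointly supported bumps of width `2h`. It
lives on `[0, 1]` when `2mh ≤ 1`. -/
noncomputable def comb {m : ℕ} (h : ℝ) (i : ℕ) (s : Fin m → ℝ) (x : ℝ) : ℝ :=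
  ∑ k, s k * bump i ((x - (2 * k + 1) * h) / h)

section comb

variable {m : ℕ} {h : ℝ} {i : ℕ} {s : Fin m → ℝ}

theorem contDiff_comb : ContDiff ℝ ∞ (comb h i s) := by
  refine ContDiff.sum fun k _ => contDiff_const.mul ((contDiff_bump i).comp ?_)
  fun_prop

theorem deriv_comb : deriv (comb h i s) = fun x => h⁻¹ * comb h (i + 1) s x := by
  ext x
  have : HasDerivAt (comb h i s)
      (∑ k, s k * (deriv (bump i) ((x - (2 * k + 1) * h) / h) * (1 / h))) x := by
    refine HasDerivAt.fun_sum fun k _ => HasDerivAt.const_mul _ ?_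
    refine HasDerivAt.comp x
      (((contDiff_bump i).differentiable (by simp)) _).hasDerivAt ?_
    exact ((hasDerivAt_id x).sub_const _).div_const h
  rw [this.deriv, comb, Finset.mul_sum, bump_succ]
  refine Finset.sum_congr rfl fun k _ => ?_
  ring

theorem iteratedDeriv_comb (hh : h ≠ 0) (j : ℕ) (x : ℝ) :
    h ^ j * iteratedDeriv j (comb h i s) x = comb h (i + j) s x := by
  induction j generalizing i with
  | zero => simp
  | succ j ih =>
    rw [iteratedDeriv_succ', deriv_comb, iteratedDeriv_const_mul_field,
      add_comm j 1, ← add_assoc, ← ih, pow_add, pow_one]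
    field_simp

/-- At each point at most one tooth of the comb is alive. -/
theorem comb_dichotomy (hh : 0 < h) (x : ℝ) :
    (∀ (k : Fin m) (i : ℕ), bump i ((x - (2 * k + 1) * h) / h) = 0) ∨
      ∃ k : Fin m, |(x - (2 * k + 1) * h) / h| < 1 ∧
        ∀ l : Fin m, l ≠ k → ∀ i : ℕ, bump i ((x - (2 * l + 1) * h) / h) = 0 := by
  by_cases hk : ∃ k : Fin m, |(x - (2 * k + 1) * h) / h| < 1
  · obtain ⟨k, hk⟩ := hk
    refine Or.inr ⟨k, hk, fun l hl i => bump_eq_zero ?_⟩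
    by_contra! hl1
    apply hl
    have e : ∀ k : Fin m, (x - (2 * k + 1) * h) / h = x / h - (2 * k + 1) := fun k => by
      field_simp
    rw [e, abs_lt] at hk hl1
    have h1 : (l : ℝ) < k + 1 := by linarith [hk.1, hk.2, hl1.1, hl1.2]
    have h2 : (k : ℝ) < l + 1 := by linarith [hk.1, hk.2, hl1.1, hl1.2]
    have h1' : (l : ℕ) < k + 1 := by exact_mod_cast h1
    have h2' : (k : ℕ) < l + 1 := by exact_mod_cast h2
    exact Fin.ext (by omega)
  · push Not at hk
    exact Or.inl fun k i => bump_eq_zero (hk k)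

theorem comb_sq (hh : 0 < h) (x : ℝ) :
    comb h i s x ^ 2 = ∑ k, s k ^ 2 * bump i ((x - (2 * k + 1) * h) / h) ^ 2 := by
  rcases comb_dichotomy (m := m) hh x with h0 | ⟨k, -, h0⟩
  · simp [comb, h0]
  · rw [comb, Finset.sum_eq_single k, Finset.sum_eq_single k]
    · ring
    · intro l _ hl; simp [h0 l hl]
    · simp
    · intro l _ hl; simp [h0 l hl]
    · simp

theorem exists_bump_le (i : ℕ) : ∃ K, 0 < K ∧ ∀ x, |bump i x| ≤ K := by
  obtain ⟨C, hC⟩ := (hasCompactSupport_bump i).exists_bound_of_continuous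
    (contDiff_bump i).continuous
  exact ⟨max C 1, by positivity, fun x => (hC x).trans (le_max_left _ _)⟩

theorem abs_comb_le (hh : 0 < h) (hs : ∀ k, |s k| ≤ 1) {K : ℝ} (hK : ∀ x, |bump i x| ≤ K) (x : ℝ) :
    |comb h i s x| ≤ K := by
  have hK0 : 0 ≤ K := (abs_nonneg _).trans (hK 0)
  rcases comb_dichotomy (m := m) hh x with h0 | ⟨k, -, h0⟩
  · simpa [comb, h0] using hK0
  · rw [comb, Finset.sum_eq_single k, abs_mul]
    · calc |s k| * _ ≤ 1 * K := by gcongr; exacts [hs k, hK _]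
        _ = K := one_mul K
    · intro l _ hl; simp [h0 l hl]
    · simp

theorem comb_eq_zero (hh : 0 < h) (hm : 2 * m * h ≤ 1) {x : ℝ} (hx : x ∉ Set.Icc (0 : ℝ) 1) :
    comb h i s x = 0 := by
  refine Finset.sum_eq_zero fun k _ => ?_
  rw [bump_eq_zero, mul_zero]
  by_contra! hk
  apply hx
  rw [abs_lt, lt_div_iff₀ hh, div_lt_iff₀ hh] at hk
  have h1 : (k : ℝ) + 1 ≤ m := by exact_mod_cast k.2
  have h2 : (k : ℝ) * h + h ≤ m * h := by nlinarith
  have h3 : 0 ≤ (k : ℝ) * h := by positivity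
  constructor <;> nlinarith

theorem hasCompactSupport_comb (hh : 0 < h) (hm : 2 * m * h ≤ 1) :
    HasCompactSupport (comb h i s) :=
  HasCompactSupport.intro isCompact_Icc fun _ hx => comb_eq_zero hh hm hx

theorem integrable_comb (hh : 0 < h) (hm : 2 * m * h ≤ 1) : Integrable (comb h i s) :=
  contDiff_comb.continuous.integrable_of_hasCompactSupport (hasCompactSupport_comb hh hm)

theorem integrable_comb_sq (hh : 0 < h) (hm : 2 * m * h ≤ 1) :
    Integrable (fun x => comb h i s x ^ 2) := by
  refine (contDiff_comb.continuous.pow 2).integrable_of_hasCompactSupport ?_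
  simp only [pow_two]; exact (hasCompactSupport_comb hh hm).mul_left

theorem integral_comb_sq (hh : 0 < h) :
    ∫ x, comb h i s x ^ 2 = (h * ∑ k, s k ^ 2) * ∫ x, bump i x ^ 2 := by
  have hi : Integrable (fun x => bump i x ^ 2) := by
    refine ((contDiff_bump i).continuous.pow 2).integrable_of_hasCompactSupport ?_
    simp only [pow_two]; exact (hasCompactSupport_bump i).mul_left
  simp_rw [comb_sq hh]
  rw [integral_finsetSum]
  · rw [Finset.mul_sum, Finset.sum_mul]
    refine Finset.sum_congr rfl fun k _ => ?_
    rw [integral_const_mul, integral_sub_right_eq_self (fun x => bump i (x / h) ^ 2),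
      Measure.integral_comp_div (fun x => bump i x ^ 2), abs_of_pos hh, smul_eq_mul]
    ring
  · intro k _
    exact ((hi.comp_div hh.ne').comp_sub_right ((2 * k + 1) * h)).const_mul _

/-- The teeth have integral zero as soon as they are derivatives. -/
theorem integral_comb_succ (hh : 0 < h) (hm : 2 * m * h ≤ 1) : ∫ x, comb h (i + 1) s x = 0 := by
  have h1 : ∫ x, deriv (comb h i s) x = 0 := by
    refine integral_eq_zero_of_hasDerivAt_of_integrable
      (fun x => ((contDiff_comb.differentiable (by simp)) x).hasDerivAt) ?_ (integrable_comb hh hm)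
    rw [deriv_comb]
    exact (integrable_comb hh hm).const_mul _
  rw [deriv_comb, integral_const_mul] at h1
  exact (mul_eq_zero.mp h1).resolve_left (by positivity)

end comb

/-- `x f⁽q⁺¹⁾` is again an exact `q`-th derivative. With `iteratedDeriv_x_sq_mul` this lets
polynomial weights pass through the smoothing estimate. -/
theorem iteratedDeriv_x_mul {f : ℝ → ℝ} (hf : ContDiff ℝ ∞ f) (q : ℕ) (x : ℝ) :
    iteratedDeriv q (fun x => x * deriv f x - q * f x) x = x * iteratedDeriv (q + 1) f x := by
  induction q generalizing f with
  | zero => simp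
  | succ q ih =>
    have hf' : ContDiff ℝ ∞ (deriv f) := (contDiff_infty_iff_deriv.mp hf).2
    rw [iteratedDeriv_succ', iteratedDeriv_succ' (n := q + 1), ← ih hf']
    congr 1
    ext y
    have h1 : HasDerivAt f (deriv f y) y := (hf.differentiable (by simp) y).hasDerivAt
    have h2 : HasDerivAt (deriv f) (deriv (deriv f) y) y :=
      (hf'.differentiable (by simp) y).hasDerivAt
    rw [(((hasDerivAt_id' y).fun_mul h2).fun_sub (h1.const_mul ((q + 1 : ℕ) : ℝ))).deriv]
    push_cast; ring

theorem iteratedDeriv_x_sq_mul {f : ℝ → ℝ} (hf : ContDiff ℝ ∞ f) (q : ℕ) (x : ℝ) :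
    iteratedDeriv q (fun x => x ^ 2 * deriv (deriv f) x - 2 * q * (x * deriv f x)
      + q * (q + 1) * f x) x = x ^ 2 * iteratedDeriv (q + 2) f x := by
  induction q generalizing f with
  | zero => simp [iteratedDeriv_succ]
  | succ q ih =>
    have hf' : ContDiff ℝ ∞ (deriv f) := (contDiff_infty_iff_deriv.mp hf).2
    have hf'' : ContDiff ℝ ∞ (deriv (deriv f)) := (contDiff_infty_iff_deriv.mp hf').2
    rw [iteratedDeriv_succ', iteratedDeriv_succ' (n := q + 2), ← ih hf']
    congr 1
    ext y
    have h1 : HasDerivAt f (deriv f y) y := (hf.differentiable (by simp) y).hasDerivAt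
    have h2 : HasDerivAt (deriv f) (deriv (deriv f) y) y :=
      (hf'.differentiable (by simp) y).hasDerivAt
    have h3 : HasDerivAt (deriv (deriv f)) (deriv (deriv (deriv f)) y) y :=
      (hf''.differentiable (by simp) y).hasDerivAt
    rw [((((hasDerivAt_pow 2 y).fun_mul h3).fun_sub (((hasDerivAt_id' y).fun_mul h2).const_mul
      (2 * ((q + 1 : ℕ) : ℝ)))).fun_add
      (h1.const_mul (((q + 1 : ℕ) : ℝ) * (((q + 1 : ℕ) : ℝ) + 1)))).deriv]
    push_cast; ring

/-! ### Smoothing of combs in a weighted norm -/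

theorem hasCompactSupport_pow_mul {b : ℝ → ℝ} (hs : HasCompactSupport b) (l : ℕ) :
    HasCompactSupport (fun x => x ^ l * b x) :=
  HasCompactSupport.mul_left (f := fun x : ℝ => x ^ l) hs

theorem integrable_cv_fiber {φ b : ℝ → ℝ} (hφ : Integrable φ) (hb : Continuous b)
    (hs : HasCompactSupport b) (x : ℝ) : Integrable (fun t => φ t * b (x - t)) := by
  obtain ⟨C, hC⟩ := hs.exists_bound_of_continuous hb
  exact hφ.mul_bdd (c := C) (by fun_prop) (Eventually.of_forall fun t => hC _)

/-- `x² = (x - t)² + 2 t (x - t) + t²` distributes the weight over the two factors of a convolution. -/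
theorem x_sq_mul_cv {φ b : ℝ → ℝ} (hφ0 : Integrable φ) (hφ1 : Integrable (fun x => x ^ 1 * φ x))
    (hφ2 : Integrable (fun x => x ^ 2 * φ x)) (hb : Continuous b) (hs : HasCompactSupport b)
    (x : ℝ) : x ^ 2 * cv φ b x = cv φ (fun x => x ^ 2 * b x) x +
      2 * cv (fun x => x ^ 1 * φ x) (fun x => x ^ 1 * b x) x + cv (fun x => x ^ 2 * φ x) b x := by
  have h2 := integrable_cv_fiber (b := fun x => x ^ 2 * b x) hφ0 (by fun_prop)
    (hasCompactSupport_pow_mul hs 2) x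
  have h1 := integrable_cv_fiber (b := fun x => x ^ 1 * b x) hφ1 (by fun_prop)
    (hasCompactSupport_pow_mul hs 1) x
  have h0 := integrable_cv_fiber hφ2 hb hs x
  simp only [cv_apply]
  rw [← integral_const_mul, ← integral_const_mul, ← integral_add h2 (h1.const_mul 2),
    ← integral_add (by exact h2.add (h1.const_mul 2)) h0]
  congr 1
  ext t
  ring

/-- Convolution of `φ` with `xˡ A`, for a comb `A` with weights `s`, has squared `L²` norm of order
`h ^ (2 * β) * (h * ∑ k, s k ^ 2)`, as soon as `xˡ A = h ^ q V⁽q⁾` with `V` dominated by combs of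
derivatives of order at most two. -/
theorem integral_cv_pow_comb_sq_le {φ V : ℝ → ℝ} {β c C h : ℝ} {q l m : ℕ} {s : Fin m → ℝ}
    (hβ : 0 < β) (hq : β ≤ q) (hφ : Integrable φ)
    (hφb : ∀ t, ‖fourier φ t‖ ≤ c * (1 + |t|) ^ (-β)) (hh : 0 < h) (hm : 2 * m * h ≤ 1)
    (hV : ContDiff ℝ ∞ V)
    (hVb : ∀ x, V x ^ 2 ≤ C * (comb h 2 s x ^ 2 + comb h 1 s x ^ 2 + comb h 0 s x ^ 2))
    (hAV : ∀ x, x ^ l * comb h (q + 2) s x = h ^ q * iteratedDeriv q V x) :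
    ∫ x, cv φ (fun x => x ^ l * comb h (q + 2) s x) x ^ 2 ≤
      c ^ 2 * (C * ((∫ x, bump 2 x ^ 2) + (∫ x, bump 1 x ^ 2) + ∫ x, bump 0 x ^ 2) +
        ∫ x, bump (q + 2) x ^ 2) * h ^ (2 * β) * (h * ∑ k, s k ^ 2) := by
  have hVs : HasCompactSupport V := by
    refine HasCompactSupport.intro (isCompact_Icc (a := (0 : ℝ)) (b := 1)) fun x hx => ?_
    have := hVb x
    simp only [comb_eq_zero hh hm hx] at this
    nlinarith [sq_nonneg (V x)]
  have hi := fun i => integrable_comb_sq (i := i) (s := s) hh hm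
  have h1 : ∫ x, V x ^ 2 ≤ C * ((h * ∑ k, s k ^ 2) * (∫ x, bump 2 x ^ 2) +
      (h * ∑ k, s k ^ 2) * (∫ x, bump 1 x ^ 2) + (h * ∑ k, s k ^ 2) * ∫ x, bump 0 x ^ 2) := by
    rw [← integral_comb_sq hh, ← integral_comb_sq hh, ← integral_comb_sq hh,
      ← integral_add (hi 2) (hi 1), ← integral_add (by exact (hi 2).add (hi 1)) (hi 0),
      ← integral_const_mul]
    exact integral_mono_of_nonneg (Eventually.of_forall fun x => sq_nonneg _)
      ((((hi 2).add (hi 1)).add (hi 0)).const_mul C) (Eventually.of_forall hVb)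
  have h2 : ∫ x, (x ^ l * comb h (q + 2) s x) ^ 2 ≤
      (h * ∑ k, s k ^ 2) * ∫ x, bump (q + 2) x ^ 2 := by
    rw [← integral_comb_sq hh]
    refine integral_mono_of_nonneg (Eventually.of_forall fun x => sq_nonneg _) (hi _)
      (Eventually.of_forall fun x => ?_)
    simp only
    by_cases hx : x ∈ Set.Icc (0 : ℝ) 1
    · rw [mul_pow]
      exact mul_le_of_le_one_left (sq_nonneg _) (pow_le_one₀ (pow_nonneg hx.1 l)
        (pow_le_one₀ hx.1 hx.2))
    · simp [comb_eq_zero hh hm hx]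
  refine (integral_cv_sq_le hβ hq hφ hφb hh hV hVs hAV).trans ?_
  calc _ ≤ c ^ 2 * h ^ (2 * β) * (C * ((h * ∑ k, s k ^ 2) * (∫ x, bump 2 x ^ 2) +
      (h * ∑ k, s k ^ 2) * (∫ x, bump 1 x ^ 2) + (h * ∑ k, s k ^ 2) * ∫ x, bump 0 x ^ 2) +
      (h * ∑ k, s k ^ 2) * ∫ x, bump (q + 2) x ^ 2) := by gcongr
    _ = _ := by ring

theorem sq_sub_le_of_unit (q : ℕ) {h x : ℝ} (hh : 0 ≤ h) (hh1 : h ≤ 1) (hx : 0 ≤ x) (hx1 : x ≤ 1)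
    (a b c : ℝ) :
    (x * a - q * h * b) ^ 2 ≤ 12 * ((q : ℝ) + 1) ^ 4 * (a ^ 2 + b ^ 2 + c ^ 2) := by
  have hq0 : (0 : ℝ) ≤ q := by positivity
  have hx2 : x ^ 2 ≤ 1 := pow_le_one₀ hx hx1
  have hh2 : h ^ 2 ≤ 1 := pow_le_one₀ hh hh1
  have hq4 : (1 : ℝ) ≤ ((q : ℝ) + 1) ^ 4 := one_le_pow₀ (by linarith)
  have hq2 : (q : ℝ) ^ 2 ≤ ((q : ℝ) + 1) ^ 4 := by
    calc (q : ℝ) ^ 2 ≤ ((q : ℝ) + 1) ^ 2 := by gcongr; linarith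
      _ ≤ ((q : ℝ) + 1) ^ 4 := pow_le_pow_right₀ (by linarith) (by norm_num)
  set Q := ((q : ℝ) + 1) ^ 4
  calc (x * a - q * h * b) ^ 2 ≤ 2 * (x * a) ^ 2 + 2 * (q * h * b) ^ 2 := by
        linarith [sq_nonneg (x * a + q * h * b), add_sq (x * a) (q * h * b),
          sub_sq (x * a) (q * h * b)]
    _ = 2 * (x ^ 2 * a ^ 2) + 2 * ((q ^ 2 * h ^ 2) * b ^ 2) := by ring
    _ ≤ 2 * (Q * a ^ 2) + 2 * ((Q * 1) * b ^ 2) := by gcongr; exact hx2.trans hq4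
    _ ≤ _ := by
        have h1 : 0 ≤ Q * a ^ 2 := by positivity
        have h2 : 0 ≤ Q * b ^ 2 := by positivity
        have h3 : 0 ≤ Q * c ^ 2 := by positivity
        linarith

theorem sq_sub_add_le_of_unit (q : ℕ) {h x : ℝ} (hh : 0 ≤ h) (hh1 : h ≤ 1) (hx : 0 ≤ x)
    (hx1 : x ≤ 1) (a b c : ℝ) :
    (x ^ 2 * a - 2 * q * x * h * b + q * (q + 1) * h ^ 2 * c) ^ 2 ≤
      12 * ((q : ℝ) + 1) ^ 4 * (a ^ 2 + b ^ 2 + c ^ 2) := by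
  have hq0 : (0 : ℝ) ≤ q := by positivity
  have hx2 : x ^ 2 ≤ 1 := pow_le_one₀ hx hx1
  have hx4 : x ^ 4 ≤ 1 := pow_le_one₀ hx hx1
  have hh2 : h ^ 2 ≤ 1 := pow_le_one₀ hh hh1
  have hh4 : h ^ 4 ≤ 1 := pow_le_one₀ hh hh1
  have hq4 : (1 : ℝ) ≤ ((q : ℝ) + 1) ^ 4 := one_le_pow₀ (by linarith)
  have hq2 : (q : ℝ) ^ 2 ≤ ((q : ℝ) + 1) ^ 4 := by
    calc (q : ℝ) ^ 2 ≤ ((q : ℝ) + 1) ^ 2 := by gcongr; linarith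
      _ ≤ ((q : ℝ) + 1) ^ 4 := pow_le_pow_right₀ (by linarith) (by norm_num)
  have hq3 : ((q : ℝ) * (q + 1)) ^ 2 ≤ ((q : ℝ) + 1) ^ 4 := by
    calc ((q : ℝ) * (q + 1)) ^ 2 ≤ (((q : ℝ) + 1) * (q + 1)) ^ 2 := by gcongr; linarith
      _ = ((q : ℝ) + 1) ^ 4 := by ring
  set Q := ((q : ℝ) + 1) ^ 4
  have h3 : ∀ u v w : ℝ, (u - v + w) ^ 2 ≤ 3 * (u ^ 2 + v ^ 2 + w ^ 2) := fun u v w => by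
    nlinarith [sq_nonneg (u + v), sq_nonneg (u - w), sq_nonneg (v + w)]
  calc _ ≤ 3 * ((x ^ 2 * a) ^ 2 + (2 * q * x * h * b) ^ 2 + (q * (q + 1) * h ^ 2 * c) ^ 2) :=
        h3 _ _ _
    _ = 3 * (x ^ 4 * a ^ 2 + 4 * (q ^ 2 * x ^ 2 * h ^ 2) * b ^ 2 +
          (q * (q + 1)) ^ 2 * h ^ 4 * c ^ 2) := by ring
    _ ≤ 3 * (Q * a ^ 2 + 4 * (Q * 1 * 1) * b ^ 2 + Q * 1 * c ^ 2) := by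
        gcongr; exact hx4.trans hq4
    _ ≤ _ := by
        have h1 : 0 ≤ Q * a ^ 2 := by positivity
        have h2 : 0 ≤ Q * b ^ 2 := by positivity
        have h3 : 0 ≤ Q * c ^ 2 := by positivity
        linarith

theorem integral_add_four {a b c d : ℝ → ℝ} (ha : Integrable a) (hb : Integrable b)
    (hc : Integrable c) (hd : Integrable d) :
    ∫ x, (2 * a x + (6 * b x + (24 * c x + 6 * d x))) =
      2 * (∫ x, a x) + (6 * (∫ x, b x) + (24 * (∫ x, c x) + 6 * ∫ x, d x)) := by
  have h1 : Integrable (fun x => 24 * c x + 6 * d x) := (hc.const_mul 24).add (hd.const_mul 6)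
  have h2 : Integrable (fun x => 6 * b x + (24 * c x + 6 * d x)) := (hb.const_mul 6).add h1
  rw [integral_add (ha.const_mul 2) h2, integral_add (hb.const_mul 6) h1,
    integral_add (hc.const_mul 24) (hd.const_mul 6), integral_const_mul, integral_const_mul,
    integral_const_mul, integral_const_mul]

/-- The weighted smoothing estimate: convolving the comb with the noise density gains a factor
`h ^ β` in `L²`, even with the weight `(1 + y²)²`. -/
theorem exists_weighted_bound {φ : ℝ → ℝ} {β c : ℝ} {q : ℕ} (hβ : 0 < β) (hq : β ≤ q)
    (hφ0 : Integrable φ) (hφ1 : Integrable (fun x => x ^ 1 * φ x))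
    (hφ2 : Integrable (fun x => x ^ 2 * φ x))
    (hb0 : ∀ t, ‖fourier φ t‖ ≤ c * (1 + |t|) ^ (-β))
    (hb1 : ∀ t, ‖fourier (fun x => x ^ 1 * φ x) t‖ ≤ c * (1 + |t|) ^ (-β))
    (hb2 : ∀ t, ‖fourier (fun x => x ^ 2 * φ x) t‖ ≤ c * (1 + |t|) ^ (-β)) :
    ∃ C, 0 < C ∧ ∀ (m : ℕ) (h : ℝ) (s : Fin m → ℝ), 0 < h → h ≤ 1 → 2 * m * h ≤ 1 →
      Integrable (fun y => cv φ (comb h (q + 2) s) y ^ 2 * (1 + y ^ 2) ^ 2) ∧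
      ∫ y, cv φ (comb h (q + 2) s) y ^ 2 * (1 + y ^ 2) ^ 2 ≤
        C * h ^ (2 * β) * (h * ∑ k, s k ^ 2) := by
  set Cq : ℝ := 12 * (q + 1) ^ 4 with hCq
  set K : ℝ := c ^ 2 * (Cq * ((∫ x, bump 2 x ^ 2) + (∫ x, bump 1 x ^ 2) + ∫ x, bump 0 x ^ 2) +
        ∫ x, bump (q + 2) x ^ 2) with hK
  have hK0 : 0 ≤ K := by positivity
  refine ⟨38 * K + 1, by positivity, fun m h s hh hh1 hm => ?_⟩
  set A := comb h (q + 2) s with hA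
  have hAc : Continuous A := contDiff_comb.continuous
  have hAs : HasCompactSupport A := hasCompactSupport_comb hh hm
  have hcd : ∀ i, ContDiff ℝ ∞ (comb h i s) := fun i => contDiff_comb
  have hcz : ∀ i x, x ∉ Set.Icc (0 : ℝ) 1 → comb h i s x = 0 := fun i x hx =>
    comb_eq_zero hh hm hx
  have hd1 : deriv (comb h 0 s) = fun x => h⁻¹ * comb h 1 s x := deriv_comb
  have hd2 : deriv (deriv (comb h 0 s)) = fun x => h⁻¹ ^ 2 * comb h 2 s x := by
    rw [hd1]
    ext x
    rw [deriv_const_mul_field, deriv_comb]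
    ring
  have hq0 : (0 : ℝ) ≤ q := by positivity
  -- the three functions `V` with `xˡ A = h ^ q V⁽q⁾`
  have e0 : ∀ x, x ^ 0 * comb h (q + 2) s x = h ^ q * iteratedDeriv q (comb h 2 s) x := fun x => by
    rw [iteratedDeriv_comb hh.ne', add_comm]; simp
  have e1 : ∀ x, x ^ 1 * comb h (q + 2) s x = h ^ q * iteratedDeriv q
      (fun x => h ^ 2 * (x * deriv (deriv (comb h 0 s)) x - q * deriv (comb h 0 s) x)) x := by
    intro x
    have h1 : ContDiff ℝ ∞ (deriv (comb h 0 s)) := (contDiff_infty_iff_deriv.mp (hcd 0)).2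
    rw [iteratedDeriv_const_mul_field, iteratedDeriv_x_mul h1, ← iteratedDeriv_succ',
      show q + 2 = 0 + (q + 1 + 1) by ring, ← iteratedDeriv_comb hh.ne']
    ring_nf
  have e2 : ∀ x, x ^ 2 * comb h (q + 2) s x = h ^ q * iteratedDeriv q
      (fun x => h ^ 2 * (x ^ 2 * deriv (deriv (comb h 0 s)) x - 2 * q * (x * deriv (comb h 0 s) x)
      + q * (q + 1) * comb h 0 s x)) x := by
    intro x
    rw [iteratedDeriv_const_mul_field, iteratedDeriv_x_sq_mul (hcd 0),
      show q + 2 = 0 + (q + 2) by ring, ← iteratedDeriv_comb hh.ne']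
    ring_nf
  have v0 : ∀ x, comb h 2 s x ^ 2 ≤
      Cq * (comb h 2 s x ^ 2 + comb h 1 s x ^ 2 + comb h 0 s x ^ 2) := by
    intro x
    have : (1 : ℝ) ≤ Cq := by
      have : (1 : ℝ) ≤ (q + 1) ^ 4 := one_le_pow₀ (by linarith)
      rw [hCq]; linarith
    have h2 : 0 ≤ comb h 1 s x ^ 2 + comb h 0 s x ^ 2 := by positivity
    have h3 := le_mul_of_one_le_left (add_nonneg (sq_nonneg (comb h 2 s x)) h2) this
    linarith
  have v1 : ∀ x, (h ^ 2 * (x * deriv (deriv (comb h 0 s)) x - q * deriv (comb h 0 s) x)) ^ 2 ≤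
      Cq * (comb h 2 s x ^ 2 + comb h 1 s x ^ 2 + comb h 0 s x ^ 2) := by
    intro x
    rw [hd2, hd1]
    by_cases hx : x ∈ Set.Icc (0 : ℝ) 1
    · have e : h ^ 2 * (x * (h⁻¹ ^ 2 * comb h 2 s x) - q * (h⁻¹ * comb h 1 s x)) =
          x * comb h 2 s x - q * h * comb h 1 s x := by field_simp
      simp only [e]
      exact sq_sub_le_of_unit q hh.le hh1 hx.1 hx.2 _ _ _
    · simp [hcz _ _ hx]
  have v2 : ∀ x, (h ^ 2 * (x ^ 2 * deriv (deriv (comb h 0 s)) x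
      - 2 * q * (x * deriv (comb h 0 s) x) + q * (q + 1) * comb h 0 s x)) ^ 2 ≤
      Cq * (comb h 2 s x ^ 2 + comb h 1 s x ^ 2 + comb h 0 s x ^ 2) := by
    intro x
    rw [hd2, hd1]
    by_cases hx : x ∈ Set.Icc (0 : ℝ) 1
    · have e : h ^ 2 * (x ^ 2 * (h⁻¹ ^ 2 * comb h 2 s x) - 2 * q * (x * (h⁻¹ * comb h 1 s x))
          + q * (q + 1) * comb h 0 s x) =
          x ^ 2 * comb h 2 s x - 2 * q * x * h * comb h 1 s x +
            q * (q + 1) * h ^ 2 * comb h 0 s x := by field_simp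
      simp only [e]
      exact sq_sub_add_le_of_unit q hh.le hh1 hx.1 hx.2 _ _ _
    · simp [hcz _ _ hx]
  have cd1 : ContDiff ℝ ∞
      (fun x => h ^ 2 * (x * deriv (deriv (comb h 0 s)) x - q * deriv (comb h 0 s) x)) := by
    rw [hd2, hd1]; have := hcd 1; have := hcd 2; fun_prop
  have cd2 : ContDiff ℝ ∞ (fun x => h ^ 2 * (x ^ 2 * deriv (deriv (comb h 0 s)) x
      - 2 * q * (x * deriv (comb h 0 s) x) + q * (q + 1) * comb h 0 s x)) := by
    rw [hd2, hd1]; have := hcd 1; have := hcd 2; have := hcd 0; fun_prop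
  set X := K * h ^ (2 * β) * (h * ∑ k, s k ^ 2) with hX
  have b00 : ∫ x, cv φ A x ^ 2 ≤ X := by
    simpa using integral_cv_pow_comb_sq_le hβ hq hφ0 hb0 hh hm (hcd 2) v0 e0
  have b02 : ∫ x, cv (fun x => x ^ 2 * φ x) A x ^ 2 ≤ X := by
    simpa using integral_cv_pow_comb_sq_le hβ hq hφ2 hb2 hh hm (hcd 2) v0 e0
  have b1 : ∫ x, cv (fun x => x ^ 1 * φ x) (fun x => x ^ 1 * A x) x ^ 2 ≤ X :=
    integral_cv_pow_comb_sq_le hβ hq hφ1 hb1 hh hm cd1 v1 e1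
  have b2 : ∫ x, cv φ (fun x => x ^ 2 * A x) x ^ 2 ≤ X :=
    integral_cv_pow_comb_sq_le hβ hq hφ0 hb0 hh hm cd2 v2 e2
  have i00 := integrable_cv_sq hφ0 hAc hAs
  have i02 := integrable_cv_sq hφ2 hAc hAs
  have i1 := integrable_cv_sq (b := fun x => x ^ 1 * A x) hφ1 (by fun_prop)
    (hasCompactSupport_pow_mul hAs 1)
  have i2 := integrable_cv_sq (b := fun x => x ^ 2 * A x) hφ0 (by fun_prop)
    (hasCompactSupport_pow_mul hAs 2)
  have hpt : ∀ y, cv φ A y ^ 2 * (1 + y ^ 2) ^ 2 ≤ 2 * cv φ A y ^ 2 +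
      (6 * cv φ (fun x => x ^ 2 * A x) y ^ 2 +
      (24 * cv (fun x => x ^ 1 * φ x) (fun x => x ^ 1 * A x) y ^ 2 +
      6 * cv (fun x => x ^ 2 * φ x) A y ^ 2)) := by
    intro y
    have hy := x_sq_mul_cv hφ0 hφ1 hφ2 hAc hAs y
    set u := cv φ A y
    set a := cv φ (fun x => x ^ 2 * A x) y
    set b := cv (fun x => x ^ 1 * φ x) (fun x => x ^ 1 * A x) y
    set d := cv (fun x => x ^ 2 * φ x) A y
    have h1 : u ^ 2 * (1 + y ^ 2) ^ 2 ≤ 2 * u ^ 2 + 2 * (y ^ 2 * u) ^ 2 := by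
      nlinarith [sq_nonneg (u - y ^ 2 * u)]
    rw [hy] at h1
    nlinarith [sq_nonneg (a - 2 * b), sq_nonneg (a - d), sq_nonneg (2 * b - d)]
  have ibound := (i00.const_mul 2).add ((i2.const_mul 6).add
    ((i1.const_mul 24).add (i02.const_mul 6)))
  have iint : Integrable (fun y => cv φ A y ^ 2 * (1 + y ^ 2) ^ 2) := by
    refine Integrable.mono' ibound ?_ (Eventually.of_forall fun y => ?_)
    · exact (((continuous_cv hφ0 hAc hAs).pow 2).mul (by fun_prop)).aestronglyMeasurable
    · rw [Real.norm_of_nonneg (by positivity)]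
      exact hpt y
  refine ⟨iint, (integral_mono iint ibound hpt).trans ?_⟩
  refine (integral_add_four i00 i2 i1 i02).trans_le ?_
  have hnn : 0 ≤ h ^ (2 * β) * (h * ∑ k, s k ^ 2) := by positivity
  have hfin : (38 * K + 1) * h ^ (2 * β) * (h * ∑ k, s k ^ 2) =
    38 * X + h ^ (2 * β) * (h * ∑ k, s k ^ 2) := by rw [hX]; ring
  rw [hfin]
  linarith

/-! ### Moments of the noise, and a heavy-tailed density -/

theorem integral_ofDensity {E F : Type*} [MeasureSpace E] [NormedAddCommGroup F] [NormedSpace ℝ F]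
    {f : E → ℝ} (hf : IsDensity f) (g : E → F) :
    ∫ x, g x ∂(ofDensity f) = ∫ x, f x • g x := by
  rw [ofDensity, integral_withDensity_eq_integral_toReal_smul₀
    hf.integrable.aestronglyMeasurable.aemeasurable.ennreal_ofReal
    (Eventually.of_forall fun x => ENNReal.ofReal_lt_top)]
  refine integral_congr_ae (Eventually.of_forall fun x => ?_)
  simp only
  rw [ENNReal.toReal_ofReal (hf.nonneg x)]

theorem isProbabilityMeasure_ofDensity {E : Type*} [MeasureSpace E] {f : E → ℝ}
    (hf : IsDensity f) : IsProbabilityMeasure (ofDensity f) := by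
  constructor
  rw [ofDensity, withDensity_apply _ MeasurableSet.univ, Measure.restrict_univ,
    ← ofReal_integral_eq_lintegral_ofReal hf.integrable (Eventually.of_forall hf.nonneg),
    hf.integral_eq_one, ENNReal.ofReal_one]

theorem fourier_eq_charFun {E : Type*} [NormedAddCommGroup E] [InnerProductSpace ℝ E]
    [MeasureSpace E] {f : E → ℝ} (hf : IsDensity f) (t : E) :
    fourier f t = charFun (ofDensity f) t := by
  rw [charFun_apply, integral_ofDensity hf, fourier]
  refine integral_congr_ae (Eventually.of_forall fun x => ?_)
  simp only [Complex.real_smul]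
  rw [real_inner_comm, mul_comm, mul_comm Complex.I]

/-- A lower bound for the second difference quotient of step `1 / n`, valid once `n` is large. -/
theorem sq_le_sub_cos {x : ℝ} {n : ℕ} (hn : 0 < n) (hx : |x| ≤ Real.pi * n) :
    4 / Real.pi ^ 2 * x ^ 2 ≤ n ^ 2 * (2 * (1 - Real.cos (x / n))) := by
  have hn' : (0 : ℝ) < n := by exact_mod_cast hn
  have h1 : |x / n| ≤ Real.pi := by
    rw [abs_div, abs_of_pos hn', div_le_iff₀ hn']; exact hx
  have h2 := Real.cos_le_one_sub_mul_cos_sq h1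
  have h3 : (n : ℝ) ^ 2 * (2 * (2 / Real.pi ^ 2 * (x / n) ^ 2)) = 4 / Real.pi ^ 2 * x ^ 2 := by
    field_simp; ring
  rw [← h3]
  gcongr
  linarith

/-- A law whose characteristic function is twice differentiable with bounded second derivative
has a second moment: Fatou's lemma for the second difference quotients at `0`. -/
theorem memLp_id_two_of_charFun {μ : Measure ℝ} [IsProbabilityMeasure μ]
    (hd1 : Differentiable ℝ (charFun μ)) (hd2 : Differentiable ℝ (deriv (charFun μ))) {K : ℝ}
    (hK : ∀ t, ‖deriv (deriv (charFun μ)) t‖ ≤ K) : MemLp (id : ℝ → ℝ) 2 μ := by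
  set φ := charFun μ with hφ
  have hlip : ∀ a b, ‖deriv φ b - deriv φ a‖ ≤ K * ‖b - a‖ := fun a b =>
    convex_univ.norm_image_sub_le_of_norm_deriv_le (fun x _ => hd2 x) (fun x _ => hK x)
      (Set.mem_univ a) (Set.mem_univ b)
  have hK0 : 0 ≤ K := (norm_nonneg _).trans (hK 0)
  have hsecond : ∀ t : ℝ, 0 ≤ t → ‖φ t + φ (-t) - (φ 0 + φ (-0))‖ ≤ (2 * K * t) * t := by
    intro t ht
    have hder : ∀ s, HasDerivAt (fun s => φ s + φ (-s)) (deriv φ s + -deriv φ (-s)) s := by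
      intro s
      refine (hd1 s).hasDerivAt.add ?_
      have := (hd1 (-s)).hasDerivAt.scomp s (hasDerivAt_neg s)
      simpa [Function.comp_def] using this
    have := (convex_Icc (0 : ℝ) t).norm_image_sub_le_of_norm_hasDerivWithin_le
      (f := fun s => φ s + φ (-s)) (C := 2 * K * t) (fun s _ => (hder s).hasDerivWithinAt)
      (fun s hs => ?_) (Set.left_mem_Icc.mpr ht) (Set.right_mem_Icc.mpr ht)
    · simpa [abs_of_nonneg ht] using this
    · rw [← sub_eq_add_neg]
      refine (hlip _ _).trans ?_
      rw [Real.norm_eq_abs, sub_neg_eq_add, abs_of_nonneg (by linarith [hs.1])]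
      nlinarith [hs.2]
  have hcosint : ∀ t : ℝ, Integrable (fun x => Real.cos (x * t)) μ := fun t =>
    Integrable.of_bound (by fun_prop) 1 (Eventually.of_forall fun x => by
      simpa using Real.abs_cos_le_one _)
  have hre : ∀ t : ℝ, φ t + φ (-t) = ((2 * ∫ x, Real.cos (x * t) ∂μ : ℝ) : ℂ) := by
    intro t
    rw [hφ, charFun_apply_real, charFun_apply_real, ← integral_add]
    · rw [← integral_const_mul, ← integral_complex_ofReal]
      refine integral_congr_ae (Eventually.of_forall fun x => ?_)
      simp only
      push_cast
      rw [Complex.two_cos]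
      ring_nf
    · refine Integrable.of_bound (by fun_prop) 1 (Eventually.of_forall fun x => ?_)
      rw [← Complex.ofReal_mul, Complex.norm_exp_ofReal_mul_I]
    · refine Integrable.of_bound (by fun_prop) 1 (Eventually.of_forall fun x => ?_)
      rw [← Complex.ofReal_mul, Complex.norm_exp_ofReal_mul_I]
  have hcos : ∀ t : ℝ, 0 ≤ t → ∫ x, 2 * (1 - Real.cos (x * t)) ∂μ ≤ 2 * K * t ^ 2 := by
    intro t ht
    have h1 := hsecond t ht
    rw [hre t, hre 0, ← Complex.ofReal_sub, Complex.norm_real, Real.norm_eq_abs] at h1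
    rw [integral_const_mul, integral_sub (integrable_const _) (hcosint t)]
    simp only [mul_zero, Real.cos_zero] at h1
    have := (abs_le.mp h1).1
    nlinarith
  have hlint : ∀ n : ℕ, 0 < n →
      ∫⁻ x, ENNReal.ofReal (n ^ 2 * (2 * (1 - Real.cos (x / n)))) ∂μ ≤ ENNReal.ofReal (2 * K) := by
    intro n hn
    have hn' : (0 : ℝ) < n := by exact_mod_cast hn
    rw [← ofReal_integral_eq_lintegral_ofReal]
    · refine ENNReal.ofReal_le_ofReal ?_
      rw [integral_const_mul]
      simp_rw [div_eq_mul_inv]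
      calc _ ≤ (n : ℝ) ^ 2 * (2 * K * (n : ℝ)⁻¹ ^ 2) := by
            gcongr; exact hcos _ (by positivity)
        _ = _ := by field_simp
    · have := hcosint (n : ℝ)⁻¹
      simp_rw [← div_eq_mul_inv] at this
      exact (((integrable_const _).sub this).const_mul _).const_mul _
    · refine Eventually.of_forall fun x => ?_
      have := Real.cos_le_one (x / n)
      simp only [Pi.zero_apply]
      have : 0 ≤ 1 - Real.cos (x / n) := by linarith
      positivity
  have hfatou : ∫⁻ x, ENNReal.ofReal (4 / Real.pi ^ 2 * x ^ 2) ∂μ ≤ ENNReal.ofReal (2 * K) := by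
    calc ∫⁻ x, ENNReal.ofReal (4 / Real.pi ^ 2 * x ^ 2) ∂μ
        ≤ ∫⁻ x, liminf (fun n : ℕ =>
            ENNReal.ofReal (n ^ 2 * (2 * (1 - Real.cos (x / n))))) atTop ∂μ := by
          refine lintegral_mono fun x => ?_
          refine le_liminf_of_le (by isBoundedDefault) ?_
          obtain ⟨N, hN⟩ := exists_nat_ge (|x| / Real.pi)
          filter_upwards [eventually_ge_atTop (N + 1)] with n hn
          refine ENNReal.ofReal_le_ofReal (sq_le_sub_cos (by omega) ?_)
          have : (N : ℝ) ≤ n := by exact_mod_cast (by omega : N ≤ n)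
          rw [div_le_iff₀ Real.pi_pos] at hN
          nlinarith [Real.pi_pos]
      _ ≤ liminf (fun n : ℕ => ∫⁻ x,
            ENNReal.ofReal (n ^ 2 * (2 * (1 - Real.cos (x / n)))) ∂μ) atTop :=
          lintegral_liminf_le fun n => by fun_prop
      _ ≤ ENNReal.ofReal (2 * K) := by
          refine liminf_le_of_frequently_le' (Eventually.frequently ?_)
          filter_upwards [eventually_gt_atTop 0] with n hn using hlint n hn
  have hi : Integrable (fun x : ℝ => 4 / Real.pi ^ 2 * x ^ 2) μ := by
    refine ⟨by fun_prop, ?_⟩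
    rw [hasFiniteIntegral_iff_ofReal (Eventually.of_forall fun x => by positivity)]
    exact hfatou.trans_lt ENNReal.ofReal_lt_top
  rw [memLp_two_iff_integrable_sq (by fun_prop)]
  have := hi.const_mul (Real.pi ^ 2 / 4)
  refine this.congr (Eventually.of_forall fun x => ?_)
  have := Real.pi_ne_zero
  simp only [id]
  field_simp

/-- The noise has a second moment, and the densities `xˡ fε`, whose transforms are the derivatives
of the transform of `fε` up to a unimodular factor, have transforms decaying at least like
`(1 + |t|) ^ (-β)`. -/
theorem noise_moments {fε : ℝ → ℝ} (hfε : IsDensity fε) {β : ℝ} (hβ : 0 < β)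
    (hdiff : ∀ l < 2, Differentiable ℝ (iteratedDeriv l (fourier fε)))
    {c : ℕ → ℝ} (hc : ∀ l ≤ 2, 0 < c l)
    (hbound : ∀ l ≤ 2, ∀ t : ℝ,
      ‖iteratedDeriv l (fourier fε) t‖ ≤ c l * (1 + |t|) ^ (-(β + (l : ℝ)))) :
    ∃ C, ∀ l ≤ 2, Integrable (fun x => x ^ l * fε x) ∧
      ∀ t, ‖fourier (fun x => x ^ l * fε x) t‖ ≤ C * (1 + |t|) ^ (-β) := by
  have hP := isProbabilityMeasure_ofDensity hfε
  have hF : fourier fε = charFun (ofDensity fε) := funext fun t => fourier_eq_charFun hfε t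
  rw [hF] at hdiff hbound
  have hmono : ∀ l ≤ 2, ∀ t : ℝ, c l * (1 + |t|) ^ (-(β + (l : ℝ))) ≤
      (c 0 + c 1 + c 2) * (1 + |t|) ^ (-β) := by
    intro l hl t
    have h1 : (1 + |t|) ^ (-(β + (l : ℝ))) ≤ (1 + |t|) ^ (-β) :=
      Real.rpow_le_rpow_of_exponent_le (by linarith [abs_nonneg t])
        (by linarith [(Nat.cast_nonneg l : (0 : ℝ) ≤ l)])
    have h2 : c l ≤ c 0 + c 1 + c 2 := by
      have h0 := hc 0 (by norm_num)
      have h1 := hc 1 (by norm_num)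
      have h2 := hc 2 (by norm_num)
      interval_cases l <;> linarith
    have h3 : 0 < c l := hc l hl
    have h4 : 0 < c 0 + c 1 + c 2 := by linarith
    gcongr
  have hmem2 : MemLp (id : ℝ → ℝ) 2 (ofDensity fε) := by
    refine memLp_id_two_of_charFun (by simpa using hdiff 0 (by norm_num))
      (by simpa [iteratedDeriv_one] using hdiff 1 (by norm_num)) (K := c 2) fun t => ?_
    have h1 := hbound 2 le_rfl t
    rw [iteratedDeriv_succ, iteratedDeriv_one] at h1
    refine h1.trans (mul_le_of_le_one_right (hc 2 le_rfl).le
      (Real.rpow_le_one_of_one_le_of_nonpos (by linarith [abs_nonneg t]) ?_))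
    push_cast
    linarith
  refine ⟨c 0 + c 1 + c 2, fun l hl => ?_⟩
  have hmem : MemLp (id : ℝ → ℝ) l (ofDensity fε) :=
    hmem2.mono_exponent (by exact_mod_cast hl)
  have hi : Integrable (fun x => x ^ l) (ofDensity fε) := by
    refine (integrable_norm_iff (by fun_prop)).mp ?_
    simpa using hmem.integrable_norm_pow'
  constructor
  · rw [ofDensity, integrable_withDensity_iff_integrable_smul₀'
      hfε.integrable.aestronglyMeasurable.aemeasurable.ennreal_ofReal
      (Eventually.of_forall fun x => ENNReal.ofReal_lt_top)] at hi
    refine hi.congr (Eventually.of_forall fun x => ?_)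
    simp only [smul_eq_mul]
    rw [ENNReal.toReal_ofReal (hfε.nonneg x), mul_comm]
  · intro t
    refine le_trans (le_of_eq ?_) ((hbound l hl t).trans (hmono l hl t))
    rw [iteratedDeriv_charFun hmem, norm_mul, norm_pow, Complex.norm_I, one_pow, one_mul,
      integral_ofDensity hfε, fourier]
    congr 1
    refine integral_congr_ae (Eventually.of_forall fun x => ?_)
    simp
    ring_nf

theorem integrable_heavy : Integrable (fun y : ℝ => ((1 + y ^ 2) ^ 2)⁻¹) := by
  refine Integrable.mono' integrable_inv_one_add_sq
    (Continuous.aestronglyMeasurable (Continuous.inv₀ (by fun_prop) fun y => by positivity))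
    (Eventually.of_forall fun y => ?_)
  rw [Real.norm_of_nonneg (by positivity)]
  gcongr
  nlinarith [sq_nonneg y, sq_nonneg (y ^ 2)]

theorem integrable_abs_mul_heavy : Integrable (fun y : ℝ => |y| * ((1 + y ^ 2) ^ 2)⁻¹) := by
  refine Integrable.mono' integrable_inv_one_add_sq (Continuous.aestronglyMeasurable
    (continuous_abs.mul (Continuous.inv₀ (by fun_prop) fun y => by positivity)))
    (Eventually.of_forall fun y => ?_)
  rw [Real.norm_of_nonneg (by positivity), ← div_eq_mul_inv, ← one_div,
    div_le_div_iff₀ (by positivity) (by positivity), one_mul, pow_two (1 + y ^ 2)]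
  gcongr
  nlinarith [sq_nonneg (|y| - 1), sq_abs y]

/-- A smooth density on the line with tails of order `x⁻⁴`, arbitrarily small first moment and
finite Sobolev norms of all orders: a rescaled `(1 + y²)⁻²` mollified by a bump. -/
theorem exists_heavy_density {ε : ℝ} (hε : 0 < ε) : ∃ q : ℝ → ℝ, Continuous q ∧ IsDensity q ∧
    Integrable (fun x => |x| * q x) ∧ ∫ x, |x| * q x ≤ ε ∧
    (∃ c, 0 < c ∧ ∀ x, c * ((1 + x ^ 2) ^ 2)⁻¹ ≤ q x) ∧
    ∀ α : ℝ, Integrable (fun t => ‖fourier q t‖ ^ 2 * (1 + t ^ 2) ^ α) := by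
  set n₀ : ℝ → ℝ := fun y => ((1 + y ^ 2) ^ 2)⁻¹ with hn₀
  set Z := ∫ y, n₀ y with hZ
  have hn₀pos : ∀ y, 0 < n₀ y := fun y => by positivity
  have hZ0 : 0 < Z := by
    rw [hZ, integral_pos_iff_support_of_nonneg (fun y => (hn₀pos y).le) integrable_heavy]
    have : Function.support n₀ = Set.univ := by
      ext y; simpa using (hn₀pos y).ne'
    rw [this]; simp
  set m₁ := ∫ y, |y| * n₀ y with hm₁
  have hm₁0 : 0 ≤ m₁ := integral_nonneg fun y => mul_nonneg (abs_nonneg y) (hn₀pos y).le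
  -- the scale making the first moment of the rescaled tail at most `ε / 2`
  set s := ε * Z / (2 * (m₁ + 1)) with hs
  have hs0 : 0 < s := by positivity
  set n : ℝ → ℝ := fun y => (Z * s)⁻¹ * n₀ (y / s) with hn
  have hni : Integrable n := (integrable_heavy.comp_div hs0.ne').const_mul _
  have hn1 : ∫ y, n y = 1 := by
    rw [hn, integral_const_mul, Measure.integral_comp_div n₀, abs_of_pos hs0, smul_eq_mul, ← hZ]
    field_simp
  have hnm : (fun y => |y| * n y) = fun y => Z⁻¹ * (|y / s| * n₀ (y / s)) := by
    ext y
    rw [hn, abs_div, abs_of_pos hs0]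
    field_simp
  have hnmi : Integrable (fun y => |y| * n y) := by
    rw [hnm]
    exact (integrable_abs_mul_heavy.comp_div hs0.ne').const_mul _
  have hnm1 : ∫ y, |y| * n y ≤ ε / 2 := by
    rw [hnm, integral_const_mul, Measure.integral_comp_div (fun y => |y| * n₀ y), abs_of_pos hs0,
      smul_eq_mul, ← hm₁, hs]
    have : Z⁻¹ * (ε * Z / (2 * (m₁ + 1)) * m₁) = ε / 2 * (m₁ / (m₁ + 1)) := by field_simp
    rw [this]
    refine mul_le_of_le_one_right (by positivity) ?_
    rw [div_le_one (by positivity)]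
    linarith
  have hn0 : ∀ y, 0 ≤ n y := fun y => by have := (hn₀pos (y / s)).le; positivity
  set ρ := min 1 (ε / 2) with hρ
  have hρ0 : 0 < ρ := by positivity
  let b₀ : ContDiffBump (0 : ℝ) := ⟨ρ / 2, ρ, by positivity, by linarith⟩
  set b : ℝ → ℝ := b₀.normed volume with hb
  have hb0 : ∀ x, 0 ≤ b x := b₀.nonneg_normed
  have hb1 : ∫ x, b x = 1 := b₀.integral_normed
  have hbc : ContDiff ℝ ∞ b := b₀.contDiff_normed
  have hbs : HasCompactSupport b := b₀.hasCompactSupport_normed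
  have hbz : ∀ x, ρ ≤ |x| → b x = 0 := by
    intro x hx
    have h1 : Function.support b = Metric.ball 0 ρ := b₀.support_normed_eq
    by_contra hne
    have h2 : x ∈ Function.support b := hne
    rw [h1, mem_ball_zero_iff, Real.norm_eq_abs] at h2
    linarith
  have hbi : Integrable b := hbc.continuous.integrable_of_hasCompactSupport hbs
  have hfib : ∀ x, Integrable (fun t => n t * b (x - t)) :=
    integrable_cv_fiber hni hbc.continuous hbs
  have hq0 : ∀ x, 0 ≤ cv n b x := fun x =>
    integral_nonneg fun t => mul_nonneg (hn0 t) (hb0 _)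
  have hqi : Integrable (cv n b) := integrable_cv hni hbi
  have hq1 : ∫ x, cv n b x = 1 := by
    have := integral_convolution (μ := volume) (ν := volume) (ContinuousLinearMap.mul ℝ ℝ) hni hbi
    rw [hn1, hb1] at this
    simpa [cv] using this
  have hpt : ∀ x, |x| * cv n b x ≤ ρ * cv n b x + cv (fun y => |y| * n y) b x := by
    intro x
    have h1 := integrable_cv_fiber hnmi hbc.continuous hbs x
    simp only [cv_apply]
    rw [← integral_const_mul, ← integral_const_mul, ← integral_add ((hfib x).const_mul ρ) h1]
    refine integral_mono ((hfib x).const_mul _) (((hfib x).const_mul ρ).add h1) fun t => ?_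
    simp only
    rcases le_or_gt ρ |x - t| with h | h
    · simp [hbz _ h]
    · have h2 : |x| ≤ ρ + |t| := by
        have := abs_add_le (x - t) t
        rw [sub_add_cancel] at this
        linarith
      nlinarith [mul_nonneg (hn0 t) (hb0 (x - t))]
  have hmombound : Integrable (fun x => ρ * cv n b x + cv (fun y => |y| * n y) b x) :=
    (hqi.const_mul ρ).add (integrable_cv hnmi hbi)
  have hmomi : Integrable (fun x => |x| * cv n b x) := by
    refine Integrable.mono' hmombound
      (continuous_abs.mul (continuous_cv hni hbc.continuous hbs)).aestronglyMeasurable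
      (Eventually.of_forall fun x => ?_)
    rw [Real.norm_of_nonneg (mul_nonneg (abs_nonneg x) (hq0 x))]
    exact hpt x
  refine ⟨cv n b, continuous_cv hni hbc.continuous hbs, ⟨hq0, hqi, hq1⟩, hmomi, ?_, ?_, ?_⟩
  · refine (integral_mono hmomi hmombound hpt).trans ?_
    rw [integral_add (hqi.const_mul ρ) (integrable_cv hnmi hbi), integral_const_mul, hq1]
    have := integral_convolution (μ := volume) (ν := volume) (ContinuousLinearMap.mul ℝ ℝ) hnmi hbi
    rw [hb1, ContinuousLinearMap.mul_apply', mul_one] at this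
    have h2 : ∫ x, cv (fun y => |y| * n y) b x = ∫ y, |y| * n y := this
    rw [h2]
    linarith [min_le_right 1 (ε / 2)]
  · refine ⟨(Z * s)⁻¹ * ((1 + 2 / s ^ 2) ^ 2)⁻¹, by positivity, fun x => ?_⟩
    have hcomm : cv n b x = ∫ t, n (x - t) * b t := by
      rw [cv_apply, ← integral_sub_left_eq_self _ volume x]
      simp
    have hfib' : Integrable (fun t => n (x - t) * b t) := by
      have := (hfib x).comp_sub_left x
      simpa using this
    rw [hcomm]
    calc (Z * s)⁻¹ * ((1 + 2 / s ^ 2) ^ 2)⁻¹ * ((1 + x ^ 2) ^ 2)⁻¹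
        = ∫ t, (Z * s)⁻¹ * ((1 + 2 / s ^ 2) ^ 2)⁻¹ * ((1 + x ^ 2) ^ 2)⁻¹ * b t := by
          rw [integral_const_mul, hb1, mul_one]
      _ ≤ _ := by
          refine integral_mono (hbi.const_mul _) hfib' fun t => ?_
          simp only
          rcases le_or_gt ρ |t| with h | h
          · simp [hbz _ h]
          · refine mul_le_mul_of_nonneg_right ?_ (hb0 t)
            rw [hn, mul_assoc]
            refine mul_le_mul_of_nonneg_left ?_ (by positivity)
            rw [hn₀, ← mul_inv, ← mul_pow]
            have ht : t ^ 2 ≤ 1 := by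
              rw [← sq_abs]
              exact pow_le_one₀ (abs_nonneg t) (h.le.trans (min_le_left _ _))
            have h3 : 1 + ((x - t) / s) ^ 2 ≤ (1 + 2 / s ^ 2) * (1 + x ^ 2) := by
              have h4 : (x - t) ^ 2 ≤ 2 * (1 + x ^ 2) := by nlinarith [sq_nonneg (x + t)]
              calc 1 + ((x - t) / s) ^ 2 = 1 + (x - t) ^ 2 / s ^ 2 := by rw [div_pow]
                _ ≤ (1 + x ^ 2) + 2 * (1 + x ^ 2) / s ^ 2 := by
                    gcongr; nlinarith [sq_nonneg x]
                _ = _ := by ring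
            simp only
            gcongr
  · intro α
    refine Integrable.mono' (integrable_sobolev hbc hbs α) ?_ (Eventually.of_forall fun t => ?_)
    · refine Continuous.aestronglyMeasurable (((continuous_fourier hqi).norm.pow 2).mul
        (Continuous.rpow_const (by fun_prop) fun t => Or.inl ?_))
      positivity
    · rw [Real.norm_of_nonneg (by positivity), fourier_cv hni hbi, norm_mul]
      have h1 : ‖fourier n t‖ ≤ 1 := by
        refine (norm_fourier_le n t).trans_eq ?_
        simp_rw [abs_of_nonneg (hn0 _), hn1]
      gcongr
      exact mul_le_of_le_one_left (norm_nonneg _) h1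

/-! ### Tensor products and the Sobolev energy -/

/-- The tensor product `x ↦ ∏ j, a j (x j)` of functions of one real variable. -/
noncomputable def prodFun {d : ℕ} (a : Fin d → ℝ → ℝ) (x : EuclideanSpace ℝ (Fin d)) : ℝ :=
  ∏ j, a j (x j)

section prodFun

variable {d : ℕ}

theorem integral_euclidean_prod {𝕜 : Type*} [RCLike 𝕜] (f : Fin d → ℝ → 𝕜) :
    ∫ x : EuclideanSpace ℝ (Fin d), ∏ j, f j (x j) = ∏ j, ∫ x, f j x := by
  rw [← (PiLp.volume_preserving_toLp (Fin d)).integral_comp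
    (MeasurableEquiv.toLp 2 (Fin d → ℝ)).measurableEmbedding]
  exact integral_fintype_prod_volume_eq_prod f

theorem integrable_euclidean_prod {𝕜 : Type*} [RCLike 𝕜] {f : Fin d → ℝ → 𝕜}
    (hf : ∀ j, Integrable (f j)) :
    Integrable (fun x : EuclideanSpace ℝ (Fin d) => ∏ j, f j (x j)) := by
  rw [← (PiLp.volume_preserving_toLp (Fin d)).integrable_comp_emb
    (MeasurableEquiv.toLp 2 (Fin d → ℝ)).measurableEmbedding]
  exact Integrable.fintype_prod hf

theorem integral_prodFun (a : Fin d → ℝ → ℝ) : ∫ x, prodFun a x = ∏ j, ∫ x, a j x :=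
  integral_euclidean_prod a

theorem integrable_prodFun {a : Fin d → ℝ → ℝ} (ha : ∀ j, Integrable (a j)) :
    Integrable (prodFun a) :=
  integrable_euclidean_prod ha

theorem continuous_prodFun {a : Fin d → ℝ → ℝ} (ha : ∀ j, Continuous (a j)) :
    Continuous (prodFun a) :=
  continuous_finsetProd _ fun j _ => (ha j).comp (by fun_prop)

theorem fourier_prodFun (a : Fin d → ℝ → ℝ) (t : EuclideanSpace ℝ (Fin d)) :
    fourier (prodFun a) t = ∏ j, fourier (a j) (t j) := by
  simp only [fourier]
  rw [← integral_euclidean_prod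
    (fun j (x : ℝ) => Complex.exp (Complex.I * ((inner ℝ (t j) x : ℝ) : ℂ)) * (a j x : ℂ))]
  refine integral_congr_ae (Eventually.of_forall fun x => ?_)
  simp only [prodFun]
  rw [Finset.prod_mul_distrib, ← Complex.exp_sum, PiLp.inner_apply]
  push_cast
  rw [Finset.mul_sum]

theorem norm_le_sum_abs (x : EuclideanSpace ℝ (Fin d)) : ‖x‖ ≤ ∑ j, |x j| := by
  refine le_of_sq_le_sq ?_ (by positivity)
  rw [EuclideanSpace.real_norm_sq_eq]
  refine le_trans (le_of_eq ?_)
    (Finset.sum_sq_le_sq_sum_of_nonneg (f := fun j => |x j|) fun i _ => abs_nonneg _)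
  simp

end prodFun

/-- The sum of squared Sobolev seminorms `∑ j, ∫ |f̂ t|² (1 + t_j²)^α dt` that defines
`sobolevClass`. -/
noncomputable def sob {d : ℕ} (α : ℝ) (f : EuclideanSpace ℝ (Fin d) → ℝ) : ℝ≥0∞ :=
  ∑ j : Fin d, ∫⁻ t : EuclideanSpace ℝ (Fin d),
      ENNReal.ofReal (‖fourier f t‖ ^ 2 * (1 + t j ^ 2) ^ α)

section sob

variable {d : ℕ} {α : ℝ}

theorem measurable_sob_integrand {f : EuclideanSpace ℝ (Fin d) → ℝ} (hf : Integrable f)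
    (j : Fin d) : Measurable (fun t : EuclideanSpace ℝ (Fin d) =>
      ENNReal.ofReal (‖fourier f t‖ ^ 2 * (1 + t j ^ 2) ^ α)) := by
  have := (continuous_fourier hf).measurable
  fun_prop

theorem fourier_add {E : Type*} [NormedAddCommGroup E] [InnerProductSpace ℝ E]
    [MeasureSpace E] [BorelSpace E] [SecondCountableTopology E] {f g : E → ℝ}
    (hf : Integrable f) (hg : Integrable g) (t : E) :
    fourier (fun x => f x + g x) t = fourier f t + fourier g t := by
  have h : ∀ {f : E → ℝ}, Integrable f → Integrable
      (fun x => Complex.exp (Complex.I * ((inner ℝ t x : ℝ) : ℂ)) * (f x : ℂ)) := fun hf =>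
    hf.ofReal.bdd_mul (c := 1) (Continuous.aestronglyMeasurable (by fun_prop))
      (Eventually.of_forall fun x => by
        rw [mul_comm Complex.I, Complex.norm_exp_ofReal_mul_I])
  rw [fourier, fourier, fourier, ← integral_add (h hf) (h hg)]
  refine integral_congr_ae (Eventually.of_forall fun x => ?_)
  simp only
  push_cast; ring

theorem fourier_const_mul {E : Type*} [NormedAddCommGroup E] [InnerProductSpace ℝ E]
    [MeasureSpace E] (c : ℝ) (f : E → ℝ) (t : E) :
    fourier (fun x => c * f x) t = c * fourier f t := by
  rw [fourier, fourier, ← integral_const_mul]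
  refine integral_congr_ae (Eventually.of_forall fun x => ?_)
  simp only
  push_cast; ring

theorem fourier_congr_ae {E : Type*} [NormedAddCommGroup E] [InnerProductSpace ℝ E]
    [MeasureSpace E] {f g : E → ℝ} (h : f =ᵐ[volume] g) : fourier f = fourier g := by
  ext t
  refine integral_congr_ae ?_
  filter_upwards [h] with x hx
  rw [hx]

theorem sob_const_mul (c : ℝ) (f : EuclideanSpace ℝ (Fin d) → ℝ) :
    sob α (fun x => c * f x) = ENNReal.ofReal (c ^ 2) * sob α f := by
  rw [sob, sob, Finset.mul_sum]
  refine Finset.sum_congr rfl fun j _ => ?_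
  rw [← lintegral_const_mul' _ _ ENNReal.ofReal_ne_top]
  refine lintegral_congr fun t => ?_
  rw [← ENNReal.ofReal_mul (by positivity), fourier_const_mul, norm_mul, Complex.norm_real,
    Real.norm_eq_abs, mul_pow, sq_abs, mul_assoc]

theorem sob_add_le {f g : EuclideanSpace ℝ (Fin d) → ℝ} (hf : Integrable f) (hg : Integrable g)
    {τ : ℝ} (hτ : 0 < τ) :
    sob α (fun x => f x + g x) ≤
      ENNReal.ofReal (1 + τ) * sob α f + ENNReal.ofReal (1 + τ⁻¹) * sob α g := by
  rw [sob, sob, sob, Finset.mul_sum, Finset.mul_sum, ← Finset.sum_add_distrib]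
  refine Finset.sum_le_sum fun j _ => ?_
  rw [← lintegral_const_mul' _ _ ENNReal.ofReal_ne_top,
    ← lintegral_const_mul' _ _ ENNReal.ofReal_ne_top,
    ← lintegral_add_left ((measurable_sob_integrand hf j).const_mul _)]
  refine lintegral_mono fun t => ?_
  rw [← ENNReal.ofReal_mul (by positivity), ← ENNReal.ofReal_mul (by positivity),
    ← ENNReal.ofReal_add (by positivity) (by positivity)]
  refine ENNReal.ofReal_le_ofReal ?_
  rw [← mul_assoc, ← mul_assoc, ← add_mul, fourier_add hf hg]
  gcongr
  have h1 := norm_add_le (fourier f t) (fourier g t)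
  set u := ‖fourier f t‖
  set v := ‖fourier g t‖
  have hu : 0 ≤ u := norm_nonneg _
  have hv : 0 ≤ v := norm_nonneg _
  have h2 : 2 * u * v ≤ τ * u ^ 2 + τ⁻¹ * v ^ 2 := by
    have h3 : 0 ≤ τ⁻¹ * (τ * u - v) ^ 2 := by positivity
    have h4 : τ⁻¹ * (τ * u - v) ^ 2 = τ * u ^ 2 + τ⁻¹ * v ^ 2 - 2 * u * v := by
      field_simp; ring
    linarith
  calc ‖fourier f t + fourier g t‖ ^ 2 ≤ (u + v) ^ 2 := by gcongr
    _ ≤ _ := by nlinarith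

/-- The parallelogram law, written with midpoints. -/
theorem sob_parallelogram {f g : EuclideanSpace ℝ (Fin d) → ℝ} (hf : Integrable f)
    (hg : Integrable g) :
    2 * (sob α (fun x => (1 / 2) * (f x + g x)) + sob α (fun x => (1 / 2) * (f x + (-1) * g x))) =
      sob α f + sob α g := by
  have hg' : Integrable (fun x => (-1) * g x) := hg.const_mul _
  have hs : Integrable (fun x => (1 / 2) * (f x + g x)) := (hf.add hg).const_mul _
  rw [sob, sob, sob, sob, ← Finset.sum_add_distrib, ← Finset.sum_add_distrib, Finset.mul_sum]
  refine Finset.sum_congr rfl fun j _ => ?_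
  rw [← lintegral_add_left (measurable_sob_integrand hs j),
    ← lintegral_add_left (measurable_sob_integrand hf j),
    ← lintegral_const_mul' _ _ (by norm_num)]
  refine lintegral_congr fun t => ?_
  rw [← ENNReal.ofReal_add (by positivity) (by positivity),
    ← ENNReal.ofReal_add (by positivity) (by positivity)]
  have h2 : ∀ r : ℝ, 2 * ENNReal.ofReal r = ENNReal.ofReal (2 * r) := fun r => by
    rw [ENNReal.ofReal_mul (by norm_num), ENNReal.ofReal_ofNat]
  rw [h2]
  congr 1
  rw [fourier_const_mul, fourier_const_mul, fourier_add hf hg, fourier_add hf hg',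
    fourier_const_mul, norm_mul, norm_mul]
  have := parallelogram_law_with_norm ℝ (fourier f t) (fourier g t)
  push_cast
  rw [neg_one_mul, ← sub_eq_add_neg]
  simp only [← add_mul, ← mul_assoc]
  congr 1
  norm_num
  nlinarith

/-- The weight involves one coordinate at a time, so a tensor product costs one Sobolev integral
and `d - 1` plain `L²` norms. -/
theorem sob_prodFun_le (hd : 1 ≤ d) {a : Fin d → ℝ → ℝ} {X Y : ℝ}
    (h0 : ∀ i, Integrable (fun t => ‖fourier (a i) t‖ ^ 2))
    (hα : ∀ i, Integrable (fun t => ‖fourier (a i) t‖ ^ 2 * (1 + t ^ 2) ^ α))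
    (hX : ∀ i, ∫ t, ‖fourier (a i) t‖ ^ 2 ≤ X)
    (hY : ∀ i, ∫ t, ‖fourier (a i) t‖ ^ 2 * (1 + t ^ 2) ^ α ≤ Y) :
    sob α (prodFun a) ≤ ENNReal.ofReal (d * (Y * X ^ (d - 1))) := by
  have hX0 : 0 ≤ X := (integral_nonneg fun t => by positivity).trans (hX ⟨0, hd⟩)
  have hY0 : 0 ≤ Y := (integral_nonneg fun t => by positivity).trans (hY ⟨0, hd⟩)
  rw [ENNReal.ofReal_mul (by positivity), ENNReal.ofReal_natCast]
  refine (Finset.sum_le_card_nsmul _ _ _ fun j _ => ?_).trans_eq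
    (by rw [Finset.card_univ, Fintype.card_fin, nsmul_eq_mul])
  set g : Fin d → ℝ → ℝ := fun i t =>
    if i = j then ‖fourier (a i) t‖ ^ 2 * (1 + t ^ 2) ^ α else ‖fourier (a i) t‖ ^ 2 with hg
  have hgi : ∀ i, Integrable (g i) := fun i => by
    by_cases h : i = j
    · simp only [hg, h, if_true]; exact hα j
    · simp only [hg, h, if_false]; exact h0 i
  have hg0 : ∀ i t, 0 ≤ g i t := fun i t => by
    simp only [hg]; split_ifs <;> positivity
  have hpt : ∀ t : EuclideanSpace ℝ (Fin d),
      ‖fourier (prodFun a) t‖ ^ 2 * (1 + t j ^ 2) ^ α = ∏ i, g i (t i) := by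
    intro t
    rw [fourier_prodFun, norm_prod, ← Finset.prod_pow,
      ← Finset.mul_prod_erase _ _ (Finset.mem_univ j),
      ← Finset.mul_prod_erase _ (fun i => g i (t i)) (Finset.mem_univ j)]
    have : ∏ i ∈ Finset.univ.erase j, g i (t i) =
        ∏ i ∈ Finset.univ.erase j, ‖fourier (a i) (t i)‖ ^ 2 :=
      Finset.prod_congr rfl fun i hi => by simp [hg, Finset.ne_of_mem_erase hi]
    rw [this]
    simp only [hg, if_true]
    ring
  simp_rw [hpt]
  rw [← ofReal_integral_eq_lintegral_ofReal (integrable_euclidean_prod hgi)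
    (Eventually.of_forall fun t => Finset.prod_nonneg fun i _ => hg0 _ _),
    integral_euclidean_prod g]
  refine ENNReal.ofReal_le_ofReal ?_
  rw [← Finset.mul_prod_erase _ _ (Finset.mem_univ j)]
  have h1 : ∏ i ∈ Finset.univ.erase j, ∫ t, g i t ≤ X ^ (d - 1) := by
    calc _ ≤ ∏ i ∈ Finset.univ.erase j, X := by
          refine Finset.prod_le_prod (fun i _ => integral_nonneg (hg0 i)) fun i hi => ?_
          simp only [hg, Finset.ne_of_mem_erase hi, if_false]
          exact hX i
      _ = _ := by rw [Finset.prod_const, Finset.card_erase_of_mem (Finset.mem_univ j)]; simp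
  have h2 : ∫ t, g j t ≤ Y := by simp only [hg, if_true]; exact hY j
  exact mul_le_mul h2 h1 (Finset.prod_nonneg fun i _ => integral_nonneg (hg0 i)) hY0

end sob

/-! ### Room for perturbation inside the class -/

/-- The first absolute moment `∫ f |x| dx` of a density. -/
noncomputable def mom {d : ℕ} (f : EuclideanSpace ℝ (Fin d) → ℝ) : ℝ≥0∞ :=
  ∫⁻ x, ENNReal.ofReal (f x) * ‖x‖ₑ

section base

variable {d : ℕ} {α : ℝ}

theorem lintegral_enorm_ofDensity {f : EuclideanSpace ℝ (Fin d) → ℝ} (hf : Integrable f) :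
    ∫⁻ x, ‖x‖ₑ ∂(ofDensity f) = mom f := by
  rw [ofDensity, lintegral_withDensity_eq_lintegral_mul₀
    hf.aestronglyMeasurable.aemeasurable.ennreal_ofReal (by fun_prop)]
  rfl

/-- A difference of densities with zero Sobolev energy has zero transform almost everywhere, hence
everywhere by continuity, so the laws agree. The factor `1 / 2` matches `sob_parallelogram`. -/
theorem eq_of_sob_sub_eq_zero (hd : 1 ≤ d) {f g : EuclideanSpace ℝ (Fin d) → ℝ}
    (hf : IsDensity f) (hg : IsDensity g)
    (h : sob α (fun x => (1 / 2) * (f x + (-1) * g x)) = 0) : ofDensity f = ofDensity g := by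
  have hgi : Integrable (fun x => (-1) * g x) := hg.integrable.const_mul _
  have hi : Integrable (fun x => (1 / 2) * (f x + (-1) * g x)) :=
    (hf.integrable.add hgi).const_mul _
  have h0 := (Finset.sum_eq_zero_iff.mp h) ⟨0, hd⟩ (Finset.mem_univ _)
  rw [lintegral_eq_zero_iff (measurable_sob_integrand hi _)] at h0
  have h1 : fourier (fun x => (1 / 2) * (f x + (-1) * g x)) =ᵐ[volume] fun _ => 0 := by
    filter_upwards [h0] with t ht
    simp only [Pi.zero_apply, ENNReal.ofReal_eq_zero] at ht
    have h2 : 0 < (1 + t ⟨0, hd⟩ ^ 2) ^ α := by positivity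
    have h3 : ‖fourier (fun x => (1 / 2) * (f x + (-1) * g x)) t‖ ^ 2 ≤ 0 := by
      by_contra! h4
      linarith [mul_pos h4 h2]
    exact norm_eq_zero.mp (pow_eq_zero_iff (two_ne_zero) |>.mp (le_antisymm h3 (by positivity)))
  have h2 := (Continuous.ae_eq_iff_eq volume (continuous_fourier hi) continuous_const).mp h1
  have := isProbabilityMeasure_ofDensity hf
  have := isProbabilityMeasure_ofDensity hg
  refine Measure.ext_of_charFun (funext fun t => ?_)
  rw [← fourier_eq_charFun hf, ← fourier_eq_charFun hg]
  have h3 := congrFun h2 t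
  rw [fourier_const_mul, fourier_add hf.integrable hgi, fourier_const_mul] at h3
  have h4 : (2⁻¹ : ℂ) ≠ 0 := by norm_num
  push_cast at h3
  have h5 := (mul_eq_zero.mp h3).resolve_left (by norm_num)
  linear_combination h5

/-- As the class has two elements, it contains a density strictly inside the Sobolev ball: the
midpoint, by strict convexity of the Hilbert norm. -/
theorem exists_interior_density (hd : 1 ≤ d) {L M : ℝ}
    (hD : (mixingClass d α L M).Nontrivial) :
    ∃ f : EuclideanSpace ℝ (Fin d) → ℝ, Measurable f ∧ IsDensity f ∧
      mom f ≤ ENNReal.ofReal M ∧ sob α f < ENNReal.ofReal (L ^ 2) := by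
  obtain ⟨μ₁, ⟨hm₁, f₁, hf₁S, hf₁, rfl⟩, μ₂, ⟨hm₂, f₂, hf₂S, hf₂, rfl⟩, hne⟩ := hD
  have i₁ := hf₁.integrable
  have i₂ := hf₂.integrable
  rw [lintegral_enorm_ofDensity i₁] at hm₁
  rw [lintegral_enorm_ofDensity i₂] at hm₂
  set g : EuclideanSpace ℝ (Fin d) → ℝ := fun x => (1 / 2) * (f₁ x + f₂ x) with hg
  have hgi : Integrable g := (i₁.add i₂).const_mul _
  have hg0 : ∀ x, 0 ≤ g x := fun x => by
    have := hf₁.nonneg x; have := hf₂.nonneg x; positivity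
  have hg1 : ∫ x, g x = 1 := by
    rw [hg, integral_const_mul, integral_add i₁ i₂, hf₁.integral_eq_one, hf₂.integral_eq_one]
    norm_num
  -- a measurable version of the midpoint; the absolute value keeps it nonnegative everywhere
  set f : EuclideanSpace ℝ (Fin d) → ℝ := fun x => |hgi.aestronglyMeasurable.mk g x| with hf
  have hfm : Measurable f := by
    have := hgi.aestronglyMeasurable.stronglyMeasurable_mk.measurable
    fun_prop
  have hfg : f =ᵐ[volume] g := by
    filter_upwards [hgi.aestronglyMeasurable.ae_eq_mk] with x hx
    simp only [hf]
    rw [← hx, abs_of_nonneg (hg0 x)]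
  refine ⟨f, hfm, ⟨fun x => abs_nonneg _, hgi.congr hfg.symm,
    (integral_congr_ae hfg).trans hg1⟩, ?_, ?_⟩
  · have h1 : mom f = mom g := by
      refine lintegral_congr_ae ?_
      filter_upwards [hfg] with x hx
      rw [hx]
    have h2 : 2 * mom g = mom f₁ + mom f₂ := by
      have ha : AEMeasurable (fun x => ENNReal.ofReal (f₁ x) * ‖x‖ₑ) volume :=
        i₁.aestronglyMeasurable.aemeasurable.ennreal_ofReal.mul (by fun_prop)
      rw [mom, mom, mom, ← lintegral_add_left' ha, ← lintegral_const_mul' _ _ (by norm_num)]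
      refine lintegral_congr fun x => ?_
      rw [← add_mul, ← mul_assoc, ← ENNReal.ofReal_add (hf₁.nonneg x) (hf₂.nonneg x)]
      congr 1
      rw [hg, ENNReal.ofReal_mul (by norm_num), ← mul_assoc]
      rw [one_div, ENNReal.ofReal_inv_of_pos (by norm_num), ENNReal.ofReal_ofNat,
        ENNReal.mul_inv_cancel (by norm_num) (by norm_num), one_mul]
    rw [h1]
    have h3 : 2 * mom g ≤ 2 * ENNReal.ofReal M := by
      rw [h2, two_mul]; exact add_le_add hm₁ hm₂
    exact (ENNReal.mul_le_mul_iff_right (by norm_num) (by norm_num)).mp h3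
  · have h1 : sob α f = sob α g := by rw [sob, sob, fourier_congr_ae hfg]
    rw [h1]
    have h2 := sob_parallelogram (α := α) i₁ i₂
    have h3 : 2 * (sob α g + sob α (fun x => (1 / 2) * (f₁ x + (-1) * f₂ x))) ≤
        2 * ENNReal.ofReal (L ^ 2) := by
      rw [h2, two_mul]; exact add_le_add hf₁S.2 hf₂S.2
    have h4 := (ENNReal.mul_le_mul_iff_right (by norm_num) (by norm_num)).mp h3
    have h5 : sob α (fun x => (1 / 2) * (f₁ x + (-1) * f₂ x)) ≠ 0 := fun h =>
      hne (eq_of_sob_sub_eq_zero hd hf₁ hf₂ h)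
    refine lt_of_lt_of_le (ENNReal.lt_add_right ?_ h5) h4
    exact ne_top_of_le_ne_top ENNReal.ofReal_ne_top (le_self_add.trans h4)

/-- A small amount `η` of a heavy-tailed density `p` may be mixed into an interior density, and
the mixture may then be perturbed by any `g` dominated by `η p / 2` of small Sobolev norm, without
leaving the class. -/
theorem exists_perturbation_room {L M : ℝ} (hM : 0 < M)
    {f p : EuclideanSpace ℝ (Fin d) → ℝ} (hf : IsDensity f) (hp : IsDensity p)
    (hfM : mom f ≤ ENNReal.ofReal M) (hfL : sob α f < ENNReal.ofReal (L ^ 2))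
    (hpM : mom p ≤ ENNReal.ofReal (M / 2)) (hpL : sob α p ≠ ⊤) :
    ∃ η κ : ℝ, 0 < η ∧ η ≤ 1 ∧ 0 < κ ∧ ∀ g : EuclideanSpace ℝ (Fin d) → ℝ, Integrable g →
      (∀ x, |g x| ≤ η / 2 * p x) → ∫ x, g x = 0 → sob α g ≤ ENNReal.ofReal κ →
      IsDensity (fun x => (1 - η) * f x + (η * p x + g x)) ∧
      ofDensity (fun x => (1 - η) * f x + (η * p x + g x)) ∈ mixingClass d α L M := by
  have hfS : sob α f ≠ ⊤ := hfL.ne_top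
  set S := (sob α f).toReal with hS
  set P := (sob α p).toReal with hP
  have hS0 : 0 ≤ S := ENNReal.toReal_nonneg
  have hP0 : 0 ≤ P := ENNReal.toReal_nonneg
  have hSL : S < L ^ 2 := by
    have h1 : sob α f = ENNReal.ofReal S := (ENNReal.ofReal_toReal hfS).symm
    rw [h1] at hfL
    exact (ENNReal.ofReal_lt_ofReal_iff_of_nonneg hS0).mp hfL
  -- `τ` splits the gap `L² - S` evenly between the two terms of `sob_add_le`
  set δ := (L ^ 2 - S) / 2 with hδ
  have hδ0 : 0 < δ := by linarith
  set τ := δ / (S + 1) with hτ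
  have hτ0 : 0 < τ := by positivity
  have hτS : (1 + τ) * S ≤ S + δ := by
    have : τ * S ≤ δ := by
      rw [hτ, div_mul_eq_mul_div, div_le_iff₀ (by positivity)]
      nlinarith
    linarith
  set κ := δ / (4 * (1 + τ⁻¹)) with hκ
  have hκ0 : 0 < κ := by positivity
  set η := min 1 (κ / (P + 1)) with hη
  have hη0 : 0 < η := by positivity
  have hη1 : η ≤ 1 := min_le_left _ _
  have hηP : η ^ 2 * P ≤ κ := by
    calc η ^ 2 * P ≤ η * P := by gcongr; nlinarith
      _ ≤ κ / (P + 1) * (P + 1) := by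
          gcongr
          · exact min_le_right _ _
          · linarith
      _ = κ := by field_simp
  refine ⟨η, κ, hη0, hη1, hκ0, fun g hg hgp hg0 hgS => ?_⟩
  have hpi : Integrable (fun x => η * p x) := hp.integrable.const_mul η
  have hfi : Integrable (fun x => (1 - η) * f x) := hf.integrable.const_mul _
  have hpg : Integrable (fun x => η * p x + g x) := hpi.add hg
  have hdens : IsDensity (fun x => (1 - η) * f x + (η * p x + g x)) := by
    refine ⟨fun x => ?_, hfi.add hpg, ?_⟩
    · have h1 := (abs_le.mp (hgp x)).1
      have h2 : 0 ≤ (1 - η) * f x := mul_nonneg (by linarith) (hf.nonneg x)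
      have h3 : 0 ≤ η * p x := mul_nonneg hη0.le (hp.nonneg x)
      linarith
    · rw [integral_add hfi hpg, integral_add hpi hg, integral_const_mul, integral_const_mul,
        hf.integral_eq_one, hp.integral_eq_one, hg0]
      ring
  refine ⟨hdens, ?_, _, ⟨hdens.integrable, ?_⟩, hdens, rfl⟩
  · rw [lintegral_enorm_ofDensity hdens.integrable]
    have ha : AEMeasurable (fun x => ENNReal.ofReal (f x) * ‖x‖ₑ) volume :=
      hf.integrable.aestronglyMeasurable.aemeasurable.ennreal_ofReal.mul (by fun_prop)
    calc mom (fun x => (1 - η) * f x + (η * p x + g x))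
        ≤ ENNReal.ofReal (1 - η) * mom f + ENNReal.ofReal (3 / 2 * η) * mom p := by
          rw [mom, mom, mom, ← lintegral_const_mul' _ _ ENNReal.ofReal_ne_top,
            ← lintegral_const_mul' _ _ ENNReal.ofReal_ne_top,
            ← lintegral_add_left' (ha.const_mul _)]
          refine lintegral_mono fun x => ?_
          rw [← mul_assoc, ← mul_assoc, ← add_mul, ← ENNReal.ofReal_mul (by linarith),
            ← ENNReal.ofReal_mul (by positivity), ← ENNReal.ofReal_add
            (mul_nonneg (by linarith) (hf.nonneg x)) (mul_nonneg (by positivity) (hp.nonneg x))]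
          gcongr
          have h1 := (abs_le.mp (hgp x)).2
          linarith
      _ ≤ ENNReal.ofReal (1 - η) * ENNReal.ofReal M +
            ENNReal.ofReal (3 / 2 * η) * ENNReal.ofReal (M / 2) := by gcongr
      _ ≤ ENNReal.ofReal M := by
          rw [← ENNReal.ofReal_mul (by linarith), ← ENNReal.ofReal_mul (by positivity),
            ← ENNReal.ofReal_add (mul_nonneg (by linarith) hM.le) (by positivity)]
          refine ENNReal.ofReal_le_ofReal ?_
          nlinarith [mul_pos hη0 hM]
  · change sob α _ ≤ _
    have hp' : sob α p = ENNReal.ofReal P := (ENNReal.ofReal_toReal hpL).symm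
    have hf' : sob α f = ENNReal.ofReal S := (ENNReal.ofReal_toReal hfS).symm
    have h1 : sob α (fun x => η * p x + g x) ≤ ENNReal.ofReal (4 * κ) := by
      refine (sob_add_le hpi hg one_pos).trans ?_
      rw [sob_const_mul, hp', ← ENNReal.ofReal_mul (by positivity)]
      calc _ ≤ ENNReal.ofReal (1 + 1) * ENNReal.ofReal κ +
            ENNReal.ofReal (1 + 1⁻¹) * ENNReal.ofReal κ := by gcongr
        _ = _ := by
            rw [← ENNReal.ofReal_mul (by norm_num), ← ENNReal.ofReal_mul (by norm_num),
              ← ENNReal.ofReal_add (by positivity) (by positivity)]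
            congr 1; ring
    refine (sob_add_le hfi hpg hτ0).trans ?_
    rw [sob_const_mul, hf', ← ENNReal.ofReal_mul (by positivity)]
    calc _ ≤ ENNReal.ofReal (1 + τ) * ENNReal.ofReal S +
          ENNReal.ofReal (1 + τ⁻¹) * ENNReal.ofReal (4 * κ) := by
          gcongr
          exact mul_le_of_le_one_left hS0 (by nlinarith)
      _ = ENNReal.ofReal ((1 + τ) * S + (1 + τ⁻¹) * (4 * κ)) := by
          rw [← ENNReal.ofReal_mul (by positivity), ← ENNReal.ofReal_mul (by positivity),
            ← ENNReal.ofReal_add (by positivity) (by positivity)]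
      _ ≤ _ := by
          refine ENNReal.ofReal_le_ofReal ?_
          have : (1 + τ⁻¹) * (4 * κ) = δ := by rw [hκ]; field_simp
          rw [this]
          linarith

theorem mom_prodFun_le {q : ℝ → ℝ} (hq : IsDensity q) (hqi : Integrable (fun x => |x| * q x)) :
    mom (prodFun fun _ : Fin d => q) ≤ ENNReal.ofReal (d * ∫ x, |x| * q x) := by
  have hp0 : ∀ x, 0 ≤ prodFun (fun _ : Fin d => q) x := fun x =>
    Finset.prod_nonneg fun j _ => hq.nonneg _
  set g : Fin d → Fin d → ℝ → ℝ := fun j i x => if i = j then |x| * q x else q x with hg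
  have hgi : ∀ j i, Integrable (g j i) := fun j i => by
    by_cases h : i = j
    · simp only [hg, h, if_true]; exact hqi
    · simp only [hg, h, if_false]; exact hq.integrable
  have hpt : ∀ (j : Fin d) (x : EuclideanSpace ℝ (Fin d)),
      prodFun (fun _ : Fin d => q) x * |x j| = ∏ i, g j i (x i) := by
    intro j x
    rw [prodFun, ← Finset.mul_prod_erase _ _ (Finset.mem_univ j),
      ← Finset.mul_prod_erase _ (fun i => g j i (x i)) (Finset.mem_univ j)]
    have : ∏ i ∈ Finset.univ.erase j, g j i (x i) = ∏ i ∈ Finset.univ.erase j, q (x i) :=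
      Finset.prod_congr rfl fun i hi => by simp [hg, Finset.ne_of_mem_erase hi]
    rw [this]
    simp only [hg, if_true]
    ring
  have hint : ∀ j : Fin d, ∫ x : EuclideanSpace ℝ (Fin d), ∏ i, g j i (x i) =
      ∫ x, |x| * q x := by
    intro j
    rw [integral_euclidean_prod (g j), ← Finset.mul_prod_erase _ _ (Finset.mem_univ j)]
    have : ∏ i ∈ Finset.univ.erase j, ∫ x, g j i x = 1 :=
      Finset.prod_eq_one fun i hi => by
        simp only [hg, Finset.ne_of_mem_erase hi, if_false]; exact hq.integral_eq_one
    rw [this]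
    simp [hg]
  have hsum : ∫ x : EuclideanSpace ℝ (Fin d), ∑ j, ∏ i, g j i (x i) = d * ∫ x, |x| * q x := by
    rw [integral_finsetSum _ fun j _ => integrable_euclidean_prod (hgi j)]
    simp [hint]
  rw [← hsum, ofReal_integral_eq_lintegral_ofReal
    (integrable_finsetSum _ fun j _ => integrable_euclidean_prod (hgi j))]
  · refine lintegral_mono fun x => ?_
    rw [← ofReal_norm, ← ENNReal.ofReal_mul (hp0 x)]
    refine ENNReal.ofReal_le_ofReal ?_
    simp_rw [← hpt, ← Finset.mul_sum]
    exact mul_le_mul_of_nonneg_left (norm_le_sum_abs x) (hp0 x)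
  · refine Eventually.of_forall fun x => Finset.sum_nonneg fun j _ => ?_
    rw [← hpt]
    exact mul_nonneg (hp0 x) (abs_nonneg _)

end base

/-! ### Laws of the observations -/

section conv

variable {d : ℕ} {N : Measure (EuclideanSpace ℝ (Fin d))} [IsProbabilityMeasure N]

theorem measurable_convDensity {f : EuclideanSpace ℝ (Fin d) → ℝ} (hf : Measurable f) :
    Measurable (fun y => ∫⁻ x, ENNReal.ofReal (f (y - x)) ∂N) :=
  Measurable.lintegral_prod_right' (f := fun p : EuclideanSpace ℝ (Fin d) ×
    EuclideanSpace ℝ (Fin d) => ENNReal.ofReal (f (p.1 - p.2))) (by fun_prop)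

/-- The density of the observations. It may be infinite on a null set, so it is kept with values in
`[0, ∞]`. -/
theorem conv_ofDensity {f : EuclideanSpace ℝ (Fin d) → ℝ} (hf : Measurable f) :
    Measure.conv (ofDensity f) N =
      volume.withDensity (fun y => ∫⁻ x, ENNReal.ofReal (f (y - x)) ∂N) := by
  have hfin : SFinite (ofDensity f) := by rw [ofDensity]; infer_instance
  refine Measure.ext_of_lintegral _ fun φ hφ => ?_
  rw [Measure.lintegral_conv hφ,
    lintegral_withDensity_eq_lintegral_mul₀ (measurable_convDensity hf).aemeasurable
      hφ.aemeasurable, ofDensity, lintegral_withDensity_eq_lintegral_mul₀ (by fun_prop)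
      (Measurable.lintegral_prod_right' (f := fun p : EuclideanSpace ℝ (Fin d) ×
        EuclideanSpace ℝ (Fin d) => φ (p.1 + p.2)) (by fun_prop)).aemeasurable]
  simp only [Pi.mul_apply]
  calc ∫⁻ x, ENNReal.ofReal (f x) * ∫⁻ y, φ (x + y) ∂N
      = ∫⁻ x, ∫⁻ y, ENNReal.ofReal (f x) * φ (x + y) ∂N := by
        refine lintegral_congr fun x => ?_
        rw [lintegral_const_mul _ (by fun_prop)]
    _ = ∫⁻ y, ∫⁻ x, ENNReal.ofReal (f x) * φ (x + y) ∂volume ∂N :=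
        lintegral_lintegral_swap (f := fun x y => ENNReal.ofReal (f x) * φ (x + y))
          (Measurable.aemeasurable (by unfold Function.uncurry; fun_prop))
    _ = ∫⁻ y, ∫⁻ z, ENNReal.ofReal (f (z - y)) * φ z ∂volume ∂N := by
        refine lintegral_congr fun y => ?_
        rw [← lintegral_sub_right_eq_self (μ := volume)
          (fun x => ENNReal.ofReal (f x) * φ (x + y)) y]
        simp
    _ = ∫⁻ z, ∫⁻ y, ENNReal.ofReal (f (z - y)) * φ z ∂N :=
        lintegral_lintegral_swap (f := fun y z => ENNReal.ofReal (f (z - y)) * φ z)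
          (Measurable.aemeasurable (by unfold Function.uncurry; fun_prop))
    _ = _ := by
        refine lintegral_congr fun z => ?_
        rw [lintegral_mul_const _ (by fun_prop)]

/-- The `χ²` bound: if `N ∗ f` dominates the weight `w`, the observation laws of the densities `f`
and `f + δ` have a likelihood ratio with `χ²`-divergence at most `∫ (N ∗ δ)² / w`. -/
theorem exists_likelihood_ratio {f δ w : EuclideanSpace ℝ (Fin d) → ℝ} (hf : Measurable f)
    (hδ : Measurable δ) (hfd : IsDensity f) (hfδ : IsDensity (fun x => f x + δ x)) {C : ℝ}
    (hC : ∀ x, |δ x| ≤ C) (hw0 : ∀ y, 0 < w y)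
    (hw : ∀ y, ENNReal.ofReal (w y) ≤ ∫⁻ x, ENNReal.ofReal (f (y - x)) ∂N) {X : ℝ}
    (hi : Integrable (fun y => (∫ x, δ (y - x) ∂N) ^ 2 / w y))
    (hX : ∫ y, (∫ x, δ (y - x) ∂N) ^ 2 / w y ≤ X) :
    ∃ r : EuclideanSpace ℝ (Fin d) → ℝ, Measurable r ∧ (∀ y, 0 ≤ r y) ∧
      Measure.conv (ofDensity (fun x => f x + δ x)) N =
        (Measure.conv (ofDensity f) N).withDensity (fun y => ENNReal.ofReal (r y)) ∧
      Integrable (fun y => (r y - 1) ^ 2) (Measure.conv (ofDensity f) N) ∧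
      ∫ y, (r y - 1) ^ 2 ∂(Measure.conv (ofDensity f) N) ≤ X := by
  have hg : Measurable (fun x => f x + δ x) := hf.add hδ
  set D := fun y => ∫⁻ x, ENNReal.ofReal (f (y - x)) ∂N with hDdef
  set D' := fun y => ∫⁻ x, ENNReal.ofReal (f (y - x) + δ (y - x)) ∂N with hD'def
  have hDm : Measurable D := measurable_convDensity hf
  have hD'm : Measurable D' := measurable_convDensity hg
  have hconv : Measure.conv (ofDensity f) N = volume.withDensity D := conv_ofDensity hf
  have hconv' : Measure.conv (ofDensity (fun x => f x + δ x)) N = volume.withDensity D' :=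
    conv_ofDensity hg
  have hfin : ∀ {g : EuclideanSpace ℝ (Fin d) → ℝ}, Measurable g → IsDensity g →
      ∀ᵐ y, ∫⁻ x, ENNReal.ofReal (g (y - x)) ∂N < ⊤ := by
    intro g hgm hgd
    refine ae_lt_top (measurable_convDensity hgm) ?_
    have := isProbabilityMeasure_ofDensity hgd
    have h1 : (Measure.conv (ofDensity g) N) Set.univ = 1 := measure_univ
    rw [conv_ofDensity hgm, withDensity_apply _ MeasurableSet.univ, Measure.restrict_univ] at h1
    rw [h1]; simp
  -- pointwise description of the two densities where they are finite
  have hkey : ∀ᵐ y, D y = ENNReal.ofReal (D y).toReal ∧ D' y = ENNReal.ofReal (D' y).toReal ∧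
      w y ≤ (D y).toReal ∧ (D' y).toReal = (D y).toReal + ∫ x, δ (y - x) ∂N := by
    filter_upwards [hfin hf hfd, hfin hg hfδ] with y hy hy'
    refine ⟨(ENNReal.ofReal_toReal hy.ne).symm, (ENNReal.ofReal_toReal hy'.ne).symm, ?_, ?_⟩
    · have := ENNReal.toReal_mono hy.ne (hw y)
      rwa [ENNReal.toReal_ofReal (hw0 y).le] at this
    · have hfi : Integrable (fun x => f (y - x)) N := by
        refine ⟨Measurable.aestronglyMeasurable (by fun_prop), ?_⟩
        rw [hasFiniteIntegral_iff_ofReal (Eventually.of_forall fun x => hfd.nonneg _)]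
        exact hy
      have hδi : Integrable (fun x => δ (y - x)) N :=
        Integrable.of_bound (Measurable.aestronglyMeasurable (by fun_prop)) C (Eventually.of_forall fun x => hC _)
      rw [hDdef, hD'def]
      simp only
      rw [← integral_eq_lintegral_of_nonneg_ae (Eventually.of_forall fun x => hfd.nonneg _)
        (Measurable.aestronglyMeasurable (by fun_prop)), ← integral_eq_lintegral_of_nonneg_ae
        (Eventually.of_forall fun x => hfδ.nonneg _)
        (Measurable.aestronglyMeasurable (by fun_prop)), integral_add hfi hδi]
  set r := fun y => (D' y).toReal / (D y).toReal with hr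
  have hrm : Measurable r := hD'm.ennreal_toReal.div hDm.ennreal_toReal
  have hr0 : ∀ y, 0 ≤ r y := fun y => by positivity
  have hlin : ∫⁻ y, ENNReal.ofReal ((r y - 1) ^ 2) ∂(Measure.conv (ofDensity f) N) ≤
      ENNReal.ofReal X := by
    rw [hconv, lintegral_withDensity_eq_lintegral_mul₀ hDm.aemeasurable (by fun_prop)]
    refine le_trans ?_ (ENNReal.ofReal_le_ofReal hX)
    rw [ofReal_integral_eq_lintegral_ofReal hi (Eventually.of_forall fun y => by
      have := hw0 y; positivity)]
    refine lintegral_mono_ae ?_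
    filter_upwards [hkey] with y ⟨h1, h2, h3, h4⟩
    have hDpos : 0 < (D y).toReal := (hw0 y).trans_le h3
    rw [Pi.mul_apply, h1, ← ENNReal.ofReal_mul hDpos.le]
    refine ENNReal.ofReal_le_ofReal ?_
    have h5 : (D y).toReal * (r y - 1) ^ 2 = (∫ x, δ (y - x) ∂N) ^ 2 / (D y).toReal := by
      rw [hr]
      simp only
      rw [h4]
      field_simp
      ring
    rw [h5]
    have := hw0 y
    gcongr
  have hrint : Integrable (fun y => (r y - 1) ^ 2) (Measure.conv (ofDensity f) N) := by
    refine ⟨by fun_prop, ?_⟩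
    rw [hasFiniteIntegral_iff_ofReal (Eventually.of_forall fun x => sq_nonneg _)]
    exact hlin.trans_lt ENNReal.ofReal_lt_top
  have hX0 : 0 ≤ X := (integral_nonneg fun y => by have := hw0 y; positivity).trans hX
  refine ⟨r, hrm, hr0, ?_, hrint, ?_⟩
  · rw [hconv', hconv, ← withDensity_mul _ hDm (by fun_prop)]
    refine withDensity_congr_ae ?_
    filter_upwards [hkey] with y ⟨h1, h2, h3, h4⟩
    have hDpos : 0 < (D y).toReal := (hw0 y).trans_le h3
    rw [Pi.mul_apply, h1, h2, ← ENNReal.ofReal_mul hDpos.le, hr]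
    congr 1
    simp only
    field_simp
  · rw [integral_eq_lintegral_of_nonneg_ae (Eventually.of_forall fun y => sq_nonneg _)
      (by fun_prop)]
    exact ENNReal.toReal_le_of_le_ofReal hX0 hlin

end conv

section noise

variable {d : ℕ} {fε : ℝ → ℝ}

instance isProbabilityMeasure_noiseLaw {με : Measure ℝ} [IsProbabilityMeasure με] :
    IsProbabilityMeasure (noiseLaw d με) :=
  Measure.isProbabilityMeasure_map (by fun_prop)

/-- Convolution with the product noise acts on a tensor product coordinatewise. -/
theorem integral_noiseLaw_prodFun (hfε : IsDensity fε) (a : Fin d → ℝ → ℝ)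
    (y : EuclideanSpace ℝ (Fin d)) :
    ∫ x, prodFun a (y - x) ∂(noiseLaw d (ofDensity fε)) = ∏ j, cv fε (a j) (y j) := by
  have := isProbabilityMeasure_ofDensity hfε
  rw [noiseLaw, show (WithLp.toLp 2 : (Fin d → ℝ) → EuclideanSpace ℝ (Fin d)) =
    MeasurableEquiv.toLp 2 (Fin d → ℝ) from rfl, integral_map_equiv]
  have h1 : ∀ x : Fin d → ℝ, prodFun a (y - MeasurableEquiv.toLp 2 (Fin d → ℝ) x) =
      ∏ j, (fun j (t : ℝ) => a j (y j - t)) j (x j) := fun x => rfl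
  simp_rw [h1]
  rw [integral_fintype_prod_eq_prod (fun j (t : ℝ) => a j (y j - t))]
  refine Finset.prod_congr rfl fun j _ => ?_
  rw [integral_ofDensity hfε, cv_apply]
  rfl

/-- A translate of the heavy tail still dominates the tail, up to a factor depending on the shift. -/
theorem heavy_sub_ge (y t : ℝ) :
    1 / 4 * ((1 + y ^ 2) ^ 2)⁻¹ * ((1 + t ^ 2) ^ 2)⁻¹ ≤ ((1 + (y - t) ^ 2) ^ 2)⁻¹ := by
  have h : (1 + (y - t) ^ 2) ^ 2 ≤ 4 * ((1 + y ^ 2) ^ 2 * (1 + t ^ 2) ^ 2) := by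
    have h1 : 1 + (y - t) ^ 2 ≤ 2 * ((1 + y ^ 2) * (1 + t ^ 2)) := by
      nlinarith [sq_nonneg (y + t), sq_nonneg (y * t)]
    calc (1 + (y - t) ^ 2) ^ 2 ≤ (2 * ((1 + y ^ 2) * (1 + t ^ 2))) ^ 2 := by gcongr
      _ = _ := by ring
  calc _ = (4 * ((1 + y ^ 2) ^ 2 * (1 + t ^ 2) ^ 2))⁻¹ := by
        rw [mul_inv, mul_inv]; ring
    _ ≤ _ := by gcongr

/-- The heavy tail survives convolution with the noise. -/
theorem exists_heavy_le_cv (hfε : IsDensity fε) :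
    ∃ c, 0 < c ∧ ∀ y, c * ((1 + y ^ 2) ^ 2)⁻¹ ≤ cv fε (fun x => ((1 + x ^ 2) ^ 2)⁻¹) y := by
  have hcont : Continuous (fun x : ℝ => ((1 + x ^ 2) ^ 2)⁻¹) :=
    Continuous.inv₀ (by fun_prop) fun y => by positivity
  have hle : ∀ x : ℝ, ‖((1 + x ^ 2) ^ 2)⁻¹‖ ≤ 1 := fun x => by
    rw [Real.norm_of_nonneg (by positivity)]
    exact inv_le_one_of_one_le₀ (one_le_pow₀ (by nlinarith [sq_nonneg x]))
  have hi : Integrable (fun t => fε t * ((1 + t ^ 2) ^ 2)⁻¹) :=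
    hfε.integrable.mul_bdd (c := 1) hcont.aestronglyMeasurable (Eventually.of_forall hle)
  set c₀ := ∫ t, fε t * ((1 + t ^ 2) ^ 2)⁻¹ with hc₀
  have hnn : ∀ t, 0 ≤ fε t * ((1 + t ^ 2) ^ 2)⁻¹ := fun t => by
    have := hfε.nonneg t; positivity
  have hpos : 0 < c₀ := by
    refine lt_of_le_of_ne (integral_nonneg hnn) fun h0 => ?_
    have h1 := (integral_eq_zero_iff_of_nonneg hnn hi).mp h0.symm
    have h2 : fε =ᵐ[volume] 0 := by
      filter_upwards [h1] with t ht
      have h3 : ((1 + t ^ 2) ^ 2)⁻¹ ≠ 0 := by positivity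
      exact (mul_eq_zero.mp ht).resolve_right h3
    have h3 := hfε.integral_eq_one
    rw [integral_congr_ae h2] at h3
    simp at h3
  refine ⟨1 / 4 * c₀, by positivity, fun y => ?_⟩
  rw [cv_apply, show 1 / 4 * c₀ * ((1 + y ^ 2) ^ 2)⁻¹ = 1 / 4 * ((1 + y ^ 2) ^ 2)⁻¹ * c₀ by ring,
    hc₀, ← integral_const_mul]
  refine integral_mono (hi.const_mul _) (hfε.integrable.mul_bdd (c := 1)
    (by fun_prop) (Eventually.of_forall fun t => hle _)) fun t => ?_
  simp only
  calc _ = fε t * (1 / 4 * ((1 + y ^ 2) ^ 2)⁻¹ * ((1 + t ^ 2) ^ 2)⁻¹) := by ring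
    _ ≤ _ := mul_le_mul_of_nonneg_left (heavy_sub_ge y t) (hfε.nonneg t)

end noise

/-! ### Tensor products of combs -/

section tensorComb

variable {d m i : ℕ} {h : ℝ} {S : Fin d → Fin m → ℝ}

/-- The tensor product on `ℝᵈ` of the combs with weights `S j`. The perturbations used below carry
free weights in one coordinate and unit weights in the others. -/
noncomputable def tensorComb (h : ℝ) (i : ℕ) (S : Fin d → Fin m → ℝ) :
    EuclideanSpace ℝ (Fin d) → ℝ :=
  prodFun fun j => comb h i (S j)

theorem continuous_tensorComb : Continuous (tensorComb h i S) :=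
  continuous_prodFun fun _ => contDiff_comb.continuous

theorem integrable_tensorComb (hh : 0 < h) (hm : 2 * m * h ≤ 1) :
    Integrable (tensorComb h i S) :=
  integrable_prodFun fun _ => integrable_comb hh hm

theorem abs_tensorComb_le (hh : 0 < h) (hS : ∀ j k, |S j k| ≤ 1) {K : ℝ}
    (hK : ∀ x, |bump i x| ≤ K) (x : EuclideanSpace ℝ (Fin d)) :
    |tensorComb h i S x| ≤ K ^ d := by
  rw [tensorComb, prodFun, Finset.abs_prod]
  refine (Finset.prod_le_prod (fun j _ => abs_nonneg _)
    fun j _ => abs_comb_le hh (hS j) hK (x j)).trans_eq ?_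
  simp

theorem integral_tensorComb_succ (hd : 1 ≤ d) (hh : 0 < h) (hm : 2 * m * h ≤ 1) :
    ∫ x, tensorComb h (i + 1) S x = 0 := by
  rw [tensorComb, integral_prodFun]
  exact Finset.prod_eq_zero (Finset.mem_univ ⟨0, hd⟩) (integral_comb_succ hh hm)

theorem integral_tensorComb_sq (hh : 0 < h) :
    ∫ x, tensorComb h i S x ^ 2 = ∏ j, (h * ∑ k, S j k ^ 2) * ∫ x, bump i x ^ 2 := by
  simp_rw [tensorComb, prodFun, ← Finset.prod_pow]
  rw [integral_euclidean_prod (fun j x => comb h i (S j) x ^ 2)]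
  exact Finset.prod_congr rfl fun j _ => integral_comb_sq hh

theorem integrable_tensorComb_sq (hh : 0 < h) (hm : 2 * m * h ≤ 1) :
    Integrable (fun x => tensorComb h i S x ^ 2) := by
  simp_rw [tensorComb, prodFun, ← Finset.prod_pow]
  exact integrable_euclidean_prod (f := fun j x => comb h i (S j) x ^ 2)
    fun j => integrable_comb_sq hh hm

theorem tensorComb_update (U : Fin d → Fin m → ℝ) (j : Fin d) (s : Fin m → ℝ)
    (x : EuclideanSpace ℝ (Fin d)) :
    tensorComb h i (Function.update U j s) x =
      comb h i s (x j) * ∏ l ∈ Finset.univ.erase j, comb h i (U l) (x l) := by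
  rw [tensorComb, prodFun, ← Finset.mul_prod_erase _ _ (Finset.mem_univ j), Function.update_self]
  congr 1
  refine Finset.prod_congr rfl fun l hl => ?_
  rw [Function.update_of_ne (Finset.ne_of_mem_erase hl)]

theorem tensorComb_update_add (U : Fin d → Fin m → ℝ) (j : Fin d) (s t : Fin m → ℝ) (c : ℝ)
    (x : EuclideanSpace ℝ (Fin d)) :
    tensorComb h i (Function.update U j (fun k => s k + c * t k)) x =
      tensorComb h i (Function.update U j s) x + c * tensorComb h i (Function.update U j t) x := by
  have h1 : comb h i (fun k => s k + c * t k) (x j) = comb h i s (x j) + c * comb h i t (x j) := by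
    simp only [comb, add_mul, Finset.sum_add_distrib, Finset.mul_sum, mul_assoc c]
  rw [tensorComb_update, tensorComb_update, tensorComb_update, h1]
  ring

theorem tensorComb_update_eq_sum (U : Fin d → Fin m → ℝ) (j : Fin d) (s : Fin m → ℝ)
    (x : EuclideanSpace ℝ (Fin d)) :
    tensorComb h i (Function.update U j s) x =
      ∑ k, s k * tensorComb h i (Function.update U j (Pi.single k 1)) x := by
  simp only [tensorComb_update, comb]
  rw [Finset.sum_mul]
  refine Finset.sum_congr rfl fun k _ => ?_
  rw [Finset.sum_eq_single k (fun l _ hl => by simp [Pi.single_eq_of_ne hl]) (by simp)]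
  simp [mul_assoc]

theorem abs_prod_sub_prod_le {ι : Type*} (s : Finset ι) {a b : ι → ℝ} {K ε : ℝ} (hK : 1 ≤ K)
    (ha : ∀ i, |a i| ≤ K) (hb : ∀ i, |b i| ≤ K) (hab : ∀ i, |a i - b i| ≤ ε) :
    |∏ i ∈ s, a i - ∏ i ∈ s, b i| ≤ s.card * K ^ s.card * ε := by
  classical
  induction s using Finset.induction_on with
  | empty => simp
  | insert j s hj ih =>
    have hε : 0 ≤ ε := (abs_nonneg _).trans (hab j)
    have hbs : |∏ i ∈ s, b i| ≤ K ^ s.card := by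
      rw [Finset.abs_prod]
      exact (Finset.prod_le_prod (fun i _ => abs_nonneg _) fun i _ => hb i).trans_eq (by simp)
    rw [Finset.prod_insert hj, Finset.prod_insert hj, Finset.card_insert_of_notMem hj]
    calc |a j * ∏ i ∈ s, a i - b j * ∏ i ∈ s, b i|
        = |a j * (∏ i ∈ s, a i - ∏ i ∈ s, b i) + (a j - b j) * ∏ i ∈ s, b i| := by
          congr 1; ring
      _ ≤ |a j| * |∏ i ∈ s, a i - ∏ i ∈ s, b i| + |a j - b j| * |∏ i ∈ s, b i| := by
          rw [← abs_mul, ← abs_mul]; exact abs_add_le _ _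
      _ ≤ K * (s.card * K ^ s.card * ε) + ε * K ^ s.card := by
          gcongr
          exacts [ha j, hab j]
      _ ≤ K * (s.card * K ^ s.card * ε) + ε * K ^ s.card * K := by
          have := mul_le_mul_of_nonneg_left hK (by positivity : 0 ≤ ε * K ^ s.card)
          linarith
      _ = _ := by push_cast; ring

theorem abs_comb_sub_comb_le {s : Fin m → ℝ} (hh : 0 < h) (hs : ∀ k, |s k| ≤ 1) {K : ℝ}
    (hK : ∀ x, |bump (i + 1) x| ≤ K) (x y : ℝ) :
    |comb h i s x - comb h i s y| ≤ K / h * |x - y| := by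
  refine Convex.norm_image_sub_le_of_norm_deriv_le (𝕜 := ℝ) (s := Set.univ)
    (fun z _ => (contDiff_comb.differentiable (by simp)) z) (fun z _ => ?_) convex_univ
    (Set.mem_univ y) (Set.mem_univ x)
  rw [deriv_comb, Real.norm_eq_abs, abs_mul, abs_of_pos (inv_pos.mpr hh), div_eq_inv_mul]
  gcongr
  exact abs_comb_le hh hs hK z

theorem lipschitzWith_tensorComb (hh : 0 < h) (hS : ∀ j k, |S j k| ≤ 1) {K : ℝ} (hK1 : 1 ≤ K)
    (hK : ∀ x, |bump i x| ≤ K) (hK' : ∀ x, |bump (i + 1) x| ≤ K) :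
    LipschitzWith (Real.toNNReal (d * K ^ (d + 1) / h)) (tensorComb h i S) := by
  refine LipschitzWith.of_dist_le_mul fun x y => ?_
  rw [Real.coe_toNNReal _ (by positivity), Real.dist_eq, dist_eq_norm, tensorComb, prodFun, prodFun]
  refine (abs_prod_sub_prod_le Finset.univ hK1 (fun j => abs_comb_le hh (hS j) hK _)
    (fun j => abs_comb_le hh (hS j) hK _) (ε := K / h * ‖x - y‖) fun j => ?_).trans_eq ?_
  · refine (abs_comb_sub_comb_le hh (hS j) hK' _ _).trans ?_
    gcongr
    exact PiLp.norm_apply_le (x - y) j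
  · simp only [Finset.card_univ, Fintype.card_fin]
    ring

/-- Sobolev energy of the tensor combs: frequencies are of order `h⁻¹`. -/
theorem sob_tensorComb_le (hd : 1 ≤ d) {α : ℝ} (hα : 0 ≤ α) {N : ℕ} (hN : α ≤ N) (hh : 0 < h)
    (hh1 : h ≤ 1) (hm : 2 * m * h ≤ 1) (hS : ∀ j k, |S j k| ≤ 1) :
    sob α (tensorComb h i S) ≤ ENNReal.ofReal (h ^ (-(2 * α)) *
      (d * (2 ^ N * (2 * Real.pi) * ((∫ x, bump i x ^ 2) + ∫ x, bump (i + N) x ^ 2) *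
        (2 * Real.pi * ∫ x, bump i x ^ 2) ^ (d - 1)))) := by
  have hsq : ∀ (i : ℕ) (j : Fin d), ∫ x, comb h i (S j) x ^ 2 ≤ ∫ x, bump i x ^ 2 := by
    intro i j
    rw [integral_comb_sq hh]
    refine mul_le_of_le_one_left (integral_bump_sq_pos i).le ?_
    have h1 : ∑ k, S j k ^ 2 ≤ m := by
      refine (Finset.sum_le_card_nsmul _ _ 1 fun k _ => ?_).trans_eq (by simp)
      exact (sq_le_one_iff_abs_le_one _).mpr (hS j k)
    nlinarith [mul_le_mul_of_nonneg_left h1 hh.le]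
  refine (sob_prodFun_le hd (X := 2 * Real.pi * ∫ x, bump i x ^ 2)
    (Y := 2 ^ N * h ^ (-(2 * α)) * (2 * Real.pi) *
      ((∫ x, bump i x ^ 2) + ∫ x, bump (i + N) x ^ 2)) ?_ ?_ ?_ ?_).trans_eq ?_
  · intro j
    simpa using integrable_sobolev (b := comb h i (S j)) contDiff_comb
      (hasCompactSupport_comb hh hm) 0
  · exact fun j => integrable_sobolev contDiff_comb (hasCompactSupport_comb hh hm) α
  · intro j
    rw [integral_norm_fourier_sq_of_contDiff contDiff_comb (hasCompactSupport_comb hh hm)]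
    exact mul_le_mul_of_nonneg_left (hsq i j) (by positivity)
  · intro j
    refine (integral_sobolev_le contDiff_comb (hasCompactSupport_comb hh hm) hα hN hh hh1).trans ?_
    simp_rw [iteratedDeriv_comb hh.ne']
    exact mul_le_mul_of_nonneg_left (add_le_add (hsq i j) (hsq (i + N) j)) (by positivity)
  · congr 1; ring

end tensorComb

/-- Around the interior of the class sits a family of densities perturbed by tensor combs: with
amplitude of order `h ^ α` they stay in the class, and they keep a common heavy lower bound. -/
theorem exists_perturbed_family {d : ℕ} (hd : 1 ≤ d) {α L M : ℝ} (hα : 0 < α) (hM : 0 < M)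
    (hD : (mixingClass d α L M).Nontrivial) (i : ℕ) :
    ∃ (f : EuclideanSpace ℝ (Fin d) → ℝ) (c₀ w₀ : ℝ), Measurable f ∧ 0 < c₀ ∧ 0 < w₀ ∧
      ∀ (m : ℕ) (h γ : ℝ) (S : Fin d → Fin m → ℝ), 0 < h → h ≤ 1 → 2 * m * h ≤ 1 →
        (∀ j k, |S j k| ≤ 1) → 0 ≤ γ → γ ≤ c₀ * h ^ α →
        IsDensity (fun x => f x + γ * tensorComb h (i + 1) S x) ∧
        ofDensity (fun x => f x + γ * tensorComb h (i + 1) S x) ∈ mixingClass d α L M ∧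
        ∀ x, w₀ * prodFun (fun _ t => ((1 + t ^ 2) ^ 2)⁻¹) x ≤
          f x + γ * tensorComb h (i + 1) S x := by
  obtain ⟨fm, hfmm, hfm, hfM, hfL⟩ := exists_interior_density hd hD
  have hd0 : (0 : ℝ) < d := by exact_mod_cast hd
  obtain ⟨q, hqc, hq, hqi, hqm, ⟨c, hc, hqh⟩, hqs⟩ :=
    exists_heavy_density (ε := M / (2 * d)) (by positivity)
  set p : EuclideanSpace ℝ (Fin d) → ℝ := prodFun (fun _ => q) with hp
  have hpd : IsDensity p :=
    ⟨fun x => Finset.prod_nonneg fun j _ => hq.nonneg _, integrable_prodFun fun _ => hq.integrable,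
      by rw [hp, integral_prodFun]; simp [hq.integral_eq_one]⟩
  have hpM : mom p ≤ ENNReal.ofReal (M / 2) := by
    refine (mom_prodFun_le hq hqi).trans (ENNReal.ofReal_le_ofReal ?_)
    calc d * ∫ x, |x| * q x ≤ d * (M / (2 * d)) := by gcongr
      _ = M / 2 := by field_simp
  have hpL : sob α p ≠ ⊤ :=
    ne_top_of_le_ne_top ENNReal.ofReal_ne_top (sob_prodFun_le hd (fun _ => by simpa using hqs 0)
      (fun _ => hqs α) (fun _ => le_rfl) (fun _ => le_rfl))
  obtain ⟨η, κ, hη, hη1, hκ, hroom⟩ := exists_perturbation_room hM hfm hpd hfM hfL hpM hpL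
  obtain ⟨K, hK0, hK⟩ := exists_bump_le (i + 1)
  obtain ⟨N, hN⟩ := exists_nat_ge α
  set A : ℝ := d * (2 ^ N * (2 * Real.pi) *
    ((∫ x, bump (i + 1) x ^ 2) + ∫ x, bump (i + 1 + N) x ^ 2) *
        (2 * Real.pi * ∫ x, bump (i + 1) x ^ 2) ^ (d - 1)) with hA
  have hA0 : 0 < A := by
    have := integral_bump_sq_pos (i + 1)
    have := integral_bump_sq_pos (i + 1 + N)
    positivity
  set ν : EuclideanSpace ℝ (Fin d) → ℝ := prodFun (fun _ t => ((1 + t ^ 2) ^ 2)⁻¹) with hν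
  have hpν : ∀ x, c ^ d * ν x ≤ p x := fun x => by
    have h1 : c ^ d * ν x = ∏ j : Fin d, c * ((1 + x j ^ 2) ^ 2)⁻¹ := by
      rw [Finset.prod_mul_distrib]; simp [hν, prodFun]
    rw [h1]
    exact Finset.prod_le_prod (fun j _ => by positivity) fun j _ => hqh _
  set c₀ := min (η / 2 * (c / 4) ^ d / K ^ d) (Real.sqrt (κ / A)) with hc₀
  refine ⟨fun x => (1 - η) * fm x + η * p x, c₀, η / 2 * c ^ d, ?_, by positivity, by positivity,
    ?_⟩
  · exact (hfmm.const_mul _).add ((continuous_prodFun fun _ => hqc).measurable.const_mul _)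
  intro m h γ S hh hh1 hm hS hγ0 hγ
  have hhα : h ^ α ≤ 1 := Real.rpow_le_one hh.le hh1 hα.le
  have hhα0 : 0 < h ^ α := by positivity
  have hg : ∀ x, |γ * tensorComb h (i + 1) S x| ≤ η / 2 * p x := by
    intro x
    by_cases hx : ∀ j, x j ∈ Set.Icc (0 : ℝ) 1
    · have h1 : γ ≤ η / 2 * (c / 4) ^ d / K ^ d :=
        hγ.trans ((mul_le_of_le_one_right (by positivity) hhα).trans (min_le_left _ _))
      rw [le_div_iff₀ (by positivity)] at h1
      have h2 : (c / 4) ^ d ≤ p x := by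
        have : (c / 4) ^ d = ∏ _j : Fin d, c / 4 := by simp [div_pow]
        rw [this]
        refine Finset.prod_le_prod (fun j _ => by positivity) fun j _ => (hqh _).trans' ?_
        rw [div_eq_mul_inv]
        gcongr
        obtain ⟨h3, h4⟩ := hx j
        have h5 : x j ^ 2 ≤ 1 := by nlinarith
        calc (1 + x j ^ 2) ^ 2 ≤ (1 + 1) ^ 2 := by gcongr
          _ = 4 := by norm_num
      rw [abs_mul, abs_of_nonneg hγ0]
      calc γ * |tensorComb h (i + 1) S x| ≤ γ * K ^ d := by
            gcongr; exact abs_tensorComb_le hh hS hK x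
        _ ≤ η / 2 * (c / 4) ^ d := h1
        _ ≤ _ := by gcongr
    · push Not at hx
      obtain ⟨j, hj⟩ := hx
      rw [tensorComb, prodFun, Finset.prod_eq_zero (Finset.mem_univ j) (comb_eq_zero hh hm hj)]
      have := hpd.nonneg x
      rw [mul_zero, abs_zero]
      positivity
  have hsob : sob α (fun x => γ * tensorComb h (i + 1) S x) ≤ ENNReal.ofReal κ := by
    rw [sob_const_mul]
    refine (mul_le_mul_right (sob_tensorComb_le hd hα.le hN hh hh1 hm hS) _).trans ?_
    rw [← hA, ← ENNReal.ofReal_mul (by positivity)]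
    refine ENNReal.ofReal_le_ofReal ?_
    have h1 : γ ≤ Real.sqrt (κ / A) * h ^ α :=
      hγ.trans (mul_le_mul_of_nonneg_right (min_le_right _ _) hhα0.le)
    have h2 : h ^ (-(2 * α)) = ((h ^ α) ^ 2)⁻¹ := by
      rw [Real.rpow_neg hh.le, mul_comm 2 α, Real.rpow_mul hh.le]; simp
    calc γ ^ 2 * (h ^ (-(2 * α)) * A) ≤ (Real.sqrt (κ / A) * h ^ α) ^ 2 * (h ^ (-(2 * α)) * A) := by
          gcongr
      _ = κ := by
          rw [mul_pow, Real.sq_sqrt (by positivity), h2]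
          field_simp
  have hadd : (fun x => (1 - η) * fm x + η * p x + γ * tensorComb h (i + 1) S x) =
      fun x => (1 - η) * fm x + (η * p x + γ * tensorComb h (i + 1) S x) := by
    ext x; ring
  obtain ⟨h1, h2⟩ := hroom (fun x => γ * tensorComb h (i + 1) S x)
    ((integrable_tensorComb hh hm).const_mul _) hg
    (by rw [integral_const_mul, integral_tensorComb_succ hd hh hm, mul_zero]) hsob
  refine ⟨by rw [hadd]; exact h1, by rw [hadd]; exact h2, fun x => ?_⟩
  have h3 := neg_le_of_abs_le (hg x)
  have h4 : 0 ≤ (1 - η) * fm x := mul_nonneg (by linarith) (hfm.nonneg x)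
  have h5 := mul_le_mul_of_nonneg_left (hpν x) (by positivity : 0 ≤ η / 2)
  linarith

/-! ### The minimax lower bound -/

section lowerBound

variable {d : ℕ} {fε : ℝ → ℝ} {β c : ℝ} {q : ℕ}

/-- Flipping one weight of the comb in the coordinate `j₀` changes the law of an observation by a
`χ²`-divergence of order `ρ ^ 2 * h ^ (2 * β * d + 1)`: each of the `d` coordinates gains `h ^ (2 * β)`
from the smoothness of the noise, and the single bump in the coordinate `j₀` has length `h`. -/
theorem exists_chiSq_bound (hfε : IsDensity fε) (hβ : 0 < β) (hq : β ≤ q)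
    (hmom : ∀ l ≤ 2, Integrable (fun x => x ^ l * fε x) ∧
      ∀ t, ‖fourier (fun x => x ^ l * fε x) t‖ ≤ c * (1 + |t|) ^ (-β))
    (j₀ : Fin d) {w₀ : ℝ} (hw₀ : 0 < w₀) :
    ∃ B, 0 < B ∧ ∀ (m : ℕ) (h ρ : ℝ) (k : Fin m) (f : EuclideanSpace ℝ (Fin d) → ℝ),
      Measurable f → IsDensity f → (∀ x, w₀ * prodFun (fun _ t => ((1 + t ^ 2) ^ 2)⁻¹) x ≤ f x) →
      0 < h → h ≤ 1 → 2 * m * h ≤ 1 →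
      IsDensity (fun x => f x +
        ρ * tensorComb h (q + 2) (Function.update (fun _ _ => 1) j₀ (Pi.single k 1)) x) →
      ∃ r : EuclideanSpace ℝ (Fin d) → ℝ, Measurable r ∧ (∀ y, 0 ≤ r y) ∧
        Measure.conv (ofDensity (fun x => f x +
          ρ * tensorComb h (q + 2) (Function.update (fun _ _ => 1) j₀ (Pi.single k 1)) x))
            (noiseLaw d (ofDensity fε)) =
          (Measure.conv (ofDensity f) (noiseLaw d (ofDensity fε))).withDensity
            (fun y => ENNReal.ofReal (r y)) ∧
        Integrable (fun y => (r y - 1) ^ 2)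
          (Measure.conv (ofDensity f) (noiseLaw d (ofDensity fε))) ∧
        ∫ y, (r y - 1) ^ 2 ∂(Measure.conv (ofDensity f) (noiseLaw d (ofDensity fε))) ≤
          B * (ρ ^ 2 * h ^ (2 * β * d + 1)) := by
  have := isProbabilityMeasure_ofDensity hfε
  obtain ⟨C, hC, hCb⟩ := exists_weighted_bound hβ hq (by simpa using (hmom 0 (by norm_num)).1)
    (hmom 1 (by norm_num)).1 (hmom 2 le_rfl).1 (by simpa using (hmom 0 (by norm_num)).2)
    (hmom 1 (by norm_num)).2 (hmom 2 le_rfl).2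
  obtain ⟨cε, hcε, hcv⟩ := exists_heavy_le_cv hfε
  set N := noiseLaw d (ofDensity fε) with hN
  set ν : EuclideanSpace ℝ (Fin d) → ℝ := prodFun (fun _ t => ((1 + t ^ 2) ^ 2)⁻¹) with hν
  have hνc : Continuous ν := continuous_prodFun fun _ =>
    Continuous.inv₀ (by fun_prop) fun y => by positivity
  have hν0 : ∀ x, 0 < ν x := fun x => Finset.prod_pos fun j _ => by positivity
  have hν1 : ∀ x, ν x ≤ 1 := fun x => Finset.prod_le_one (fun j _ => by positivity) fun j _ =>
    inv_le_one_of_one_le₀ (one_le_pow₀ (by nlinarith [sq_nonneg (x j)]))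
  refine ⟨C ^ d / (w₀ * cε ^ d), by positivity, ?_⟩
  intro m h ρ k f hfm hf hfν hh hh1 hm hδ
  set S : Fin d → Fin m → ℝ := Function.update (fun _ _ => 1) j₀ (Pi.single k 1) with hS
  have hSabs : ∀ j k, |S j k| ≤ 1 := by
    intro j l
    by_cases hj : j = j₀
    · subst hj
      rw [hS, Function.update_self]
      by_cases hl : l = k
      · subst hl; simp
      · simp [Pi.single_eq_of_ne hl]
    · simp [hS, Function.update_of_ne hj]
  have hSsum : ∀ j, h * ∑ k, S j k ^ 2 ≤ if j = j₀ then h else 1 := by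
    intro j
    split_ifs with hj
    · subst hj
      rw [hS, Function.update_self, Finset.sum_eq_single k
        (fun l _ hl => by simp [Pi.single_eq_of_ne hl]) (by simp)]
      simp
    · simp only [hS, Function.update_of_ne hj]
      simp only [one_pow, Finset.sum_const, Finset.card_univ, Fintype.card_fin, nsmul_eq_mul,
        mul_one]
      have : 0 ≤ m * h := by positivity
      linarith
  obtain ⟨K, hK0, hK⟩ := exists_bump_le (q + 2)
  have hform : ∀ y : EuclideanSpace ℝ (Fin d),
      (∫ x, ρ * tensorComb h (q + 2) S (y - x) ∂N) ^ 2 / (w₀ * cε ^ d * ν y) =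
      ρ ^ 2 / (w₀ * cε ^ d) * ∏ j, cv fε (comb h (q + 2) (S j)) (y j) ^ 2 * (1 + y j ^ 2) ^ 2 := by
    intro y
    rw [integral_const_mul, tensorComb, hN, integral_noiseLaw_prodFun hfε, Finset.prod_mul_distrib,
      Finset.prod_pow, hν, prodFun, Finset.prod_inv_distrib]
    have : 0 < ∏ j, (1 + y j ^ 2) ^ 2 := Finset.prod_pos fun j _ => by positivity
    field_simp
  refine exists_likelihood_ratio (C := |ρ| * K ^ d) (w := fun y => w₀ * cε ^ d * ν y) hfm
    (continuous_tensorComb.measurable.const_mul _) hf hδ ?_ ?_ ?_ ?_ ?_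
  · intro x
    rw [abs_mul]
    gcongr
    exact abs_tensorComb_le hh hSabs hK x
  · intro y
    have := hν0 y
    positivity
  · intro y
    have hint : Integrable (fun x => w₀ * ν (y - x)) N := by
      refine Integrable.const_mul (Integrable.of_bound (C := 1)
        (Continuous.aestronglyMeasurable (by fun_prop)) (Eventually.of_forall fun x => ?_)) _
      rw [Real.norm_of_nonneg (hν0 _).le]
      exact hν1 _
    calc ENNReal.ofReal (w₀ * cε ^ d * ν y) ≤ ENNReal.ofReal (∫ x, w₀ * ν (y - x) ∂N) := by
          refine ENNReal.ofReal_le_ofReal ?_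
          rw [integral_const_mul, hν, hN, integral_noiseLaw_prodFun hfε, mul_assoc]
          refine mul_le_mul_of_nonneg_left ?_ hw₀.le
          have h1 : cε ^ d * prodFun (fun _ t => ((1 + t ^ 2) ^ 2)⁻¹) y =
              ∏ j : Fin d, cε * ((1 + y j ^ 2) ^ 2)⁻¹ := by
            rw [Finset.prod_mul_distrib]; simp [prodFun]
          rw [h1]
          exact Finset.prod_le_prod (fun j _ => by positivity) fun j _ => hcv _
      _ = ∫⁻ x, ENNReal.ofReal (w₀ * ν (y - x)) ∂N :=
          ofReal_integral_eq_lintegral_ofReal hint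
            (Eventually.of_forall fun x => mul_nonneg hw₀.le (hν0 _).le)
      _ ≤ _ := lintegral_mono fun x => ENNReal.ofReal_le_ofReal (hfν _)
  · simp_rw [hform]
    exact (integrable_euclidean_prod (f := fun j t =>
      cv fε (comb h (q + 2) (S j)) t ^ 2 * (1 + t ^ 2) ^ 2)
        fun j => (hCb m h (S j) hh hh1 hm).1).const_mul _
  · simp_rw [hform]
    rw [integral_const_mul, integral_euclidean_prod (fun j t =>
      cv fε (comb h (q + 2) (S j)) t ^ 2 * (1 + t ^ 2) ^ 2)]
    have h1 : ∏ j, ∫ t, cv fε (comb h (q + 2) (S j)) t ^ 2 * (1 + t ^ 2) ^ 2 ≤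
        ∏ j, C * h ^ (2 * β) * (if j = j₀ then h else 1) := by
      refine Finset.prod_le_prod (fun j _ => integral_nonneg fun t => by positivity) fun j _ => ?_
      exact (hCb m h (S j) hh hh1 hm).2.trans
        (mul_le_mul_of_nonneg_left (hSsum j) (by positivity))
    have h2 : ∏ j, C * h ^ (2 * β) * (if j = j₀ then h else 1) = C ^ d * h ^ (2 * β * d + 1) := by
      rw [Finset.prod_mul_distrib, Finset.prod_ite_eq', if_pos (Finset.mem_univ _),
        Real.rpow_add hh, Real.rpow_one, Real.rpow_mul_natCast hh.le]
      simp [mul_pow, mul_assoc]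
    rw [h2] at h1
    calc _ ≤ ρ ^ 2 / (w₀ * cε ^ d) * (C ^ d * h ^ (2 * β * d + 1)) := by gcongr
      _ = _ := by ring

/-- Assouad's bound for the perturbed family. The combs also serve as test functions: a signed
combination of bumps of width `h` is Lipschitz with a constant of order `h⁻¹`, so by duality `W₁`
controls `h` times the sum over all bumps of the estimation errors. -/
theorem exists_minimax_lower_bound (hfε : IsDensity fε) (hβ : 0 < β) (hq : β ≤ q)
    (hmom : ∀ l ≤ 2, Integrable (fun x => x ^ l * fε x) ∧
      ∀ t, ‖fourier (fun x => x ^ l * fε x) t‖ ≤ c * (1 + |t|) ^ (-β))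
    (hd : 1 ≤ d) {α L M : ℝ} (hα : 0 < α) (hM : 0 < M)
    (hD : (mixingClass d α L M).Nontrivial) :
    ∃ c₀ c₁ c₂ : ℝ, 0 < c₀ ∧ 0 < c₁ ∧ 0 < c₂ ∧ ∀ (n m : ℕ) (h γ : ℝ), 0 < h → h ≤ 1 →
      2 * m * h ≤ 1 → 0 ≤ γ → γ ≤ c₀ * h ^ α → n * (γ ^ 2 * h ^ (2 * β * d + 1)) ≤ c₁ →
      ∀ μhat : (Fin n → EuclideanSpace ℝ (Fin d)) → Measure (EuclideanSpace ℝ (Fin d)),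
        IsEstimator μhat →
        ENNReal.ofReal (c₂ * (γ * h * (m * h) ^ d)) ≤
          ⨆ μ ∈ mixingClass d α L M, risk (ofDensity fε) μhat μ := by
  have hd0 : (0 : ℝ) < d := by exact_mod_cast hd
  have := isProbabilityMeasure_ofDensity hfε
  set j₀ : Fin d := ⟨0, hd⟩ with hj₀
  obtain ⟨f, c₀, w₀, hfm, hc₀, hw₀, hfam⟩ := exists_perturbed_family hd hα hM hD (q + 1)
  obtain ⟨B, hB, hchi⟩ := exists_chiSq_bound hfε hβ hq hmom j₀ hw₀
  obtain ⟨K₁, -, hK₁⟩ := exists_bump_le (q + 2)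
  obtain ⟨K₂, -, hK₂⟩ := exists_bump_le (q + 2 + 1)
  obtain ⟨K, hK1, hKa, hKb⟩ : ∃ K, 1 ≤ K ∧ (∀ x, |bump (q + 2) x| ≤ K) ∧
      ∀ x, |bump (q + 2 + 1) x| ≤ K :=
    ⟨max 1 (max K₁ K₂), le_max_left _ _, fun x => (hK₁ x).trans (by simp),
      fun x => (hK₂ x).trans (by simp)⟩
  set J := ∫ x, bump (q + 2) x ^ 2 with hJ
  have hJ0 : 0 < J := integral_bump_sq_pos _
  refine ⟨c₀, 1 / (5 * B), J ^ d / (8 * d * K ^ (d + 1)), hc₀, by positivity, by positivity, ?_⟩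
  intro n m h γ hh hh1 hm hγ0 hγ hn μhat hest
  -- the weights `s` in the coordinate `j₀`, and unit weights elsewhere
  set φ : (Fin m → ℝ) → EuclideanSpace ℝ (Fin d) → ℝ :=
    fun s => tensorComb h (q + 2) (Function.update (fun _ _ => 1) j₀ s) with hφ
  set e : Fin m → Fin m → ℝ := fun k => Pi.single k 1 with he
  have hφc : ∀ s, Continuous (φ s) := fun s => continuous_tensorComb
  have hw : ∀ s : Fin m → ℝ, (∀ k, |s k| ≤ 1) → ∀ j k,
      |(Function.update (fun _ _ => 1) j₀ s : Fin d → Fin m → ℝ) j k| ≤ 1 := by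
    intro s hs j k
    by_cases hj : j = j₀
    · subst hj; rw [Function.update_self]; exact hs k
    · simp [Function.update_of_ne hj]
  have he1 : ∀ k l, |e k l| ≤ 1 := by
    intro k l
    by_cases hl : l = k
    · subst hl; simp [he]
    · simp [he, Pi.single_eq_of_ne hl]
  have hφb : ∀ s : Fin m → ℝ, (∀ k, |s k| ≤ 1) → ∀ x, |φ s x| ≤ K ^ d := fun s hs x =>
    abs_tensorComb_le hh (hw s hs) hKa x
  set sw : (Fin m → Bool) → Fin m → ℝ := fun θ k => if θ k then 1 else 0 with hsw
  have hsw1 : ∀ θ k, |sw θ k| ≤ 1 := by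
    intro θ k
    simp only [hsw]
    split_ifs <;> simp
  set F : (Fin m → Bool) → EuclideanSpace ℝ (Fin d) → ℝ :=
    fun θ x => f x + γ * φ (sw θ) x with hF
  have hFm : ∀ θ, Measurable (F θ) := fun θ => hfm.add ((hφc _).measurable.const_mul _)
  have hFd : ∀ θ, IsDensity (F θ) := fun θ =>
    (hfam m h γ _ hh hh1 hm (hw _ (hsw1 θ)) hγ0 hγ).1
  have hFmem : ∀ θ, ofDensity (F θ) ∈ mixingClass d α L M := fun θ =>
    (hfam m h γ _ hh hh1 hm (hw _ (hsw1 θ)) hγ0 hγ).2.1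
  have hFν : ∀ θ x, w₀ * prodFun (fun _ t => ((1 + t ^ 2) ^ 2)⁻¹) x ≤ F θ x := fun θ =>
    (hfam m h γ _ hh hh1 hm (hw _ (hsw1 θ)) hγ0 hγ).2.2
  have hFprob : ∀ θ, IsProbabilityMeasure (ofDensity (F θ)) := fun θ =>
    isProbabilityMeasure_ofDensity (hFd θ)
  have hmprob := hest.isProbabilityMeasure
  have hφi : ∀ {μ : Measure (EuclideanSpace ℝ (Fin d))} [IsProbabilityMeasure μ] (s : Fin m → ℝ),
      (∀ k, |s k| ≤ 1) → Integrable (φ s) μ := fun s hs =>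
    Integrable.of_bound (hφc s).aestronglyMeasurable (K ^ d)
      (Eventually.of_forall fun x => hφb s hs x)
  have hφsq : ∀ k, ∫ x, φ (e k) x ^ 2 = (h * J) * (h * m * J) ^ (d - 1) := by
    intro k
    rw [hφ]
    simp only
    rw [integral_tensorComb_sq hh, ← Finset.mul_prod_erase _ _ (Finset.mem_univ j₀),
      Function.update_self, Finset.sum_eq_single k
        (fun l _ hl => by simp [he, Pi.single_eq_of_ne hl]) (by simp)]
    congr 1
    · simp [he, hJ]
    · rw [Finset.prod_congr rfl (g := fun _ => h * m * J) fun j hj => by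
        rw [Function.update_of_ne (Finset.ne_of_mem_erase hj)]; simp [hJ]]
      simp
  set Λ : NNReal := Real.toNNReal (d * K ^ (d + 1) / h) with hΛ
  have hΛ0 : Λ ≠ 0 := by
    rw [hΛ]
    exact (Real.toNNReal_pos.mpr (by positivity)).ne'
  set R := ⨆ μ ∈ mixingClass d α L M, risk (ofDensity fε) μhat μ with hR
  set T : Fin m → (Fin n → EuclideanSpace ℝ (Fin d)) → ℝ := fun k y => ∫ x, φ (e k) x ∂(μhat y)
    with hT
  have hTm : ∀ k, Measurable (T k) := fun k =>
    measurable_integral_estimator hest.measurable (hφc _).measurable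
  set a : (Fin m → Bool) → Fin m → ℝ := fun θ k => ∫ x, φ (e k) x ∂(ofDensity (F θ)) with ha
  have key := assouad (D := ENNReal.ofReal (γ * ((h * J) * (h * m * J) ^ (d - 1)) / 4))
    (S := Λ * R) (fun θ k => ∫⁻ y, ENNReal.ofReal |T k y - a θ k|
      ∂(sampleLaw d n (ofDensity fε) (ofDensity (F θ)))) ?_ ?_
  · have hE : (m : ℝ≥0∞) * ENNReal.ofReal (γ * ((h * J) * (h * m * J) ^ (d - 1)) / 4) =
        ENNReal.ofReal (γ * (h * m * J) ^ d / 4) := by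
      rw [← ENNReal.ofReal_natCast, ← ENNReal.ofReal_mul (by positivity)]
      congr 1
      obtain ⟨d', rfl⟩ : ∃ d', d = d' + 1 := ⟨d - 1, by omega⟩
      rw [Nat.add_sub_cancel]
      ring
    have hX : J ^ d / (8 * d * K ^ (d + 1)) * (γ * h * (m * h) ^ d) =
        (γ * (h * m * J) ^ d / 4) / (2 * (d * K ^ (d + 1) / h)) := by
      field_simp
      ring
    rw [hX, ENNReal.ofReal_div_of_pos (by positivity)]
    refine ENNReal.div_le_of_le_mul' ?_
    rw [← hE, ENNReal.ofReal_mul (by norm_num), ENNReal.ofReal_ofNat]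
    exact key.trans_eq (mul_assoc 2 (Λ : ℝ≥0∞) R).symm
  · -- two neighbouring hypotheses
    intro θ k
    set θ' := Function.update θ k (!θ k) with hθ'
    set σ : ℝ := if θ k then -1 else 1 with hσ
    have hσ1 : |σ| = 1 := by
      simp only [hσ]; split_ifs <;> simp
    have hsw' : sw θ' = fun l => sw θ l + σ * e k l := by
      ext l
      by_cases hl : l = k
      · subst hl
        simp only [hsw, hθ', hσ, he, Function.update_self, Pi.single_eq_same]
        cases θ l <;> simp
      · simp [hsw, hθ', he, Function.update_of_ne hl, Pi.single_eq_of_ne hl]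
    have hF' : F θ' = fun x => F θ x + (γ * σ) * φ (e k) x := by
      ext x
      simp only [hF, hφ]
      rw [hsw', tensorComb_update_add]
      ring
    have hd' : IsDensity (fun x => F θ x + (γ * σ) * φ (e k) x) := by
      rw [← hF']; exact hFd θ'
    obtain ⟨r, hrm, hr0, hrQ, hri, hrX⟩ := hchi m h (γ * σ) k (F θ) (hFm θ) (hFd θ) (hFν θ) hh hh1
      hm hd'
    have hQ : Measure.conv (ofDensity (F θ')) (noiseLaw d (ofDensity fε)) =
        (Measure.conv (ofDensity (F θ)) (noiseLaw d (ofDensity fε))).withDensity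
          (fun y => ENNReal.ofReal (r y)) := by
      rw [hF']; exact hrQ
    have hdiff : |a θ k - a θ' k| = γ * ((h * J) * (h * m * J) ^ (d - 1)) := by
      have hi1 : Integrable (fun x => F θ x • φ (e k) x) :=
        (hFd θ).integrable.mul_bdd (c := K ^ d) (hφc _).aestronglyMeasurable
          (Eventually.of_forall fun x => hφb _ (he1 k) x)
      have hi2 : Integrable (fun x => γ * σ * φ (e k) x ^ 2) :=
        (integrable_tensorComb_sq hh hm).const_mul _
      have h1 : a θ' k = a θ k + γ * σ * ((h * J) * (h * m * J) ^ (d - 1)) := by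
        simp only [ha]
        rw [integral_ofDensity (hFd θ), integral_ofDensity (hFd θ'), ← hφsq k,
          ← integral_const_mul, ← integral_add hi1 hi2, hF']
        refine integral_congr_ae (Eventually.of_forall fun x => ?_)
        simp only [smul_eq_mul]
        ring
      rw [h1, sub_add_cancel_left, abs_neg, abs_mul, abs_mul, hσ1, mul_one, abs_of_nonneg hγ0,
        abs_of_nonneg (by positivity)]
    rw [← hdiff]
    refine two_point_bound_pi hrm hr0 hQ hri ?_ (hTm k) _ _
    calc _ ≤ (n : ℝ) * (B * ((γ * σ) ^ 2 * h ^ (2 * β * d + 1))) := by gcongr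
      _ = B * (n * (γ ^ 2 * h ^ (2 * β * d + 1))) := by
          rw [mul_pow, ← sq_abs σ, hσ1]; ring
      _ ≤ B * (1 / (5 * B)) := by gcongr
      _ = 1 / 5 := by field_simp
  · -- duality: the errors over all bumps are tested by one signed comb
    intro θ
    rw [← lintegral_finsetSum _ fun k _ => by
      have := hTm k
      fun_prop]
    have hpt : ∀ y, ∑ k, ENNReal.ofReal |T k y - a θ k| ≤ Λ * W1 (μhat y) (ofDensity (F θ)) := by
      intro y
      have := hmprob y
      set v : Fin m → ℝ := fun k => if 0 ≤ T k y - a θ k then 1 else -1 with hv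
      have hv1 : ∀ k, |v k| ≤ 1 := by
        intro k
        simp only [hv]
        split_ifs <;> simp
      have hsum : ∀ (μ : Measure (EuclideanSpace ℝ (Fin d))) [IsProbabilityMeasure μ],
          ∫ x, φ v x ∂μ = ∑ k, v k * ∫ x, φ (e k) x ∂μ := by
        intro μ _
        simp_rw [← integral_const_mul]
        rw [← integral_finsetSum _ fun k _ => (hφi (e k) (he1 k)).const_mul _]
        exact integral_congr_ae (Eventually.of_forall fun x => tensorComb_update_eq_sum _ _ _ _)
      have habs : ∑ k, |T k y - a θ k| =
          ∫ x, φ v x ∂(μhat y) - ∫ x, φ v x ∂(ofDensity (F θ)) := by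
        rw [hsum, hsum, ← Finset.sum_sub_distrib]
        refine Finset.sum_congr rfl fun k _ => ?_
        rw [← mul_sub]
        change _ = v k * (T k y - a θ k)
        simp only [hv]
        split_ifs with h0
        · rw [abs_of_nonneg h0, one_mul]
        · rw [abs_of_neg (not_le.mp h0), neg_one_mul]
      rw [← ENNReal.ofReal_sum_of_nonneg fun k _ => abs_nonneg _, habs]
      exact (ENNReal.ofReal_le_ofReal (le_abs_self _)).trans
        (ofReal_abs_integral_sub_le_W1 (hφc v).measurable (hφb v hv1) hΛ0
          (lipschitzWith_tensorComb hh (hw v hv1) hK1 hKa hKb))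
    refine (lintegral_mono hpt).trans ?_
    rw [lintegral_const_mul' _ _ ENNReal.coe_ne_top]
    refine mul_le_mul_right ?_ _
    exact le_iSup₂_of_le (ofDensity (F θ)) (hFmem θ) le_rfl

end lowerBound

/-! ### Choice of the parameters -/

/-- The choice of bandwidth, number of bumps and amplitude. For `1 ≤ 2 * β * d` the bandwidth
balances the information constraint against smoothness; for `2 * β * d < 1` a single bump of fixed
width already gives the parametric rate `n ^ (-1 / 2)`. -/
theorem exists_tuning (d : ℕ) {α β c₀ c₁ : ℝ} (hα : 0 < α) (hβ : 0 < β) (hc₀ : 0 < c₀)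
    (hc₁ : 0 < c₁) :
    ∃ c₃, 0 < c₃ ∧ ∀ᶠ n : ℕ in atTop, ∃ (m : ℕ) (h γ : ℝ), 0 < h ∧ h ≤ 1 ∧ 2 * m * h ≤ 1 ∧
      0 ≤ γ ∧ γ ≤ c₀ * h ^ α ∧ n * (γ ^ 2 * h ^ (2 * β * d + 1)) ≤ c₁ ∧
      c₃ ≤ psi d α β n * (γ * h * (m * h) ^ d) := by
  rcases le_or_gt 1 (2 * β * d) with hβd | hβd
  · set p := 2 * α + 2 * β * d + 1 with hp
    have hp0 : 0 < p := by positivity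
    set c' := min c₀ (Real.sqrt c₁) with hc'
    have hc'0 : 0 < c' := lt_min hc₀ (Real.sqrt_pos.mpr hc₁)
    refine ⟨c' * (1 / 4) ^ d, by positivity, ?_⟩
    filter_upwards [eventually_ge_atTop ⌈(4 : ℝ) ^ p⌉₊] with n hn
    have hn4 : (4 : ℝ) ^ p ≤ n := (Nat.le_ceil _).trans (by exact_mod_cast hn)
    have hn0 : (0 : ℝ) < n := lt_of_lt_of_le (by positivity) hn4
    set h := (n : ℝ) ^ (-(1 / p)) with hh
    have hh0 : 0 < h := by positivity
    have hh4 : h ≤ 1 / 4 := by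
      have h1 : (4 : ℝ) ≤ (n : ℝ) ^ (1 / p) := by
        calc (4 : ℝ) = ((4 : ℝ) ^ p) ^ (1 / p) := by
              rw [← Real.rpow_mul (by norm_num), mul_one_div_cancel hp0.ne', Real.rpow_one]
          _ ≤ _ := Real.rpow_le_rpow (by positivity) hn4 (by positivity)
      rw [hh, Real.rpow_neg hn0.le, one_div (4 : ℝ)]
      exact inv_anti₀ (by norm_num) h1
    have hhp : h ^ p = (n : ℝ)⁻¹ := by
      rw [hh, ← Real.rpow_mul hn0.le, neg_mul, one_div_mul_cancel hp0.ne', Real.rpow_neg_one]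
    have hψ : psi d α β n = (h ^ (α + 1))⁻¹ := by
      rw [psi, max_eq_left hβd, ← hp, hh, ← Real.rpow_mul hn0.le, ← Real.rpow_neg hn0.le]
      congr 1
      ring
    set m := ⌊1 / (2 * h)⌋₊ with hm
    have hm1 : (m : ℝ) ≤ 1 / (2 * h) := Nat.floor_le (by positivity)
    have hm2 : 1 / (2 * h) < m + 1 := Nat.lt_floor_add_one _
    rw [le_div_iff₀ (by positivity)] at hm1
    rw [div_lt_iff₀ (by positivity)] at hm2
    have hm3 : 1 / 4 ≤ m * h := by nlinarith
    refine ⟨m, h, c' * h ^ α, hh0, by linarith, by linarith, by positivity, ?_, ?_, ?_⟩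
    · gcongr; exact min_le_left _ _
    · have h1 : (c' * h ^ α) ^ 2 * h ^ (2 * β * d + 1) = c' ^ 2 * h ^ p := by
        rw [mul_pow, mul_assoc, ← Real.rpow_mul_natCast hh0.le, ← Real.rpow_add hh0, hp]
        congr 2
        push_cast; ring
      rw [h1, hhp]
      calc n * (c' ^ 2 * (n : ℝ)⁻¹) = c' ^ 2 := by field_simp
        _ ≤ Real.sqrt c₁ ^ 2 := by gcongr; exact min_le_right _ _
        _ = c₁ := Real.sq_sqrt hc₁.le
    · rw [hψ]
      calc c' * (1 / 4) ^ d ≤ c' * (m * h) ^ d := by gcongr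
        _ = (h ^ (α + 1))⁻¹ * (c' * h ^ α * h * (m * h) ^ d) := by
            rw [Real.rpow_add_one hh0.ne']
            field_simp
  · set c' := min (c₀ * (1 / 2) ^ α) (Real.sqrt c₁) with hc'
    have hc'0 : 0 < c' := lt_min (by positivity) (Real.sqrt_pos.mpr hc₁)
    refine ⟨c' * (1 / 2) * (1 / 2) ^ d, by positivity, ?_⟩
    filter_upwards [eventually_ge_atTop 1] with n hn
    have hn1 : (1 : ℝ) ≤ n := by exact_mod_cast hn
    have hn0 : (0 : ℝ) < n := by linarith
    have hs1 : 1 ≤ Real.sqrt n := Real.one_le_sqrt.mpr hn1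
    have hψ : psi d α β n = Real.sqrt n := by
      rw [psi, max_eq_right hβd.le, Real.sqrt_eq_rpow]
      congr 1
      field_simp
      ring
    refine ⟨1, 1 / 2, c' / Real.sqrt n, by norm_num, by norm_num, by norm_num, by positivity, ?_, ?_,
      ?_⟩
    · exact (div_le_self hc'0.le hs1).trans (min_le_left _ _)
    · have h1 : ((1 : ℝ) / 2) ^ (2 * β * d + 1) ≤ 1 :=
        Real.rpow_le_one (by norm_num) (by norm_num) (by positivity)
      calc n * ((c' / Real.sqrt n) ^ 2 * (1 / 2) ^ (2 * β * d + 1))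
          ≤ n * ((c' / Real.sqrt n) ^ 2 * 1) := by gcongr
        _ = c' ^ 2 := by
            rw [div_pow, Real.sq_sqrt hn0.le]
            field_simp
        _ ≤ Real.sqrt c₁ ^ 2 := by gcongr; exact min_le_right _ _
        _ = c₁ := Real.sq_sqrt hc₁.le
    · rw [hψ, Nat.cast_one, one_mul]
      refine le_of_eq ?_
      have : Real.sqrt n ≠ 0 := by positivity
      field_simp

end Deconvolution

theorem theorem7
    (fε : ℝ → ℝ) (hfε : Deconvolution.IsDensity fε)
    (β : ℝ) (hβ : 0 < β)
    (hdiff : ∀ l < 2, Differentiable ℝ (iteratedDeriv l (Deconvolution.fourier fε)))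
    (c : ℕ → ℝ) (hc : ∀ l ≤ 2, 0 < c l)
    (hbound : ∀ l ≤ 2, ∀ t : ℝ,
      ‖iteratedDeriv l (Deconvolution.fourier fε) t‖ ≤ c l * (1 + |t|) ^ (-(β + (l : ℝ))))
    (d : ℕ) (hd : 1 ≤ d)
    (α L M : ℝ) (hα : 0 < α) (hL : 0 < L) (hM : 0 < M)
    (hD : (Deconvolution.mixingClass d α L M).Nontrivial) :
    ∃ C : ℝ, 0 < C ∧
      ∀ μhat : (n : ℕ) → (Fin n → EuclideanSpace ℝ (Fin d)) →
          Measure (EuclideanSpace ℝ (Fin d)),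
        (∀ n, Deconvolution.IsEstimator (μhat n)) →
        ENNReal.ofReal C <
          liminf (fun n : ℕ => ENNReal.ofReal (Deconvolution.psi d α β n) *
            ⨆ μ ∈ Deconvolution.mixingClass d α L M,
              Deconvolution.risk (Deconvolution.ofDensity fε) (μhat n) μ) atTop := by
  obtain ⟨q, hq⟩ := exists_nat_ge β
  obtain ⟨A, hmom⟩ := Deconvolution.noise_moments hfε hβ hdiff hc hbound
  obtain ⟨c₀, c₁, c₂, hc₀, hc₁, hc₂, hlow⟩ :=
    Deconvolution.exists_minimax_lower_bound hfε hβ hq hmom hd hα hM hD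
  obtain ⟨c₃, hc₃, htune⟩ := Deconvolution.exists_tuning d hα hβ hc₀ hc₁
  refine ⟨c₂ * c₃ / 2, by positivity, fun μhat hest => ?_⟩
  refine lt_of_lt_of_le ((ENNReal.ofReal_lt_ofReal_iff (by positivity)).mpr
    (half_lt_self (by positivity : 0 < c₂ * c₃))) (le_liminf_of_le (by isBoundedDefault) ?_)
  filter_upwards [htune] with n ⟨m, h, γ, hh, hh1, hm, hγ0, hγ, hn, hψ⟩
  have hψ0 : 0 ≤ Deconvolution.psi d α β n := Real.rpow_nonneg (Nat.cast_nonneg n) _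
  calc ENNReal.ofReal (c₂ * c₃)
      ≤ ENNReal.ofReal (Deconvolution.psi d α β n * (c₂ * (γ * h * (m * h) ^ d))) := by
        refine ENNReal.ofReal_le_ofReal ?_
        calc c₂ * c₃ ≤ c₂ * (Deconvolution.psi d α β n * (γ * h * (m * h) ^ d)) := by gcongr
          _ = _ := by ring
    _ = ENNReal.ofReal (Deconvolution.psi d α β n) *
          ENNReal.ofReal (c₂ * (γ * h * (m * h) ^ d)) := ENNReal.ofReal_mul hψ0
    _ ≤ _ := mul_le_mul_right (hlow n m h γ hh hh1 hm hγ0 hγ hn (μhat n) (hest n)) _
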